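/- Let $G$ be an interval graph with $n\ge 1$ vertices, given by closed real intervals $[a_v,b_v]$ (distinct vertices are adjacent iff their intervals intersect), let $w(v)\in\mathbb{Z}_{\ge 0}$ be vertex weights with $w(v)\le M$ for all $v$, where $M\ge 1$ is an integer, and let $k\ge 1$ be an integer. The maximum-weight $k$-colouring problem asks for $k$ pairwise disjoint (possibly empty) independent sets $H_1,\dots,H_k$ of $G$ such that $\sum_{i}\sum_{v\in H_i}w(v)$ is at least $\sum_{v\in S}w(v)$ for every vertex set $S$ that induces a $k$-colourable subgraph. Algorithm MWKF takes as input the list of the $2n$ endpoints sorted by value (left endpoints before right endpoints of the same value), the weights and $k$, and proceeds as follows. 1. Find the maximal cliques $C_1,\dots,C_r$ of $G$, in the order of the sweep over the endpoints. 2. Construct the network $N$ with nodes $C_0=s,C_1,\dots,C_r=t$, arcs $(C_{i-1},C_i)$ of weight $0$ and capacity $k$ for $1\le i\le r$, and, for each vertex $v$ lying exactly in the cliques $C_p,\dots,C_q$, an arc $(C_{p-1},C_q)$ of weight $w(v)$ and capacity $1$. 3. Compute, for the nodes in reverse order, $\pi(x)$, the largest weight of a path from $x$ to $t$ in $N$.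 4. Replace the weight $w_N(x,y)$ of each arc $(x,y)$ by $\pi(x)-\pi(y)-w_N(x,y)\ge 0$; this gives the network $N^U$. 5. Compute a minimum-weight $k$-flow from $s$ to $t$ in $N^U$ by $k$ successive shortest-path augmentations of one unit each (the method of Edmonds and Karp, with node potentials and Dijkstra's algorithm). 6. Let $Q$ be the set of the vertices whose arc carries positive flow. 7. Decompose the flow into $k$ paths from $s$ to $t$, and let $H_i$ consist of the vertices of $Q$ whose arc lies on the $i$-th path. Then the sets $H_1,\dots,H_k$ returned by Algorithm MWKF solve the maximum-weight $k$-colouring problem, and on a unit-cost random access machine (integer addition, subtraction, comparison and memory access at unit cost) the algorithm runs in $O(kMn^2)$ time: there is an absolute constant $C$ such that for all such inputs the number of steps is at most $C\,k\,M\,n^2$. -/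

import Mathlib

namespace MWKF

/-! ## Interval graphs and the maximum-weight `k`-colouring problem -/

/-- The closed real intervals `[a v, b v]` form an interval representation of `G`: distinct vertices
are adjacent exactly when their intervals meet. -/
def IsIntervalModel {n : ℕ} (G : SimpleGraph (Fin n)) (a b : Fin n → ℝ) : Prop :=
  (∀ v, a v ≤ b v) ∧
    ∀ u v, G.Adj u v ↔ u ≠ v ∧ (Set.Icc (a u) (b u) ∩ Set.Icc (a v) (b v)).Nonempty

/-- The real value of an endpoint; `(v, false)` is the left endpoint of the interval of `v` and
`(v, true)` its right endpoint. -/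
def endpointValue {n : ℕ} (a b : Fin n → ℝ) (p : Fin n × Bool) : ℝ :=
  if p.2 then b p.1 else a p.1

/-- `σ` is a sorted list of all `2n` endpoints (`σ i` is the endpoint in position `i`): values do
not decrease and, the intervals being closed, left endpoints precede right endpoints of the same
value. -/
def IsSortedEndpoints {n : ℕ} (a b : Fin n → ℝ) (σ : Fin (2 * n) ≃ Fin n × Bool) : Prop :=
  ∀ i j, i < j →
    endpointValue a b (σ i) < endpointValue a b (σ j) ∨
      (endpointValue a b (σ i) = endpointValue a b (σ j) ∧ ((σ i).2 = true → (σ j).2 = true))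

/-- `H₁, …, H_k` solve the maximum-weight `k`-colouring problem: they are pairwise disjoint
independent sets, and no vertex set inducing a `k`-colourable subgraph weighs more than their
union. -/
def IsMaxWeightColouring {n : ℕ} (G : SimpleGraph (Fin n)) (w : Fin n → ℕ) (k : ℕ)
    (H : Fin k → Finset (Fin n)) : Prop :=
  (∀ i j, i ≠ j → Disjoint (H i) (H j)) ∧
  (∀ i, G.IsIndepSet (H i : Set (Fin n))) ∧
  ∀ S : Finset (Fin n), (G.induce (S : Set (Fin n))).Colorable k →
    ∑ v ∈ S, w v ≤ ∑ i, ∑ v ∈ H i, w v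

/-! ## The machine model

A unit-cost random access machine, programmed in a structured language: integer registers, integer
arrays, addition, subtraction, comparison, conditionals and counted loops. Every literal, register
access, array access, arithmetic operation, comparison, assignment, branch and loop test costs one
step. -/

/-- Names of integer registers. -/
inductive Reg
  | n | k | r | m | base | afterLeft
  | i | j | v | e | u | x | y | c | cur | took
  deriving DecidableEq

/-- Names of integer arrays. -/
inductive Arr
  | endV | endS | weight
  | active | clique | first | last
  | tail | head | cap | wN | wU | pi
  | flow | pot | dist | done | par
  | Q | use | colour
  deriving DecidableEq

/-- A machine state: the contents of the registers and of the arrays. -/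
structure Store where
  reg : Reg → ℤ
  arr : Arr → ℤ → ℤ

/-- Write a register. -/
def Store.setReg (s : Store) (ρ : Reg) (z : ℤ) : Store :=
  { s with reg := Function.update s.reg ρ z }

/-- Write an array cell. -/
def Store.setArr (s : Store) (A : Arr) (i z : ℤ) : Store :=
  { s with arr := Function.update s.arr A (Function.update (s.arr A) i z) }

/-- Integer expressions: literals, registers, array cells, sums and differences. -/
inductive AExp
  | lit (z : ℤ)
  | reg (ρ : Reg)
  | get (A : Arr) (i : AExp)
  | add (a b : AExp)
  | sub (a b : AExp)

/-- The value of an expression. -/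
def AExp.eval (s : Store) : AExp → ℤ
  | .lit z => z
  | .reg ρ => s.reg ρ
  | .get A i => s.arr A (i.eval s)
  | .add a b => a.eval s + b.eval s
  | .sub a b => a.eval s - b.eval s

/-- The number of steps for evaluating an expression. -/
def AExp.cost : AExp → ℕ
  | .lit _ => 1
  | .reg _ => 1
  | .get _ i => i.cost + 1
  | .add a b => a.cost + b.cost + 1
  | .sub a b => a.cost + b.cost + 1

/-- Tests: comparisons of integers and conjunctions. -/
inductive Cond
  | eq (a b : AExp)
  | lt (a b : AExp)
  | le (a b : AExp)
  | and (p q : Cond)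

/-- The truth value of a test. -/
def Cond.eval (s : Store) : Cond → Bool
  | .eq a b => decide (a.eval s = b.eval s)
  | .lt a b => decide (a.eval s < b.eval s)
  | .le a b => decide (a.eval s ≤ b.eval s)
  | .and p q => p.eval s && q.eval s

/-- The number of steps for evaluating a test (both parts of a conjunction are evaluated). -/
def Cond.cost : Cond → ℕ
  | .eq a b => a.cost + b.cost + 1
  | .lt a b => a.cost + b.cost + 1
  | .le a b => a.cost + b.cost + 1
  | .and p q => p.cost + q.cost + 1

/-- Programs. `loop ρ a b p` is `for ρ = a, a + 1, …, b - 1 do p`, where `a` and `b` are evaluated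
once, on entry. -/
inductive Prog
  | skip
  | set (ρ : Reg) (a : AExp)
  | put (A : Arr) (i a : AExp)
  | seq (p q : Prog)
  | ite (t : Cond) (p q : Prog)
  | loop (ρ : Reg) (a b : AExp) (p : Prog)

/-- The state after the first `N` of the steps `f 0`, `f 1`, …. -/
def iterate (f : ℕ → Store → Store) : ℕ → Store → Store
  | 0, s => s
  | N + 1, s => f N (iterate f N s)

/-- The state in which a program halts. -/
def Prog.run : Prog → Store → Store
  | .skip, s => s
  | .set ρ a, s => s.setReg ρ (a.eval s)
  | .put A i a, s => s.setArr A (i.eval s) (a.eval s)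
  | .seq p q, s => q.run (p.run s)
  | .ite t p q, s => if t.eval s then p.run s else q.run s
  | .loop ρ a b p, s =>
      iterate (fun j s' => p.run (s'.setReg ρ (a.eval s + j))) (b.eval s - a.eval s).toNat s

/-- The number of steps a program makes before it halts. In a loop, every iteration costs two steps
(advancing the counter, testing it) besides those of the body, and the exit costs one. -/
def Prog.time : Prog → Store → ℕ
  | .skip, _ => 1
  | .set _ a, _ => a.cost + 1
  | .put _ i a, _ => i.cost + a.cost + 1
  | .seq p q, s => p.time s + q.time (p.run s)
  | .ite t p q, s => t.cost + 1 + (if t.eval s then p.time s else q.time s)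
  | .loop ρ a b p, s =>
      a.cost + b.cost + 1 +
        ∑ j ∈ Finset.range (b.eval s - a.eval s).toNat,
          (2 + p.time ((iterate (fun j s' => p.run (s'.setReg ρ (a.eval s + j))) j s).setReg ρ
            (a.eval s + j)))

instance : Add AExp := ⟨AExp.add⟩
instance : Sub AExp := ⟨AExp.sub⟩

/-- Execute a list of programs one after the other. -/
def block : List Prog → Prog
  | [] => .skip
  | [p] => p
  | p :: q :: l => .seq p (block (q :: l))

/-- A conditional without alternative. -/
def when (t : Cond) (p : Prog) : Prog := .ite t p .skip

/-- Increase an array cell by a given amount. -/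
def incr (A : Arr) (i a : AExp) : Prog := .put A i (AExp.get A i + a)

/-! ## The algorithm

Nodes of the network are `0, …, r` (node `0` is the source `C₀`, node `r` the sink `C_r`). Arc `v`,
for `0 ≤ v < n`, is the `i`-arc of the vertex `v`; arc `n + i`, for `0 ≤ i < r`, is the `c`-arc from
node `i` to node `i + 1`. Thus there are `m = n + r` arcs. -/

open MWKF.AExp in
/-- Step 1: all maximal cliques. Sweep over the sorted endpoints and keep the set of open intervals;
at every right endpoint that directly follows a left endpoint this set is the next maximal clique.
The cells `n * (i - 1), …, n * i - 1` of `clique` hold the characteristic vector of `C_i`. -/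
def step1 : Prog := block [
  .set .r (lit 0),
  .set .base (lit 0),
  .set .afterLeft (lit 0),
  .loop .v (lit 0) (reg .n) (.put .active (reg .v) (lit 0)),
  .loop .j (lit 0) (reg .n + reg .n) (block [
    .set .x (get .endV (reg .j)),
    .ite (.eq (get .endS (reg .j)) (lit 0))
      (block [
        .put .active (reg .x) (lit 1),
        .set .afterLeft (lit 1)])
      (block [
        when (.eq (reg .afterLeft) (lit 1)) (block [
          .loop .v (lit 0) (reg .n)
            (.put .clique (reg .base + reg .v) (get .active (reg .v))),
          .set .base (reg .base + reg .n),
          .set .r (reg .r + lit 1)]),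
        .put .active (reg .x) (lit 0),
        .set .afterLeft (lit 0)])])]

open MWKF.AExp in
/-- Step 2: the network `N`. If `C_p, …, C_q` are the cliques containing `v`, then the `i`-arc of
`v` goes from `C_{p-1}` to `C_q` with weight `w(v)` and capacity `1`; the `c`-arcs have weight `0`
and capacity `k`. -/
def step2 : Prog := block [
  .loop .v (lit 0) (reg .n) (block [
    .put .first (reg .v) (lit 0),
    .put .last (reg .v) (lit 0)]),
  .set .base (lit 0),
  .loop .i (lit 1) (reg .r + lit 1) (block [
    .loop .v (lit 0) (reg .n)
      (when (.eq (get .clique (reg .base + reg .v)) (lit 1)) (block [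
        when (.eq (get .first (reg .v)) (lit 0)) (.put .first (reg .v) (reg .i)),
        .put .last (reg .v) (reg .i)])),
    .set .base (reg .base + reg .n)]),
  .set .m (reg .n + reg .r),
  .loop .v (lit 0) (reg .n) (block [
    .put .tail (reg .v) (get .first (reg .v) - lit 1),
    .put .head (reg .v) (get .last (reg .v)),
    .put .wN (reg .v) (get .weight (reg .v)),
    .put .cap (reg .v) (lit 1)]),
  .loop .i (lit 0) (reg .r) (block [
    .put .tail (reg .n + reg .i) (reg .i),
    .put .head (reg .n + reg .i) (reg .i + lit 1),
    .put .wN (reg .n + reg .i) (lit 0),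
    .put .cap (reg .n + reg .i) (reg .k)])]

open MWKF.AExp in
/-- Step 3: the array `π`, where `π(u)` is the largest weight of a path of `N` from `u` to the sink;
the nodes are treated in the order `r - 1, …, 0`. -/
def step3 : Prog := block [
  .loop .i (lit 0) (reg .r + lit 1) (.put .pi (reg .i) (lit 0)),
  .loop .i (lit 0) (reg .r) (block [
    .set .u (reg .r - lit 1 - reg .i),
    .loop .e (lit 0) (reg .m)
      (when (.eq (get .tail (reg .e)) (reg .u)) (block [
        .set .c (get .wN (reg .e) + get .pi (get .head (reg .e))),
        when (.lt (get .pi (reg .u)) (reg .c)) (.put .pi (reg .u) (reg .c))]))])]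

open MWKF.AExp in
/-- Step 4: the network `N^U`, with the weights `π(u) - π(v) - w_N(u, v)`. -/
def step4 : Prog :=
  .loop .e (lit 0) (reg .m)
    (.put .wU (reg .e)
      (get .pi (get .tail (reg .e)) - get .pi (get .head (reg .e)) - get .wN (reg .e)))

open MWKF.AExp in
/-- One relaxation: the node in register `y` can be reached over the arc in register `e` at the
tentative distance in register `c`. The distance `-1` stands for infinity. -/
def relax : Prog :=
  when (.eq (get .done (reg .y)) (lit 0))
    (.ite (.lt (get .dist (reg .y)) (lit 0))
      (block [.put .dist (reg .y) (reg .c), .put .par (reg .y) (reg .e)])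
      (when (.lt (reg .c) (get .dist (reg .y)))
        (block [.put .dist (reg .y) (reg .c), .put .par (reg .y) (reg .e)])))

open MWKF.AExp in
/-- Dijkstra's algorithm: shortest paths from the source in the residual network of the current
flow, for the weights of `N^U` reduced by the node potentials `pot`. `par` records the last arc of
a shortest path to each node. -/
def shortestPaths : Prog := block [
  .loop .v (lit 0) (reg .r + lit 1) (block [
    .put .dist (reg .v) (lit (-1)),
    .put .done (reg .v) (lit 0)]),
  .put .dist (lit 0) (lit 0),
  .loop .i (lit 0) (reg .r + lit 1) (block [
    .set .u (lit (-1)),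
    .loop .v (lit 0) (reg .r + lit 1)
      (when (.and (.eq (get .done (reg .v)) (lit 0)) (.le (lit 0) (get .dist (reg .v))))
        (.ite (.eq (reg .u) (lit (-1)))
          (.set .u (reg .v))
          (when (.lt (get .dist (reg .v)) (get .dist (reg .u))) (.set .u (reg .v))))),
    when (.le (lit 0) (reg .u)) (block [
      .put .done (reg .u) (lit 1),
      .loop .e (lit 0) (reg .m) (block [
        when (.and (.eq (get .tail (reg .e)) (reg .u))
            (.lt (get .flow (reg .e)) (get .cap (reg .e)))) (block [
          .set .y (get .head (reg .e)),
          .set .c (get .dist (reg .u) + (get .wU (reg .e) + get .pot (reg .u)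
            - get .pot (reg .y))),
          relax]),
        when (.and (.eq (get .head (reg .e)) (reg .u))
            (.lt (lit 0) (get .flow (reg .e)))) (block [
          .set .y (get .tail (reg .e)),
          .set .c (get .dist (reg .u) + (get .pot (reg .u) - get .wU (reg .e)
            - get .pot (reg .y))),
          relax])])])])]

open MWKF.AExp in
/-- Send one unit of flow along the shortest path to the sink, following `par` backwards. An arc
that is used forwards ends in the current node `x`, an arc that is used backwards starts there. -/
def augment : Prog := block [
  .set .x (reg .r),
  .loop .i (lit 0) (reg .r)
    (when (.lt (lit 0) (reg .x)) (block [
      .set .e (get .par (reg .x)),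
      .ite (.eq (get .head (reg .e)) (reg .x))
        (block [incr .flow (reg .e) (lit 1), .set .x (get .tail (reg .e))])
        (block [incr .flow (reg .e) (lit (-1)), .set .x (get .head (reg .e))])]))]

open MWKF.AExp in
/-- Step 5: a minimum-weight `k`-flow in `N^U` by successive shortest paths (the method of Edmonds
and Karp): `k` times, find shortest paths for the reduced weights, add the distances to the
potentials and augment the flow by one unit. -/
def step5 : Prog := block [
  .loop .e (lit 0) (reg .m) (.put .flow (reg .e) (lit 0)),
  .loop .v (lit 0) (reg .r + lit 1) (.put .pot (reg .v) (lit 0)),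
  .loop .j (lit 0) (reg .k) (block [
    shortestPaths,
    .loop .v (lit 0) (reg .r + lit 1)
      (when (.le (lit 0) (get .dist (reg .v))) (incr .pot (reg .v) (get .dist (reg .v)))),
    augment])]

open MWKF.AExp in
/-- Step 6: the characteristic vector of the set `Q` of the vertices whose `i`-arc carries flow. -/
def step6 : Prog :=
  .loop .v (lit 0) (reg .n)
    (.ite (.lt (lit 0) (get .flow (reg .v))) (.put .Q (reg .v) (lit 1)) (.put .Q (reg .v) (lit 0)))

open MWKF.AExp in
/-- Step 7: distribute the vertices of `Q` to `k` colour classes, by decomposing the flow into `k`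
paths from the source to the sink; the vertices of `Q` on the `j`-th path get the colour `j`.
Vertices outside `Q` get the colour `0`, which means uncoloured. -/
def step7 : Prog := block [
  .loop .v (lit 0) (reg .n) (block [
    .put .colour (reg .v) (lit 0),
    .put .use (reg .v) (get .Q (reg .v))]),
  .loop .e (reg .n) (reg .m) (.put .use (reg .e) (get .flow (reg .e))),
  .loop .j (lit 1) (reg .k + lit 1) (block [
    .set .cur (lit 0),
    .loop .u (lit 0) (reg .r)
      (when (.eq (reg .cur) (reg .u)) (block [
        .set .took (lit 0),
        .loop .e (lit 0) (reg .m)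
          (when (.and (.eq (reg .took) (lit 0)) (.and (.eq (get .tail (reg .e)) (reg .u))
              (.lt (lit 0) (get .use (reg .e))))) (block [
            incr .use (reg .e) (lit (-1)),
            .set .cur (get .head (reg .e)),
            .set .took (lit 1),
            when (.lt (reg .e) (reg .n)) (.put .colour (reg .e) (reg .j))]))]))])]

/-- Algorithm MWKF. -/
def algorithm : Prog := block [step1, step2, step3, step4, step5, step6, step7]

/-- The initial state: the registers `n` and `k` hold `n` and `k`, the cells `i < 2n` of `endV` and
`endS` hold the vertex and the side (`0` left, `1` right) of the `i`-th endpoint, the cells `v < n`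
of `weight` hold the weights, and everything else is `0`. -/
def input {n : ℕ} (σ : Fin (2 * n) ≃ Fin n × Bool) (w : Fin n → ℕ) (k : ℕ) : Store where
  reg
    | .n => n
    | .k => k
    | _ => 0
  arr
    | .endV => fun z => if h : z.toNat < 2 * n ∧ 0 ≤ z then ((σ ⟨z.toNat, h.1⟩).1 : ℕ) else 0
    | .endS => fun z =>
        if h : z.toNat < 2 * n ∧ 0 ≤ z then (if (σ ⟨z.toNat, h.1⟩).2 then 1 else 0) else 0
    | .weight => fun z => if h : z.toNat < n ∧ 0 ≤ z then (w ⟨z.toNat, h.1⟩ : ℤ) else 0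
    | _ => fun _ => 0

/-- The colour classes `H₁, …, H_k` in a final state (here indexed from `0`). -/
def colourClasses (n k : ℕ) (s : Store) (i : Fin k) : Finset (Fin n) :=
  {v | s.arr .colour (v : ℕ) = (i : ℕ) + 1}

end MWKF

/-! Call a right endpoint that directly follows a left endpoint a turn. The arc of a vertex runs
from the number of turns before its left endpoint to the number of turns up to and including its
right endpoint. Between a left endpoint and any later right endpoint there is a turn, so the tail of
`u` lies below the head of `v` iff `a u ≤ b v`, and distinct vertices are adjacent exactly when
their arcs overlap (`adj_iff_arcs_overlap`). Hence the vertices on one path of the network are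
independent, and the vertices whose arcs cross a common cut form a clique.

All arcs point upwards, so flow conservation amounts to this: every cut between `{0, …, i - 1}` and
`{i, …, r}` carries the same amount. A `k`-colourable set crosses each cut at most `k` times, and
the c-arcs can fill every cut up to exactly `k` (`exists_isFlow`). Conversely a `k`-flow splits into
`k` paths (`Decomposition`), whose vertices form the colour classes. What is needed is therefore a
`k`-flow of largest weight.

Its optimality is linear programming duality. The total of potential drop times flow depends only on
the values of the cuts (`sum_potential`), so complementary slackness with any potential is enough
(`IsFlow.optimal`). The potential used is `π + φ`, with `φ` the final node potential of step 5. Of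
`π` only the inequality `w_N + π(head) ≤ π(tail)` matters; it makes the weights of `N^U`
nonnegative. Step 5 maintains that no residual arc has negative reduced cost: adding the Dijkstra
distances to the potentials preserves this for the old residual arcs and makes the arcs of the
shortest-path tree cost `0`, so that reversing some of them does no harm. While `j < k` units flow,
no c-arc is saturated, so every node stays reachable.

For the running time, the ranges of the loops in each step depend only on registers which that step
leaves alone, so the number of steps is bounded by an expression read off the program text
(`Prog.time_le_bound`). Distinct turns belong to distinct vertices, so `r ≤ n` and there are at most
`2n` arcs; each of the `k` shortest-path rounds and of the `k` path tracings costs `O(n²)`, and so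
does everything else together. -/

namespace MWKF

/-! ## Reasoning about programs -/

/-- Whether a program contains an assignment to a given register. -/
def Prog.writesReg : Prog → Reg → Bool
  | .skip, _ => false
  | .set ρ _, ρ' => decide (ρ = ρ')
  | .put _ _ _, _ => false
  | .seq p q, ρ => p.writesReg ρ || q.writesReg ρ
  | .ite _ p q, ρ => p.writesReg ρ || q.writesReg ρ
  | .loop ρ _ _ p, ρ' => decide (ρ = ρ') || p.writesReg ρ'

/-- Whether a program contains an assignment to a cell of a given array. -/
def Prog.writesArr : Prog → Arr → Bool
  | .skip, _ => false
  | .set _ _, _ => false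
  | .put A _ _, A' => decide (A = A')
  | .seq p q, A => p.writesArr A || q.writesArr A
  | .ite _ p q, A => p.writesArr A || q.writesArr A
  | .loop _ _ _ p, A => p.writesArr A

/-- The stores `s` and `s'` agree outside of what `p` assigns to. -/
structure Frame (p : Prog) (s s' : Store) : Prop where
  reg : ∀ ρ, p.writesReg ρ = false → s'.reg ρ = s.reg ρ
  arr : ∀ A, p.writesArr A = false → s'.arr A = s.arr A

theorem Frame.refl (p : Prog) (s : Store) : Frame p s s := ⟨fun _ _ => rfl, fun _ _ => rfl⟩

theorem iterate_induction {f : ℕ → Store → Store} {I : ℕ → Store → Prop} {N : ℕ} {s : Store}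
    (h0 : I 0 s) (hs : ∀ j s', j < N → I j s' → I (j + 1) (f j s')) :
    ∀ j, j ≤ N → I j (iterate f j s)
  | 0, _ => h0
  | j + 1, h => hs j _ h (iterate_induction h0 hs j (by omega))

/-- `writesReg` and `writesArr` are computed from the program text, so facts about untouched
registers and arrays pass through any piece of code with a side condition closed by `rfl`. -/
theorem Frame.run (p : Prog) (s : Store) : Frame p s (p.run s) := by
  induction p generalizing s with
  | skip => exact Frame.refl _ _
  | set ρ a =>
    refine ⟨fun ρ' h => ?_, fun _ _ => rfl⟩
    have h' : ρ' ≠ ρ := by rintro rfl; simp [Prog.writesReg] at h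
    simp [Prog.run, Store.setReg, h']
  | put A i a =>
    refine ⟨fun _ _ => rfl, fun A' h => ?_⟩
    have h' : A' ≠ A := by rintro rfl; simp [Prog.writesArr] at h
    simp [Prog.run, Store.setArr, h']
  | seq p q hp hq =>
    refine ⟨fun ρ h => ?_, fun A h => ?_⟩
    · simp only [Prog.writesReg, Bool.or_eq_false_iff] at h
      exact ((hq _).reg ρ h.2).trans ((hp s).reg ρ h.1)
    · simp only [Prog.writesArr, Bool.or_eq_false_iff] at h
      exact ((hq _).arr A h.2).trans ((hp s).arr A h.1)
  | ite t p q hp hq =>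
    simp only [Prog.run]
    refine ⟨fun ρ h => ?_, fun A h => ?_⟩
    · simp only [Prog.writesReg, Bool.or_eq_false_iff] at h
      split_ifs
      exacts [(hp s).reg ρ h.1, (hq s).reg ρ h.2]
    · simp only [Prog.writesArr, Bool.or_eq_false_iff] at h
      split_ifs
      exacts [(hp s).arr A h.1, (hq s).arr A h.2]
  | loop ρ a b p hp =>
    simp only [Prog.run]
    refine iterate_induction (I := fun _ s' => Frame (.loop ρ a b p) s s') (Frame.refl _ _)
      (fun j s' _ h => ⟨fun ρ' h' => ?_, fun A h' => ?_⟩) _ le_rfl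
    · have h1 := h.reg ρ' h'
      simp only [Prog.writesReg, Bool.or_eq_false_iff, decide_eq_false_iff_not] at h'
      rw [(hp _).reg ρ' h'.2, ← h1]
      simp [Store.setReg, Ne.symm h'.1]
    · rw [(hp _).arr A h', ← h.arr A h']
      rfl

/-- The counter counts as written by its loop, so the frame survives setting it at the start of an
iteration. -/
theorem Frame.setReg {ρ : Reg} {a b : AExp} {p : Prog} {s s' : Store}
    (h : Frame (.loop ρ a b p) s s') (z : ℤ) : Frame (.loop ρ a b p) s (s'.setReg ρ z) := by
  refine ⟨fun ρ' h' => ?_, h.arr⟩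
  rw [← h.reg ρ' h']
  simp only [Prog.writesReg, Bool.or_eq_false_iff, decide_eq_false_iff_not] at h'
  simp [Store.setReg, Ne.symm h'.1]

/-- Invariants of counted loops. -/
theorem Prog.run_loop {ρ : Reg} {a b : AExp} {p : Prog} {s : Store} (I : ℤ → Store → Prop)
    {x y : ℤ} (hx : a.eval s = x) (hy : b.eval s = y) (hxy : x ≤ y) (h0 : I x s)
    (hs : ∀ i s', x ≤ i → i < y → Frame (.loop ρ a b p) s s' → I i s' →
      I (i + 1) (p.run (s'.setReg ρ i))) :
    I y ((Prog.loop ρ a b p).run s) := by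
  subst hx hy
  -- The frame is carried through the induction, so that an invariant `I` need only mention what the
  -- body changes.
  have key := iterate_induction
    (I := fun j s' => I (a.eval s + j) s' ∧ Frame (.loop ρ a b p) s s')
    (f := fun j s' => p.run (s'.setReg ρ (a.eval s + j)))
    (N := (b.eval s - a.eval s).toNat) (s := s) ⟨by simpa using h0, Frame.refl _ _⟩
    (fun j s' hj h => ⟨by
      have := hs (a.eval s + j) s' (by omega) (by omega) h.2 h.1
      simpa [add_assoc] using this, by
      have h1 := h.2.setReg (a.eval s + j)
      have h2 := Frame.run p (s'.setReg ρ (a.eval s + j))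
      refine ⟨fun ρ' h' => ?_, fun A h' => ?_⟩
      · rw [← h1.reg ρ' h']
        simp only [Prog.writesReg, Bool.or_eq_false_iff] at h'
        exact h2.reg ρ' h'.2
      · rw [← h1.arr A h']
        exact h2.arr A h'⟩) _ le_rfl
  have h := key.1
  have e : a.eval s + ((b.eval s - a.eval s).toNat : ℤ) = b.eval s := by omega
  rw [e] at h
  exact h

/-! ### Syntactic bounds for the number of steps -/

/-- An expression whose value depends only on the registers in `X`. -/
def AExp.over (X : List Reg) : AExp → Bool
  | .lit _ => true
  | .reg ρ => X.contains ρ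
  | .get _ _ => false
  | .add a b => a.over X && b.over X
  | .sub a b => a.over X && b.over X

theorem AExp.eval_congr {X : List Reg} {s s' : Store} (h : ∀ ρ ∈ X, s'.reg ρ = s.reg ρ)
    {a : AExp} (ha : a.over X = true) : a.eval s' = a.eval s := by
  induction a with
  | lit z => rfl
  | reg ρ => exact h ρ (by simpa [AExp.over] using ha)
  | get A i _ => simp [AExp.over] at ha
  | add a b iha ihb =>
    simp only [AExp.over, Bool.and_eq_true] at ha
    simp [AExp.eval, iha ha.1, ihb ha.2]
  | sub a b iha ihb =>
    simp only [AExp.over, Bool.and_eq_true] at ha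
    simp [AExp.eval, iha ha.1, ihb ha.2]

/-- The ranges of all loops of the program are determined by the registers in `X`, which the
program does not change. -/
def Prog.regular (X : List Reg) : Prog → Bool
  | .skip => true
  | .set ρ _ => !X.contains ρ
  | .put _ _ _ => true
  | .seq p q => p.regular X && q.regular X
  | .ite _ p q => p.regular X && q.regular X
  | .loop ρ a b p => !X.contains ρ && (a.over X && (b.over X && p.regular X))

/-- An upper bound for the number of steps of a regular program. -/
def Prog.bound (s : Store) : Prog → ℕ
  | .skip => 1
  | .set _ a => a.cost + 1
  | .put _ i a => i.cost + a.cost + 1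
  | .seq p q => p.bound s + q.bound s
  | .ite t p q => t.cost + 1 + (p.bound s + q.bound s)
  | .loop _ a b p => a.cost + b.cost + 1 + (b.eval s - a.eval s).toNat * (2 + p.bound s)

theorem Prog.regular.run {X : List Reg} {p : Prog} (hp : p.regular X = true) (s : Store) :
    ∀ ρ ∈ X, (p.run s).reg ρ = s.reg ρ := by
  intro ρ hρ
  refine (Frame.run p s).reg ρ ?_
  clear s
  induction p with
  | skip => rfl
  | set ρ' a =>
    simp only [Prog.writesReg, decide_eq_false_iff_not]
    rintro rfl
    simp [Prog.regular, hρ] at hp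
  | put => rfl
  | seq p q ihp ihq =>
    simp only [Prog.regular, Bool.and_eq_true] at hp
    simp [Prog.writesReg, ihp hp.1, ihq hp.2]
  | ite t p q ihp ihq =>
    simp only [Prog.regular, Bool.and_eq_true] at hp
    simp [Prog.writesReg, ihp hp.1, ihq hp.2]
  | loop ρ' a b p ihp =>
    simp only [Prog.regular, Bool.and_eq_true] at hp
    simp only [Prog.writesReg, ihp hp.2.2.2, Bool.or_false, decide_eq_false_iff_not]
    rintro rfl
    simp [hρ] at hp

/-- Since the registers in `X` never change, a nested loop has the same range whenever it is
entered, and all iterations of a loop share one bound. The store `s` only fixes the values of these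
registers; the induction needs `s'` to vary, as subprograms start in intermediate states. -/
theorem Prog.time_le_bound {X : List Reg} {s : Store} {p : Prog} (hp : p.regular X = true) :
    ∀ s' : Store, (∀ ρ ∈ X, s'.reg ρ = s.reg ρ) → p.time s' ≤ p.bound s := by
  induction p with
  | skip => intros; simp [Prog.time, Prog.bound]
  | set ρ a => intros; rfl
  | put A i a => intros; rfl
  | seq p q ihp ihq =>
    intro s' h
    simp only [Prog.regular, Bool.and_eq_true] at hp
    exact Nat.add_le_add (ihp hp.1 s' h)
      (ihq hp.2 _ fun ρ hρ => (Prog.regular.run hp.1 s' ρ hρ).trans (h ρ hρ))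
  | ite t p q ihp ihq =>
    intro s' h
    simp only [Prog.regular, Bool.and_eq_true] at hp
    simp only [Prog.time, Prog.bound]
    have h1 := ihp hp.1 s' h
    have h2 := ihq hp.2 s' h
    split_ifs <;> omega
  | loop ρ a b p ihp =>
    intro s' h
    simp only [Prog.regular, Bool.and_eq_true, Bool.not_eq_true', ] at hp
    obtain ⟨hρ, ha, hb, hp⟩ := hp
    have hset : ∀ (t : Store) (z : ℤ), (∀ ρ ∈ X, t.reg ρ = s.reg ρ) →
        ∀ ρ' ∈ X, (t.setReg ρ z).reg ρ' = s.reg ρ' := by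
      intro t z ht ρ' hρ'
      have : ρ' ≠ ρ := by rintro rfl; simp [hρ'] at hρ
      simpa [Store.setReg, this] using ht ρ' hρ'
    simp only [Prog.time, Prog.bound, AExp.eval_congr h ha, AExp.eval_congr h hb]
    refine Nat.add_le_add_left ?_ _
    have := Finset.sum_le_card_nsmul (Finset.range (b.eval s - a.eval s).toNat)
      (fun j => 2 + p.time ((iterate (fun j s' => p.run (s'.setReg ρ (a.eval s + j))) j s').setReg ρ
            (a.eval s + j))) (2 + p.bound s) (fun j _ => ?_)
    · simpa using this
    · refine Nat.add_le_add_left (ihp hp _ (hset _ _ ?_)) _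
      exact iterate_induction (I := fun _ t => ∀ ρ ∈ X, t.reg ρ = s.reg ρ) (N := j) h
        (fun i t _ ht ρ' hρ' => (Prog.regular.run hp _ ρ' hρ').trans (hset t _ ht ρ' hρ')) j le_rfl

/-! ### Evaluation rules -/

theorem AExp.eval_sub (s : Store) (a b : AExp) : (a - b).eval s = a.eval s - b.eval s := rfl

theorem AExp.cost_sub (a b : AExp) : (a - b).cost = a.cost + b.cost + 1 := rfl

theorem Store.reg_setReg (s : Store) (ρ ρ' : Reg) (z : ℤ) :
    (s.setReg ρ z).reg ρ' = if ρ' = ρ then z else s.reg ρ' := by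
  simp [Store.setReg, Function.update_apply]

theorem Store.arr_setReg (s : Store) (ρ : Reg) (z : ℤ) : (s.setReg ρ z).arr = s.arr := rfl

theorem Store.reg_setArr (s : Store) (A : Arr) (i z : ℤ) : (s.setArr A i z).reg = s.reg := rfl

theorem Store.arr_setArr (s : Store) (A A' : Arr) (i z : ℤ) :
    (s.setArr A i z).arr A' = if A' = A then Function.update (s.arr A) i z else s.arr A' := by
  simp [Store.setArr, Function.update_apply]

theorem block_run_nil (s : Store) : (block []).run s = s := rfl

theorem block_run_cons (p : Prog) (l : List Prog) (s : Store) :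
    (block (p :: l)).run s = (block l).run (p.run s) := by
  cases l <;> rfl

theorem run_when (t : Cond) (p : Prog) (s : Store) :
    (when t p).run s = if t.eval s = true then p.run s else s := rfl

theorem run_incr (A : Arr) (i a : AExp) (s : Store) :
    (incr A i a).run s = s.setArr A (i.eval s) (s.arr A (i.eval s) + a.eval s) := rfl

theorem run_set (ρ : Reg) (a : AExp) (s : Store) : (Prog.set ρ a).run s = s.setReg ρ (a.eval s) :=
  rfl

theorem run_put (A : Arr) (i a : AExp) (s : Store) :
    (Prog.put A i a).run s = s.setArr A (i.eval s) (a.eval s) := rfl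

theorem run_ite (t : Cond) (p q : Prog) (s : Store) :
    (Prog.ite t p q).run s = if t.eval s = true then p.run s else q.run s := rfl

/-! ## The sweep over the endpoints -/

section Sweep

variable {n : ℕ} (σ : Fin (2 * n) ≃ Fin n × Bool)

/-- Whether the endpoint in position `i` is a right endpoint. -/
def isRight (i : ℕ) : Bool := if h : i < 2 * n then (σ ⟨i, h⟩).2 else false

/-- Position `i` holds a right endpoint that directly follows a left endpoint. -/
def IsTurn (i : ℕ) : Prop := 0 < i ∧ isRight σ i = true ∧ isRight σ (i - 1) = false

instance : DecidablePred (IsTurn σ) := fun _ => inferInstanceAs (Decidable (_ ∧ _ ∧ _))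

/-- The number of turns before position `i`. -/
def turns (i : ℕ) : ℕ := Nat.count (IsTurn σ) i

/-- The position of the left endpoint of `v`. -/
def leftPos (v : Fin n) : ℕ := σ.symm (v, false)

/-- The position of the right endpoint of `v`. -/
def rightPos (v : Fin n) : ℕ := σ.symm (v, true)

theorem rightPos_lt (v : Fin n) : rightPos σ v < 2 * n := (σ.symm (v, true)).isLt

theorem isRight_leftPos (v : Fin n) : isRight σ (leftPos σ v) = false := by
  simp [isRight, leftPos]

theorem isRight_rightPos (v : Fin n) : isRight σ (rightPos σ v) = true := by
  simp [isRight, rightPos]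

theorem eq_leftPos {i : ℕ} (h : i < 2 * n) (hi : isRight σ i = false) :
    i = leftPos σ (σ ⟨i, h⟩).1 := by
  have : σ ⟨i, h⟩ = ((σ ⟨i, h⟩).1, false) := by
    rw [isRight, dif_pos h] at hi
    exact Prod.ext rfl hi
  rw [leftPos, ← this, Equiv.symm_apply_apply]

theorem eq_rightPos {i : ℕ} (h : i < 2 * n) (hi : isRight σ i = true) :
    i = rightPos σ (σ ⟨i, h⟩).1 := by
  have : σ ⟨i, h⟩ = ((σ ⟨i, h⟩).1, true) := by
    rw [isRight, dif_pos h] at hi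
    exact Prod.ext rfl hi
  rw [rightPos, ← this, Equiv.symm_apply_apply]

theorem leftPos_injective : Function.Injective (leftPos σ) := fun u v h => by
  have := σ.symm.injective (Fin.ext h)
  exact (Prod.ext_iff.1 this).1

theorem rightPos_injective : Function.Injective (rightPos σ) := fun u v h => by
  have := σ.symm.injective (Fin.ext h)
  exact (Prod.ext_iff.1 this).1

theorem leftPos_ne_rightPos (u v : Fin n) : leftPos σ u ≠ rightPos σ v := fun h => by
  have := isRight_leftPos σ u
  rw [h, isRight_rightPos] at this
  exact absurd this (by simp)

theorem turns_mono {i j : ℕ} (h : i ≤ j) : turns σ i ≤ turns σ j := Nat.count_monotone _ h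

theorem turns_succ_of_isTurn {i : ℕ} (h : IsTurn σ i) : turns σ (i + 1) = turns σ i + 1 := by
  simp [turns, Nat.count_succ, h]

theorem turns_succ_of_not_isTurn {i : ℕ} (h : ¬ IsTurn σ i) : turns σ (i + 1) = turns σ i := by
  simp [turns, Nat.count_succ, h]

/-- Going back from `j` through consecutive right endpoints, one must meet a left endpoint, at `i`
at the latest; the right endpoint just after it is a turn. -/
theorem exists_isTurn {i : ℕ} (hi : isRight σ i = false) :
    ∀ {j : ℕ}, i < j → isRight σ j = true → ∃ t, i < t ∧ t ≤ j ∧ IsTurn σ t := by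
  intro j
  induction j with
  | zero => intro h; omega
  | succ j ih =>
    intro h hj
    by_cases hr : isRight σ j = true
    · have : i ≠ j := by rintro rfl; simp [hi] at hr
      obtain ⟨t, h1, h2, h3⟩ := ih (by omega) hr
      exact ⟨t, h1, by omega, h3⟩
    · exact ⟨j + 1, h, le_rfl, by omega, hj, by simpa using hr⟩

/-- Replaces positions in the sorted list by nodes of the network. The `+ 1` lets a turn at the
right endpoint of `v` itself be counted. -/
theorem turns_lt_turns_iff (u v : Fin n) :
    turns σ (leftPos σ u) < turns σ (rightPos σ v + 1) ↔ leftPos σ u < rightPos σ v := by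
  constructor
  · intro h
    by_contra! h'
    have := leftPos_ne_rightPos σ u v
    exact absurd (turns_mono σ (show rightPos σ v + 1 ≤ leftPos σ u by omega)) (by omega)
  · intro h
    obtain ⟨t, h1, h2, h3⟩ := exists_isTurn σ (isRight_leftPos σ u) h (isRight_rightPos σ v)
    have := turns_succ_of_isTurn σ h3
    have := turns_mono σ h1.le
    have := turns_mono σ (show t + 1 ≤ rightPos σ v + 1 by omega)
    omega

/-- Different turns are right endpoints of different vertices. This is the bound `r ≤ n` behind the
running time. -/
theorem turns_le : turns σ (2 * n) ≤ n := by
  rw [turns, Nat.count_eq_card_filter_range]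
  calc _ ≤ (Finset.univ.image (rightPos σ)).card := Finset.card_le_card fun t ht => by
        simp only [Finset.mem_filter, Finset.mem_range] at ht
        exact Finset.mem_image.2 ⟨_, Finset.mem_univ _, (eq_rightPos σ ht.1 ht.2.2.1).symm⟩
    _ ≤ n := Finset.card_image_le.trans (by simp)

variable {σ} in
-- The tie rule enters here: when `a u = b v`, the left endpoint comes first, as it must for closed
-- intervals that touch.
theorem leftPos_lt_rightPos_iff {a b : Fin n → ℝ} (hσ : IsSortedEndpoints a b σ) (u v : Fin n) :
    leftPos σ u < rightPos σ v ↔ a u ≤ b v := by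
  constructor
  · intro h
    have := hσ (σ.symm (u, false)) (σ.symm (v, true)) h
    simp only [Equiv.apply_symm_apply, endpointValue] at this
    rcases this with h | h
    · exact h.le
    · exact h.1.le
  · intro h
    by_contra! h'
    have := hσ (σ.symm (v, true)) (σ.symm (u, false))
      (lt_of_le_of_ne h' fun h => leftPos_ne_rightPos σ u v (congrArg Fin.val h).symm)
    simp only [Equiv.apply_symm_apply, endpointValue] at this
    rcases this with h1 | h1
    · simp only [Bool.false_eq_true, ↓reduceIte] at h1
      linarith
    · simp at h1

/-- The first node of the `i`-arc of a vertex. -/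
def arcTail (z : ℤ) : ℤ := if h : z.toNat < n then turns σ (leftPos σ ⟨z.toNat, h⟩) else 0

/-- The last node of the `i`-arc of a vertex. -/
def arcHead (z : ℤ) : ℤ := if h : z.toNat < n then turns σ (rightPos σ ⟨z.toNat, h⟩ + 1) else 0

theorem arcTail_coe (v : Fin n) : arcTail σ (v : ℕ) = turns σ (leftPos σ v) := by
  simp [arcTail]

theorem arcHead_coe (v : Fin n) : arcHead σ (v : ℕ) = turns σ (rightPos σ v + 1) := by
  simp [arcHead]

theorem exists_fin_eq {n : ℕ} {z : ℤ} (h0 : 0 ≤ z) (h1 : z < n) : ∃ v : Fin n, ((v : ℕ) : ℤ) = z :=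
  ⟨⟨z.toNat, by omega⟩, by simp [h0]⟩

theorem arcTail_nonneg (z : ℤ) : 0 ≤ arcTail σ z := by
  unfold arcTail; split_ifs <;> omega

theorem arcHead_le (z : ℤ) : arcHead σ z ≤ turns σ (2 * n) := by
  unfold arcHead
  split_ifs with h
  · have := turns_mono σ (show rightPos σ ⟨z.toNat, h⟩ + 1 ≤ 2 * n from rightPos_lt σ _)
    omega
  · omega

variable {σ} in
theorem arcTail_lt_arcHead_iff {a b : Fin n → ℝ} (hσ : IsSortedEndpoints a b σ) (u v : Fin n) :
    arcTail σ (u : ℕ) < arcHead σ (v : ℕ) ↔ a u ≤ b v := by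
  rw [arcTail_coe, arcHead_coe, Nat.cast_lt, turns_lt_turns_iff, leftPos_lt_rightPos_iff hσ]

variable {σ} in
/-- Distinct vertices are adjacent exactly when their arcs overlap. -/
theorem adj_iff_arcs_overlap {G : SimpleGraph (Fin n)} {a b : Fin n → ℝ}
    (hG : IsIntervalModel G a b) (hσ : IsSortedEndpoints a b σ) (u v : Fin n) :
    G.Adj u v ↔ u ≠ v ∧ arcTail σ (u : ℕ) < arcHead σ (v : ℕ) ∧
      arcTail σ (v : ℕ) < arcHead σ (u : ℕ) := by
  rw [hG.2, arcTail_lt_arcHead_iff hσ, arcTail_lt_arcHead_iff hσ, Set.Icc_inter_Icc,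
    Set.nonempty_Icc, sup_le_iff, le_inf_iff, le_inf_iff]
  have := hG.1 u
  have := hG.1 v
  tauto

/-- A vertex is active at a turn exactly when its arc crosses the corresponding cut. -/
theorem active_at_turn_iff {t : ℕ} (ht : IsTurn σ t) (v : Fin n) :
    (leftPos σ v < t ∧ t ≤ rightPos σ v) ↔
      turns σ (leftPos σ v) ≤ turns σ t ∧ turns σ t < turns σ (rightPos σ v + 1) := by
  have h1 := turns_succ_of_isTurn σ ht
  have hne : leftPos σ v ≠ t := by
    rintro rfl
    have := ht.2.1
    simp [isRight_leftPos] at this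
  constructor
  · rintro ⟨h2, h3⟩
    have := turns_mono σ h2.le
    have := turns_mono σ (show t + 1 ≤ rightPos σ v + 1 by omega)
    omega
  · rintro ⟨h2, h3⟩
    constructor
    · by_contra! h4
      have := turns_mono σ (show t + 1 ≤ leftPos σ v by omega)
      omega
    · by_contra! h4
      have := turns_mono σ (show rightPos σ v + 1 ≤ t by omega)
      omega

end Sweep

/-! ### The sweep on the machine -/

/-- A loop that fills a segment of an array. -/
theorem run_loop_put {A : Arr} {ρ : Reg} {a b j e : AExp} {s : Store} (x y d : ℤ) (f : ℤ → ℤ)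
    (ha : a.eval s = x) (hb : b.eval s = y) (hxy : x ≤ y)
    (hj : ∀ s' i, Frame (.loop ρ a b (.put A j e)) s s' → j.eval (s'.setReg ρ i) = d + i)
    (he : ∀ s' i, x ≤ i → i < y → Frame (.loop ρ a b (.put A j e)) s s' →
      e.eval (s'.setReg ρ i) = f i) (z : ℤ) :
    ((Prog.loop ρ a b (.put A j e)).run s).arr A z =
      if d + x ≤ z ∧ z < d + y then f (z - d) else s.arr A z := by
  revert z
  refine Prog.run_loop
    (fun i s' => ∀ z, s'.arr A z = if d + x ≤ z ∧ z < d + i then f (z - d) else s.arr A z)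
    ha hb hxy (fun z => ?_) (fun i s' h0 h1 hF hI z => ?_)
  · rw [if_neg (by omega)]
  · rw [run_put, Store.arr_setArr, if_pos rfl, he s' i h0 h1 hF, hj s' i hF,
      Function.update_apply, Store.arr_setReg, hI]
    split_ifs <;> first | rfl | omega | (congr 1; omega)

section CliqueSteps

variable {n : ℕ} (σ : Fin (2 * n) ≃ Fin n × Bool)

theorem input_endV {w : Fin n → ℕ} {k i : ℕ} (h : i < 2 * n) :
    (input σ w k).arr .endV i = ((σ ⟨i, h⟩).1 : ℕ) := by
  simp [input, h]

theorem input_endS {w : Fin n → ℕ} {k i : ℕ} (h : i < 2 * n) :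
    (input σ w k).arr .endS i = if isRight σ i then 1 else 0 := by
  simp [input, h, isRight]

/-- What the sweep has computed before position `i`. -/
structure Swept (i : ℕ) (s : Store) : Prop where
  r : s.reg .r = turns σ i
  base : s.reg .base = n * turns σ i
  afterLeft : s.reg .afterLeft = 1 ↔ 0 < i ∧ isRight σ (i - 1) = false
  active : ∀ v : Fin n,
    s.arr .active (v : ℕ) = if leftPos σ v < i ∧ i ≤ rightPos σ v then 1 else 0
  clique : ∀ v : Fin n, ∀ c : ℕ, c < turns σ i → s.arr .clique (n * c + (v : ℕ)) =
    if arcTail σ (v : ℕ) ≤ c ∧ (c : ℤ) < arcHead σ (v : ℕ) then 1 else 0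

/-- The cells of an earlier clique lie before the block of a later one, so copying a new clique
leaves the old ones intact. -/
theorem mul_add_lt_mul {n c d v : ℤ} (hc : c < d) (hv : v < n) (hn : 0 ≤ n) :
    n * c + v < n * d := by
  nlinarith

/-- `Swept` is the loop invariant. The block numbered `c` from `0` holds the vertices whose arcs
cross from node `c` to node `c + 1`: the active set is copied exactly at turns, where
`active_at_turn_iff` identifies activity with crossing. -/
theorem step1_run (hlr : ∀ v, leftPos σ v < rightPos σ v) (w : Fin n → ℕ) (k : ℕ) :
    Swept σ (2 * n) (step1.run (input σ w k)) := by
  set s := input σ w k with hs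
  simp only [step1, block_run_cons, block_run_nil]
  set s1 := (Prog.set .afterLeft (.lit 0)).run ((Prog.set .base (.lit 0)).run
    ((Prog.set .r (.lit 0)).run s)) with hs1
  set s2 := (Prog.loop .v (.lit 0) (.reg .n) (.put .active (.reg .v) (.lit 0))).run s1 with hs2
  have hF : Frame (Prog.loop .v (.lit 0) (.reg .n) (.put .active (.reg .v) (.lit 0))) s1 s2 :=
    Frame.run _ _
  have hn : s2.reg .n = n := hF.reg .n rfl
  have key := Prog.run_loop (ρ := .j) (a := .lit 0) (b := .reg .n + .reg .n) (s := s2)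
    (p := block [
      .set .x (.get .endV (.reg .j)),
      .ite (.eq (.get .endS (.reg .j)) (.lit 0))
        (block [.put .active (.reg .x) (.lit 1), .set .afterLeft (.lit 1)])
        (block [
          when (.eq (.reg .afterLeft) (.lit 1)) (block [
            .loop .v (.lit 0) (.reg .n)
              (.put .clique (.reg .base + .reg .v) (.get .active (.reg .v))),
            .set .base (.reg .base + .reg .n),
            .set .r (.reg .r + .lit 1)]),
          .put .active (.reg .x) (.lit 0),
          .set .afterLeft (.lit 0)])])
    (fun i s' => Swept σ i.toNat s') (x := 0) (y := (2 * n : ℕ)) rfl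
    (by simp only [AExp.eval, hn]; push_cast; ring) (by omega) ?_ ?_
  · rwa [Int.toNat_natCast] at key
  · refine ⟨?_, ?_, ?_, ?_, ?_⟩
    · rw [hF.reg .r rfl]; simp [hs1, Prog.run, AExp.eval, Store.setReg, turns]
    · rw [hF.reg .base rfl]; simp [hs1, Prog.run, AExp.eval, Store.setReg, turns]
    · rw [hF.reg .afterLeft rfl]; simp [hs1, Prog.run, AExp.eval, Store.setReg]
    · intro v
      rw [hs2, run_loop_put 0 n 0 (fun _ => 0) rfl rfl (by omega)
        (fun s' i _ => by simp [AExp.eval, Store.setReg]) (fun s' i _ _ _ => rfl)]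
      have := v.isLt
      simp [this]
    · intro v c hc
      simp [turns] at hc
  · intro i s' h0 h1 hF' hI
    lift i to ℕ using h0
    have hi : i < 2 * n := by exact_mod_cast h1
    have hn' : s'.reg .n = n := (hF'.reg .n rfl).trans hn
    have hV : s'.arr .endV i = ((σ ⟨i, hi⟩).1 : ℕ) := by
      rw [hF'.arr .endV rfl, hF.arr .endV rfl, ← input_endV σ (w := w) (k := k)]; rfl
    have hS : s'.arr .endS i = if isRight σ i then 1 else 0 := by
      rw [hF'.arr .endS rfl, hF.arr .endS rfl, ← input_endS σ (w := w) (k := k) hi]; rfl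
    have e : ((i : ℤ) + 1).toNat = i + 1 := by omega
    rw [Int.toNat_natCast] at hI
    rw [e]
    set v := (σ ⟨i, hi⟩).1 with hv
    rw [block_run_cons, run_set]
    set s3 := ((s'.setReg .j i).setReg .x (AExp.eval (s'.setReg .j i) (.get .endV (.reg .j))))
      with hs3
    have hx : s3.reg .x = (v : ℕ) := by
      simp [hs3, Store.setReg, AExp.eval, hV]
    have hr3 : ∀ ρ, ρ ≠ .j → ρ ≠ .x → s3.reg ρ = s'.reg ρ := by
      intro ρ h1 h2; simp [hs3, Store.setReg, h1, h2]
    have ha3 : s3.arr = s'.arr := rfl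
    have hj3 : s3.reg .j = i := by simp [hs3, Store.setReg]
    rw [block_run_cons, block_run_nil, run_ite]
    cases hR : isRight σ i
    · have hl := eq_leftPos σ hi hR
      rw [← hv] at hl
      have hT : ¬ IsTurn σ i := fun h => by
        have := h.2.1
        simp [hR] at this
      rw [if_pos (by simp [Cond.eval, AExp.eval, hj3, ha3, hS, hR])]
      simp only [block_run_cons, block_run_nil, run_put, run_set]
      refine ⟨?_, ?_, ?_, ?_, ?_⟩
      · simp [Store.setReg, Store.setArr, hr3, hI.r, turns_succ_of_not_isTurn σ hT]
      · simp [Store.setReg, Store.setArr, hr3, hI.base, turns_succ_of_not_isTurn σ hT]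
      · simp [Store.setReg, AExp.eval, hR]
      · intro u
        simp only [Store.setReg, Store.setArr, AExp.eval, hx, Function.update_self, ha3,
          Function.update_apply, hI.active, Nat.cast_inj, Fin.val_inj]
        by_cases huv : u = v
        · subst huv
          have := hlr v
          rw [if_pos rfl, if_pos (by omega)]
        · have h1 : leftPos σ u ≠ i := fun h => huv (leftPos_injective σ (h.trans hl))
          have h2 : rightPos σ u ≠ i := by
            intro h; rw [← h, isRight_rightPos] at hR; simp at hR
          rw [if_neg huv]
          split_ifs <;> omega
      · intro u c hc
        rw [turns_succ_of_not_isTurn σ hT] at hc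
        rw [← hI.clique u c hc]
        simp [Store.setReg, Store.setArr, ha3]
    · have hl := eq_rightPos σ hi hR
      rw [← hv] at hl
      rw [if_neg (by simp [Cond.eval, AExp.eval, hj3, ha3, hS, hR])]
      rw [block_run_cons]
      generalize hs4 : (when _ _).run s3 = s4
      -- Both outcomes of the test on `afterLeft` are summarised with `turns σ (i + 1)`, which is
      -- one more than `turns σ i` exactly when a clique has been copied.
      have hs4' : s4.reg .r = turns σ (i + 1) ∧ s4.reg .base = n * turns σ (i + 1) ∧
          s4.reg .x = (v : ℕ) ∧ s4.arr .active = s'.arr .active ∧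
          ∀ v : Fin n, ∀ c : ℕ, c < turns σ (i + 1) → s4.arr .clique (n * c + (v : ℕ)) =
            if arcTail σ (v : ℕ) ≤ c ∧ (c : ℤ) < arcHead σ (v : ℕ) then 1 else 0 := by
        subst hs4
        rw [run_when]
        by_cases hT : IsTurn σ i
        · have haf := hI.afterLeft.2 ⟨hT.1, hT.2.2⟩
          rw [if_pos (by simp [Cond.eval, AExp.eval, hr3, haf]), turns_succ_of_isTurn σ hT]
          simp only [block_run_cons, block_run_nil, run_set]
          set p := Prog.loop .v (.lit 0) (.reg .n)
              (.put .clique (.reg .base + .reg .v) (.get .active (.reg .v))) with hp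
          have hF5 := Frame.run p s3
          set s5 := p.run s3 with hs5
          refine ⟨?_, ?_, ?_, ?_, ?_⟩
          · simp [Store.setReg, AExp.eval, hF5.reg .r rfl, hr3, hI.r]
          · simp [Store.setReg, AExp.eval, hF5.reg .base rfl, hF5.reg .n rfl, hr3,
              hI.base, hn', mul_add]
          · simp [Store.setReg, hF5.reg .x rfl, hx]
          · simp [Store.setReg, hF5.arr .active rfl, ha3]
          · intro u c hc
            have hfill := run_loop_put (A := .clique) (ρ := .v) (a := .lit 0) (b := .reg .n)
              (j := .reg .base + .reg .v) (e := .get .active (.reg .v)) (s := s3)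
              0 n (n * turns σ i) (s'.arr .active) rfl (by simp [AExp.eval, hr3, hn']) (by omega)
              (fun t z hFt => by
                simp [AExp.eval, Store.setReg, hFt.reg .base rfl, hr3, hI.base])
              (fun t z _ _ hFt => by
                simp [AExp.eval, Store.setReg, hFt.arr .active rfl, ha3])
              (n * c + (u : ℕ))
            simp only [Store.setReg]
            rw [hs5, hp, hfill]
            have hu := u.isLt
            by_cases hc' : c < turns σ i
            · have := mul_add_lt_mul (n := n) (c := c) (d := turns σ i) (v := (u : ℕ))
                (by omega) (by omega) (by omega)
              rw [if_neg (by omega), ha3, hI.clique u c hc']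
            · have : c = turns σ i := by omega
              subst this
              -- The block just filled is the copy of the active set at the turn `i`.
              rw [if_pos (by omega), add_sub_cancel_left, hI.active]
              simp only [active_at_turn_iff σ hT, arcTail_coe, arcHead_coe, Nat.cast_le,
                Nat.cast_lt]
        · have haf : s'.reg .afterLeft ≠ 1 := fun h => hT ⟨(hI.afterLeft.1 h).1, hR,
            (hI.afterLeft.1 h).2⟩
          rw [if_neg (by simp [Cond.eval, AExp.eval, hr3, haf]), turns_succ_of_not_isTurn σ hT]
          exact ⟨by simp [hr3, hI.r], by simp [hr3, hI.base], hx, by rw [ha3],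
            by rw [ha3]; exact hI.clique⟩
      obtain ⟨h1, h2, h3, h4, h5⟩ := hs4'
      simp only [block_run_cons, block_run_nil, run_put, run_set]
      refine ⟨?_, ?_, ?_, ?_, ?_⟩
      · simp [Store.setReg, Store.setArr, h1]
      · simp [Store.setReg, Store.setArr, h2]
      · simp [Store.setReg, AExp.eval, hR]
      · intro u
        simp only [Store.setReg, Store.setArr, AExp.eval, h3, Function.update_self, h4,
          Function.update_apply, hI.active, Nat.cast_inj, Fin.val_inj]
        by_cases huv : u = v
        · subst huv
          rw [if_pos rfl, if_neg (by omega)]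
        · have h1 : rightPos σ u ≠ i := fun h => huv (rightPos_injective σ (h.trans hl))
          have h2 : leftPos σ u ≠ i := by
            intro h; rw [← h, isRight_leftPos] at hR; simp at hR
          rw [if_neg huv]
          split_ifs <;> omega
      · intro u c hc
        rw [← h5 u c hc]
        simp [Store.setReg, Store.setArr]

end CliqueSteps

/-! ## Flows in the network -/

/-- A network with nodes `0, …, r` and arcs `0, …, n + r - 1`, all directed upwards, the last `r` of
which form the chain `0, 1, …, r`. -/
structure Network where
  (n r k : ℤ)
  (tail head cap wt : ℤ → ℤ)
  n_nonneg : 0 ≤ n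
  r_nonneg : 0 ≤ r
  k_nonneg : 0 ≤ k
  tail_nonneg : ∀ e, 0 ≤ e → e < n + r → 0 ≤ tail e
  tail_lt_head : ∀ e, 0 ≤ e → e < n + r → tail e < head e
  head_le : ∀ e, 0 ≤ e → e < n + r → head e ≤ r
  tail_chain : ∀ i, 0 ≤ i → i < r → tail (n + i) = i
  head_chain : ∀ i, 0 ≤ i → i < r → head (n + i) = i + 1
  cap_chain : ∀ i, 0 ≤ i → i < r → cap (n + i) = k
  wt_chain : ∀ i, 0 ≤ i → i < r → wt (n + i) = 0
  cap_vertex : ∀ v, 0 ≤ v → v < n → cap v = 1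

namespace Network

variable (N : Network)

/-- The arcs of a network. -/
noncomputable def arcs : Finset ℤ := Finset.Ico 0 (N.n + N.r)

variable {N} in
theorem mem_arcs {e : ℤ} : e ∈ N.arcs ↔ 0 ≤ e ∧ e < N.n + N.r := Finset.mem_Ico

/-- The amount of `f` on the arcs that lead from `{0, …, i - 1}` to `{i, …, r}`. -/
noncomputable def cut (f : ℤ → ℤ) (i : ℤ) : ℤ :=
  ∑ e ∈ N.arcs, if N.tail e < i ∧ i ≤ N.head e then f e else 0

/-- The function `f` is a flow of value `j`. -/
structure IsFlow (f : ℤ → ℤ) (j : ℤ) : Prop where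
  nonneg : ∀ e ∈ N.arcs, 0 ≤ f e
  le_cap : ∀ e ∈ N.arcs, f e ≤ N.cap e
  cut_eq : ∀ i, 0 < i → i ≤ N.r → N.cut f i = j

variable {N}

theorem sum_Ioc_sub (Φ : ℤ → ℤ) {a b : ℤ} (h : a ≤ b) :
    ∑ i ∈ Finset.Ioc a b, (Φ (i - 1) - Φ i) = Φ a - Φ b := by
  induction b, h using Int.leInduction with
  | base => simp
  | succ b hb ih =>
    have : Finset.Ioc a (b + 1) = insert (b + 1) (Finset.Ioc a b) := by
      ext x; simp only [Finset.mem_Ioc, Finset.mem_insert]; omega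
    rw [this, Finset.sum_insert (by simp), ih]
    simp

/-- Summation by parts: the potential drop along an arc is the sum of the unit drops at the cuts it
crosses; then the two sums are exchanged. For flows of equal value the right-hand sides agree. -/
theorem sum_potential (Φ f : ℤ → ℤ) :
    ∑ e ∈ N.arcs, (Φ (N.tail e) - Φ (N.head e)) * f e =
      ∑ i ∈ Finset.Ioc 0 N.r, (Φ (i - 1) - Φ i) * N.cut f i := by
  simp only [cut, Finset.mul_sum]
  rw [Finset.sum_comm]
  refine Finset.sum_congr rfl fun e he => ?_
  obtain ⟨h0, h1⟩ := mem_arcs.1 he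
  have h2 := N.tail_nonneg e h0 h1
  have h3 := N.head_le e h0 h1
  rw [← sum_Ioc_sub Φ (N.tail_lt_head e h0 h1).le, Finset.sum_mul]
  simp only [mul_ite, mul_zero]
  rw [← Finset.sum_filter]
  refine Finset.sum_congr ?_ fun _ _ => rfl
  ext i
  simp only [Finset.mem_Ioc, Finset.mem_filter]
  omega

/-- A flow that satisfies complementary slackness with some potential has the largest weight among
all flows of the same value. -/
theorem IsFlow.optimal {f g Φ : ℤ → ℤ} {j : ℤ} (hf : N.IsFlow f j) (hg : N.IsFlow g j)
    (h1 : ∀ e ∈ N.arcs, f e < N.cap e → 0 ≤ Φ (N.tail e) - Φ (N.head e) - N.wt e)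
    (h2 : ∀ e ∈ N.arcs, 0 < f e → Φ (N.tail e) - Φ (N.head e) - N.wt e ≤ 0) :
    ∑ e ∈ N.arcs, N.wt e * g e ≤ ∑ e ∈ N.arcs, N.wt e * f e := by
  have hpot : ∑ e ∈ N.arcs, (Φ (N.tail e) - Φ (N.head e)) * g e =
      ∑ e ∈ N.arcs, (Φ (N.tail e) - Φ (N.head e)) * f e := by
    rw [sum_potential, sum_potential]
    refine Finset.sum_congr rfl fun i hi => ?_
    obtain ⟨hi0, hi1⟩ := Finset.mem_Ioc.1 hi
    rw [hf.cut_eq i hi0 hi1, hg.cut_eq i hi0 hi1]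
  -- Every term is nonnegative: where `g e > f e` the arc has spare capacity and its reduced cost is
  -- at least `0`; where `g e < f e` it carries flow and its reduced cost is at most `0`.
  have hsum : 0 ≤ ∑ e ∈ N.arcs, (Φ (N.tail e) - Φ (N.head e) - N.wt e) * (g e - f e) := by
    refine Finset.sum_nonneg fun e he => ?_
    have := hf.nonneg e he
    have := hf.le_cap e he
    have := hg.nonneg e he
    have := hg.le_cap e he
    rcases lt_trichotomy (g e) (f e) with h | h | h
    · exact mul_nonneg_of_nonpos_of_nonpos (h2 e he (by omega)) (by omega)
    · simp [h]
    · exact mul_nonneg (h1 e he (by omega)) (by omega)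
  simp only [sub_mul, mul_sub, Finset.sum_sub_distrib] at hsum
  simp only [sub_mul, Finset.sum_sub_distrib] at hpot
  linarith

theorem cut_update {f : ℤ → ℤ} {e d : ℤ} (he : e ∈ N.arcs) (i : ℤ) :
    N.cut (Function.update f e (f e + d)) i =
      N.cut f i + if N.tail e < i ∧ i ≤ N.head e then d else 0 := by
  unfold cut
  rw [← Finset.sum_erase_add _ _ he, ← Finset.sum_erase_add (a := e) _ _ he]
  rw [Finset.sum_congr rfl (g := fun x => if N.tail x < i ∧ i ≤ N.head x then f x else 0)]
  · simp only [Function.update_self]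
    split_ifs <;> ring
  · intro x hx
    rw [Function.update_of_ne (Finset.ne_of_mem_erase hx)]

theorem le_cut {f : ℤ → ℤ} (hf : ∀ e ∈ N.arcs, 0 ≤ f e) {e i : ℤ} (he : e ∈ N.arcs)
    (h1 : N.tail e < i) (h2 : i ≤ N.head e) : f e ≤ N.cut f i := by
  have := Finset.single_le_sum (f := fun e => if N.tail e < i ∧ i ≤ N.head e then f e else 0)
    (fun e he => by split_ifs; exacts [hf e he, le_rfl]) he
  simp only [h1, h2, and_self, if_true] at this
  exact this

theorem chain_mem {i : ℤ} (h0 : 0 ≤ i) (h1 : i < N.r) : N.n + i ∈ N.arcs := by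
  have := N.n_nonneg
  exact mem_arcs.2 (by omega)

theorem cut_zero (f : ℤ → ℤ) : N.cut f 0 = 0 := by
  refine Finset.sum_eq_zero fun e he => if_neg fun h => ?_
  obtain ⟨h0, h1⟩ := mem_arcs.1 he
  have := N.tail_nonneg e h0 h1
  omega

/-- An arc that crosses cut `u + 1` but not cut `u` has tail `u`. So if no arc leaving `u` carried
anything, the amount could not grow from one cut to the next. -/
theorem exists_outgoing {f : ℤ → ℤ} (hf : ∀ e ∈ N.arcs, 0 ≤ f e) {u : ℤ}
    (h : N.cut f u < N.cut f (u + 1)) : ∃ e ∈ N.arcs, N.tail e = u ∧ 0 < f e := by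
  by_contra! h'
  refine absurd h (not_lt.2 (Finset.sum_le_sum fun e he => ?_))
  have h1 := hf e he
  have h2 := h' e he
  split_ifs <;> omega

variable (N)

/-- The store holds the network. -/
structure Loaded (s : Store) : Prop where
  n : s.reg .n = N.n
  r : s.reg .r = N.r
  k : s.reg .k = N.k
  m : s.reg .m = N.n + N.r
  tail : s.arr .tail = N.tail
  head : s.arr .head = N.head
  cap : s.arr .cap = N.cap
  wt : s.arr .wN = N.wt

/-- The program leaves the network in place. -/
def _root_.MWKF.Prog.keepsNetwork (p : Prog) : Bool :=
  !(p.writesReg .n || p.writesReg .r || p.writesReg .k || p.writesReg .m || p.writesArr .tail ||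
    p.writesArr .head || p.writesArr .cap || p.writesArr .wN)

variable {N} in
theorem Loaded.of_frame {s s' : Store} (h : N.Loaded s) {p : Prog} (hF : Frame p s s')
    (hp : p.keepsNetwork = true) : N.Loaded s' := by
  simp only [Prog.keepsNetwork, Bool.not_eq_true', Bool.or_eq_false_iff] at hp
  obtain ⟨⟨⟨⟨⟨⟨⟨h1, h2⟩, h3⟩, h4⟩, h5⟩, h6⟩, h7⟩, h8⟩ := hp
  exact ⟨(hF.reg _ h1).trans h.n, (hF.reg _ h2).trans h.r, (hF.reg _ h3).trans h.k,
    (hF.reg _ h4).trans h.m, (hF.arr _ h5).trans h.tail, (hF.arr _ h6).trans h.head,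
    (hF.arr _ h7).trans h.cap, (hF.arr _ h8).trans h.wt⟩

variable {N} in
theorem Loaded.run {s : Store} (h : N.Loaded s) {p : Prog} (hp : p.keepsNetwork = true) :
    N.Loaded (p.run s) := h.of_frame (Frame.run p s) hp

end Network

/-! ### Building the network -/

section Construction

variable {n r k : ℤ} {lo hi : ℤ → ℤ}

/-- Cliques are numbered from `1` here, with `0` meaning "not seen yet", while `lo` and `hi` count
from `0` with `hi` excluded. Before round `i` the cliques `1, …, i - 1` have been inspected, so `v`
has been seen iff `lo v < i - 1`; its last clique so far is then the smaller of `hi v` and `i - 1`.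
-/
theorem firstLast_run {s : Store} (hn : s.reg .n = n) (hr : s.reg .r = r) (h0 : 0 ≤ n) (h1 : 0 ≤ r)
    (hlo : ∀ v, 0 ≤ v → v < n → 0 ≤ lo v) (hlt : ∀ v, 0 ≤ v → v < n → lo v < hi v)
    (hc : ∀ v c, 0 ≤ v → v < n → 0 ≤ c → c < r →
      s.arr .clique (n * c + v) = if lo v ≤ c ∧ c < hi v then 1 else 0)
    (hb : s.reg .base = 0)
    (hz : ∀ v, 0 ≤ v → v < n → s.arr .first v = 0 ∧ s.arr .last v = 0) :
    ∀ v, 0 ≤ v → v < n →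
      (((Prog.loop .i (.lit 1) (.reg .r + .lit 1) (block [
        .loop .v (.lit 0) (.reg .n)
          (when (.eq (.get .clique (.reg .base + .reg .v)) (.lit 1)) (block [
            when (.eq (.get .first (.reg .v)) (.lit 0)) (.put .first (.reg .v) (.reg .i)),
            .put .last (.reg .v) (.reg .i)])),
        .set .base (.reg .base + .reg .n)])).run s).arr .first v =
          if lo v < r then lo v + 1 else 0) ∧
      (((Prog.loop .i (.lit 1) (.reg .r + .lit 1) (block [
        .loop .v (.lit 0) (.reg .n)
          (when (.eq (.get .clique (.reg .base + .reg .v)) (.lit 1)) (block [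
            when (.eq (.get .first (.reg .v)) (.lit 0)) (.put .first (.reg .v) (.reg .i)),
            .put .last (.reg .v) (.reg .i)])),
        .set .base (.reg .base + .reg .n)])).run s).arr .last v =
          if lo v < r then min (hi v) r else 0) := by
  have key := Prog.run_loop (ρ := .i) (a := .lit 1) (b := .reg .r + .lit 1) (s := s) (p := block [
        .loop .v (.lit 0) (.reg .n)
          (when (.eq (.get .clique (.reg .base + .reg .v)) (.lit 1)) (block [
            when (.eq (.get .first (.reg .v)) (.lit 0)) (.put .first (.reg .v) (.reg .i)),
            .put .last (.reg .v) (.reg .i)])),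
        .set .base (.reg .base + .reg .n)])
    (fun i s' => s'.reg .base = n * (i - 1) ∧ ∀ v, 0 ≤ v → v < n →
      (s'.arr .first v = if lo v < i - 1 then lo v + 1 else 0) ∧
      (s'.arr .last v = if lo v < i - 1 then min (hi v) (i - 1) else 0))
    (x := 1) (y := r + 1) rfl (by simp [AExp.eval, hr]) (by omega) ?_ ?_
  · simpa using key.2
  · refine ⟨by simp [hb], fun v hv0 hv1 => ?_⟩
    have := hlo v hv0 hv1
    rw [(hz v hv0 hv1).1, (hz v hv0 hv1).2, if_neg (by omega), if_neg (by omega)]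
    exact ⟨rfl, rfl⟩
  · rintro i s' hi1 hi2 hF ⟨hb', hI⟩
    have hn' : s'.reg .n = n := (hF.reg .n rfl).trans hn
    have hq : s'.arr .clique = s.arr .clique := hF.arr .clique rfl
    simp only [block_run_cons, block_run_nil, run_set]
    set t := s'.setReg .i i with ht
    have hti : t.reg .i = i := by simp [ht, Store.setReg]
    have htn : t.reg .n = n := by simp [ht, Store.setReg, hn']
    have htb : t.reg .base = n * (i - 1) := by simp [ht, Store.setReg, hb']
    have hta : t.arr = s'.arr := rfl
    set p := Prog.loop .v (.lit 0) (.reg .n)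
          (when (.eq (.get .clique (.reg .base + .reg .v)) (.lit 1)) (block [
            when (.eq (.get .first (.reg .v)) (.lit 0)) (.put .first (.reg .v) (.reg .i)),
            .put .last (.reg .v) (.reg .i)])) with hp
    have hF' := Frame.run p t
    refine ⟨?_, ?_⟩
    · simp [Store.setReg, AExp.eval, hF'.reg .base rfl, hF'.reg .n rfl, htn, htb]; ring
    · have inner := Prog.run_loop (ρ := .v) (a := .lit 0) (b := .reg .n) (s := t) (p :=
          (when (.eq (.get .clique (.reg .base + .reg .v)) (.lit 1)) (block [
            when (.eq (.get .first (.reg .v)) (.lit 0)) (.put .first (.reg .v) (.reg .i)),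
            .put .last (.reg .v) (.reg .i)])))
        -- Vertices below `z` are already updated for clique `i`; the others still have the values
        -- of the previous round.
        (fun z t' => ∀ v, 0 ≤ v → v < n →
          (t'.arr .first v = if v < z then (if lo v < i then lo v + 1 else 0)
            else if lo v < i - 1 then lo v + 1 else 0) ∧
          (t'.arr .last v = if v < z then (if lo v < i then min (hi v) i else 0)
            else if lo v < i - 1 then min (hi v) (i - 1) else 0))
        (x := 0) (y := n) rfl htn h0 ?_ ?_
      · intro v hv0 hv1
        have := inner v hv0 hv1
        rw [if_pos hv1, if_pos hv1] at this
        simpa [Store.setReg] using this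
      · intro v hv0 hv1
        simp only [if_neg (show ¬ v < 0 by omega), hta]
        exact hI v hv0 hv1
      · intro z t' hz0 hz1 hFt hJ v hv0 hv1
        have e1 : t'.reg .i = i := (hFt.reg .i rfl).trans hti
        have e2 : t'.reg .base = n * (i - 1) := (hFt.reg .base rfl).trans htb
        have e3 : t'.arr .clique (n * (i - 1) + z) =
            if lo z ≤ i - 1 ∧ i - 1 < hi z then 1 else 0 := by
          rw [hFt.arr .clique rfl, hta, hq, hc z (i - 1) hz0 hz1 (by omega) (by omega)]
        have e4 := hJ z hz0 hz1
        have e5 := hJ v hv0 hv1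
        have e6 := hlt z hz0 hz1
        have e7 := hlo z hz0 hz1
        rw [if_neg (lt_irrefl z), if_neg (lt_irrefl z)] at e4
        by_cases hzv : v = z
        · subst hzv
          simp only [if_pos (show v < v + 1 by omega)]
          by_cases hcl : lo v ≤ i - 1 ∧ i - 1 < hi v
          · rw [if_pos hcl] at e3
            by_cases hlo' : lo v < i - 1
            · rw [if_pos hlo', if_pos hlo'] at e4
              simp [run_when, block_run_cons, block_run_nil, Cond.eval, AExp.eval, Store.setReg,
                e2, e3, e4, e1, run_put, Store.setArr, show lo v + 1 ≠ 0 by omega]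
              split_ifs <;> omega
            · rw [if_neg hlo', if_neg hlo'] at e4
              simp [run_when, block_run_cons, block_run_nil, Cond.eval, AExp.eval, Store.setReg,
                e2, e3, e4, e1, run_put, Store.setArr]
              split_ifs <;> omega
          · rw [if_neg hcl] at e3
            simp [run_when, Cond.eval, AExp.eval, Store.setReg, e2, e3, e4]
            split_ifs <;> omega
        · simp only [show v < z + 1 ↔ v < z by omega]
          refine Eq.mp ?_ e5
          congr 2 <;>
          · simp only [run_when, block_run_cons, block_run_nil, run_put]
            split_ifs <;> simp [Store.setReg, Store.setArr, AExp.eval, hzv]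

/-- Because `lo v < hi v ≤ r`, every vertex is seen and the minimum in `firstLast_run` is `hi v`;
thus `first - 1` and `last` are the exact ends `lo v` and `hi v`. -/
theorem step2_run {s : Store} (hn : s.reg .n = n) (hr : s.reg .r = r) (hk : s.reg .k = k)
    (h0 : 0 ≤ n) (h1 : 0 ≤ r) (hk0 : 0 ≤ k)
    (hlo : ∀ v, 0 ≤ v → v < n → 0 ≤ lo v) (hlt : ∀ v, 0 ≤ v → v < n → lo v < hi v)
    (hhi : ∀ v, 0 ≤ v → v < n → hi v ≤ r)
    (hc : ∀ v c, 0 ≤ v → v < n → 0 ≤ c → c < r →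
      s.arr .clique (n * c + v) = if lo v ≤ c ∧ c < hi v then 1 else 0) :
    ∃ N : Network, N.Loaded (step2.run s) ∧ N.n = n ∧ N.r = r ∧ N.k = k ∧
      ∀ v, 0 ≤ v → v < n → N.tail v = lo v ∧ N.head v = hi v ∧ N.wt v = s.arr .weight v := by
  obtain ⟨s1, hs1⟩ : ∃ s1, s1 = (Prog.loop .v (.lit 0) (.reg .n) (block [
    .put .first (.reg .v) (.lit 0),
    .put .last (.reg .v) (.lit 0)])).run s := ⟨_, rfl⟩
  have F1 := hs1 ▸ Frame.run _ s
  have P1 := Prog.run_loop (ρ := .v) (a := .lit 0) (b := .reg .n) (s := s) (p := block [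
    .put .first (.reg .v) (.lit 0), .put .last (.reg .v) (.lit 0)])
    (fun i s' => ∀ v, 0 ≤ v → v < i → s'.arr .first v = 0 ∧ s'.arr .last v = 0)
    (x := 0) (y := n) rfl hn h0 (by intros; omega) (by
      intro i s' _ _ hF hI v hv0 hv1
      by_cases hv : v = i
      · simp [block_run_cons, block_run_nil, run_put, Store.setArr, Store.setReg, AExp.eval, hv]
      · simpa [block_run_cons, block_run_nil, run_put, Store.setArr, Store.setReg, AExp.eval, hv]
          using hI v hv0 (by omega))
  rw [← hs1] at P1
  obtain ⟨s2, hs2⟩ : ∃ s2, s2 = (Prog.set .base (.lit 0)).run s1 := ⟨_, rfl⟩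
  have R2 : ∀ ρ, ρ ≠ .base → s2.reg ρ = s1.reg ρ := fun ρ h => by
    simp [hs2, run_set, Store.setReg, h]
  have A2 : s2.arr = s1.arr := by rw [hs2]; rfl
  have P3 := firstLast_run (s := s2) (lo := lo) (hi := hi) (n := n) (r := r)
    ((R2 _ (by decide)).trans ((F1.reg .n rfl).trans hn))
    ((R2 _ (by decide)).trans ((F1.reg .r rfl).trans hr)) h0 h1 hlo hlt
    (by rw [A2, F1.arr .clique rfl]; exact hc) (by simp [hs2, run_set, Store.setReg, AExp.eval])
    (by rw [A2]; exact P1)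
  obtain ⟨s3, hs3⟩ : ∃ s3, s3 = (Prog.loop .i (.lit 1) (.reg .r + .lit 1) (block [
        .loop .v (.lit 0) (.reg .n)
          (when (.eq (.get .clique (.reg .base + .reg .v)) (.lit 1)) (block [
            when (.eq (.get .first (.reg .v)) (.lit 0)) (.put .first (.reg .v) (.reg .i)),
            .put .last (.reg .v) (.reg .i)])),
        .set .base (.reg .base + .reg .n)])).run s2 := ⟨_, rfl⟩
  rw [← hs3] at P3
  have F3 := hs3 ▸ Frame.run _ s2
  have n3 : s3.reg .n = n :=
    (F3.reg .n rfl).trans ((R2 _ (by decide)).trans ((F1.reg .n rfl).trans hn))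
  have r3 : s3.reg .r = r :=
    (F3.reg .r rfl).trans ((R2 _ (by decide)).trans ((F1.reg .r rfl).trans hr))
  have k3 : s3.reg .k = k :=
    (F3.reg .k rfl).trans ((R2 _ (by decide)).trans ((F1.reg .k rfl).trans hk))
  have w3 : s3.arr .weight = s.arr .weight :=
    (F3.arr .weight rfl).trans (by rw [A2]; exact F1.arr .weight rfl)
  obtain ⟨s4, hs4⟩ : ∃ s4, s4 = (Prog.set .m (.reg .n + .reg .r)).run s3 := ⟨_, rfl⟩
  have n4 : s4.reg .n = n := by simp [hs4, run_set, Store.setReg, n3]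
  have r4 : s4.reg .r = r := by simp [hs4, run_set, Store.setReg, r3]
  have k4 : s4.reg .k = k := by simp [hs4, run_set, Store.setReg, k3]
  have m4 : s4.reg .m = n + r := by
    simp [hs4, run_set, Store.setReg, AExp.eval, n3, r3]
  have A4 : s4.arr = s3.arr := by rw [hs4]; rfl
  have P5 := Prog.run_loop (ρ := .v) (a := .lit 0) (b := .reg .n) (s := s4) (p := block [
    .put .tail (.reg .v) (.get .first (.reg .v) - .lit 1),
    .put .head (.reg .v) (.get .last (.reg .v)),
    .put .wN (.reg .v) (.get .weight (.reg .v)),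
    .put .cap (.reg .v) (.lit 1)])
    (fun i s' => ∀ v, 0 ≤ v → v < i → s'.arr .tail v = lo v ∧ s'.arr .head v = hi v ∧
      s'.arr .wN v = s.arr .weight v ∧ s'.arr .cap v = 1)
    (x := 0) (y := n) rfl n4 h0 (by intros; omega) (by
      intro i s' _ _ hF hI v hv0 hv1
      by_cases hv : v = i
      · subst hv
        have f := (P3 v hv0 (by omega)).1
        have l := (P3 v hv0 (by omega)).2
        have := hlt v hv0 (by omega)
        have := hhi v hv0 (by omega)
        rw [if_pos (by omega), ← A4, ← hF.arr _ rfl] at f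
        rw [if_pos (by omega), ← A4, ← hF.arr _ rfl] at l
        simp [block_run_cons, block_run_nil, run_put, Store.setArr, Store.setReg, AExp.eval,
          AExp.eval_sub, f, l,
          hF.arr .weight rfl, A4, w3]
        omega
      · simpa [block_run_cons, block_run_nil, run_put, Store.setArr, Store.setReg, AExp.eval, hv]
          using hI v hv0 (by omega))
  obtain ⟨s5, hs5⟩ : ∃ s5, s5 = (Prog.loop .v (.lit 0) (.reg .n) (block [
    .put .tail (.reg .v) (.get .first (.reg .v) - .lit 1),
    .put .head (.reg .v) (.get .last (.reg .v)),
    .put .wN (.reg .v) (.get .weight (.reg .v)),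
    .put .cap (.reg .v) (.lit 1)])).run s4 := ⟨_, rfl⟩
  rw [← hs5] at P5
  have F5 := hs5 ▸ Frame.run _ s4
  have P6 := Prog.run_loop (ρ := .i) (a := .lit 0) (b := .reg .r) (s := s5) (p := block [
    .put .tail (.reg .n + .reg .i) (.reg .i),
    .put .head (.reg .n + .reg .i) (.reg .i + .lit 1),
    .put .wN (.reg .n + .reg .i) (.lit 0),
    .put .cap (.reg .n + .reg .i) (.reg .k)])
    (fun i s' => (∀ v, 0 ≤ v → v < n → s'.arr .tail v = lo v ∧ s'.arr .head v = hi v ∧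
      s'.arr .wN v = s.arr .weight v ∧ s'.arr .cap v = 1) ∧ ∀ j, 0 ≤ j → j < i →
      s'.arr .tail (n + j) = j ∧ s'.arr .head (n + j) = j + 1 ∧
      s'.arr .wN (n + j) = 0 ∧ s'.arr .cap (n + j) = k)
    (x := 0) (y := r) rfl ((F5.reg .r rfl).trans r4) h1 ⟨P5, by intros; omega⟩ (by
      intro i s' hi0 _ hF hI
      have n6 : s'.reg .n = n := (hF.reg .n rfl).trans ((F5.reg .n rfl).trans n4)
      have k6 : s'.reg .k = k := (hF.reg .k rfl).trans ((F5.reg .k rfl).trans k4)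
      refine ⟨fun v hv0 hv1 => ?_, fun j hj0 hj1 => ?_⟩
      · simpa [block_run_cons, block_run_nil, run_put, Store.setArr, Store.setReg, AExp.eval, n6,
          show v ≠ n + i by omega] using hI.1 v hv0 hv1
      · by_cases hv : j = i
        · simp [block_run_cons, block_run_nil, run_put, Store.setArr, Store.setReg, AExp.eval, hv,
            n6, k6]
        · simpa [block_run_cons, block_run_nil, run_put, Store.setArr, Store.setReg, AExp.eval, hv,
            n6] using hI.2 j hj0 (by omega))
  obtain ⟨s6, hs6⟩ : ∃ s6, s6 = (Prog.loop .i (.lit 0) (.reg .r) (block [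
    .put .tail (.reg .n + .reg .i) (.reg .i),
    .put .head (.reg .n + .reg .i) (.reg .i + .lit 1),
    .put .wN (.reg .n + .reg .i) (.lit 0),
    .put .cap (.reg .n + .reg .i) (.reg .k)])).run s5 := ⟨_, rfl⟩
  rw [← hs6] at P6
  have F6 := hs6 ▸ Frame.run _ s5
  have hrun : step2.run s = s6 := by
    rw [hs6, hs5, hs4, hs3, hs2, hs1]
    simp only [step2, block_run_cons, block_run_nil]
  rw [hrun]
  have split : ∀ e, 0 ≤ e → e < n + r → (0 ≤ e ∧ e < n) ∨ ∃ j, 0 ≤ j ∧ j < r ∧ e = n + j := by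
    intro e h2 h3
    by_cases h : e < n
    · exact .inl ⟨h2, h⟩
    · exact .inr ⟨e - n, by omega, by omega, by omega⟩
  -- The network is read off the final store, which makes the array fields of `Loaded` hold by
  -- `rfl`.
  refine ⟨⟨n, r, k, s6.arr .tail, s6.arr .head, s6.arr .cap, s6.arr .wN, h0, h1, hk0, ?_, ?_, ?_,
    fun i h2 h3 => (P6.2 i h2 h3).1, fun i h2 h3 => (P6.2 i h2 h3).2.1,
    fun i h2 h3 => (P6.2 i h2 h3).2.2.2, fun i h2 h3 => (P6.2 i h2 h3).2.2.1,
    fun i h2 h3 => (P6.1 i h2 h3).2.2.2⟩,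
    ⟨(F6.reg .n rfl).trans ((F5.reg .n rfl).trans n4),
      (F6.reg .r rfl).trans ((F5.reg .r rfl).trans r4),
      (F6.reg .k rfl).trans ((F5.reg .k rfl).trans k4),
      (F6.reg .m rfl).trans ((F5.reg .m rfl).trans m4), rfl, rfl, rfl, rfl⟩, rfl, rfl, rfl,
    fun v h2 h3 => ⟨(P6.1 v h2 h3).1, (P6.1 v h2 h3).2.1, (P6.1 v h2 h3).2.2.1⟩⟩ <;>
  · intro e h2 h3
    rcases split e h2 h3 with ⟨h4, h5⟩ | ⟨j, h4, h5, rfl⟩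
    · have a1 := P6.1 e h4 h5
      have := hlo e h4 h5
      have := hlt e h4 h5
      have := hhi e h4 h5
      omega
    · have a1 := P6.2 j h4 h5
      omega

end Construction

/-! ## Shortest paths -/

/-- The state of Dijkstra's algorithm on the nodes `0, …, r` after `i` nodes have been finished.
`R e u y c` means that the arc `e` leads from `u` to `y` at cost `c`, `P e u` that `e` has been
relaxed from `u`, and `rank` records the order in which nodes are finished. -/
structure Search (R : ℤ → ℤ → ℤ → ℤ → Prop) (r i : ℤ) (P : ℤ → ℤ → Prop)
    (dist done par rank : ℤ → ℤ) : Prop where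
  done_eq : ∀ v, 0 ≤ v → v ≤ r → done v = 0 ∨ done v = 1
  dist_zero : dist 0 = 0
  dist_nonneg : ∀ v, 0 ≤ v → v ≤ r → done v = 1 → 0 ≤ dist v
  dist_le : ∀ d v, 0 ≤ d → d ≤ r → 0 ≤ v → v ≤ r → done d = 1 → done v = 0 → 0 ≤ dist v →
    dist d ≤ dist v
  relaxed : ∀ e u y c, R e u y c → done u = 1 → P e u → 0 ≤ dist y ∧ dist y ≤ dist u + c
  parent : ∀ v, 0 ≤ v → v ≤ r → v ≠ 0 → 0 ≤ dist v → ∃ u c, 0 ≤ u ∧ u ≤ r ∧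
    R (par v) u v c ∧ done u = 1 ∧ dist v = dist u + c ∧ (done v = 1 → rank u < rank v)
  rank_bound : ∀ v, 0 ≤ v → v ≤ r → done v = 1 → 0 ≤ rank v ∧ rank v < i
  card : (((Finset.Icc 0 r).filter fun v => done v = 1).card : ℤ) = i

namespace Search

variable {R : ℤ → ℤ → ℤ → ℤ → Prop} {r i : ℤ} {P : ℤ → ℤ → Prop} {dist done par rank : ℤ → ℤ}

theorem mono (h : Search R r i P dist done par rank) {Q : ℤ → ℤ → Prop}
    (hQ : ∀ e u y c, R e u y c → Q e u → P e u) : Search R r i Q dist done par rank :=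
  { h with relaxed := fun e u y c hR hu hq => h.relaxed e u y c hR hu (hQ e u y c hR hq) }

theorem done_of_card (h : Search R r (r + 1) P dist done par rank) (hr : 0 ≤ r) :
    ∀ v, 0 ≤ v → v ≤ r → done v = 1 := by
  have h1 : (Finset.Icc 0 r).filter (fun v => done v = 1) = Finset.Icc 0 r := by
    refine Finset.eq_of_subset_of_card_le (Finset.filter_subset _ _) ?_
    have := h.card
    rw [Int.card_Icc]
    omega
  intro v h2 h3
  have : v ∈ (Finset.Icc 0 r).filter (fun v => done v = 1) := by
    rw [h1]; exact Finset.mem_Icc.2 ⟨h2, h3⟩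
  exact (Finset.mem_filter.1 this).2

/-- If every reached node were finished, then, following the chain from node `0`, each node would be
reached by relaxation and hence finished. That makes `r + 1` finished nodes, more than `i`. -/
theorem exists_frontier (h : Search R r i (fun _ _ => True) dist done par rank) (hr : 0 ≤ r)
    (hi : i ≤ r) (hchain : ∀ v, 0 ≤ v → v < r → ∃ e c, R e v (v + 1) c) :
    ∃ v, 0 ≤ v ∧ v ≤ r ∧ done v = 0 ∧ 0 ≤ dist v := by
  by_contra! hno
  have hall : ∀ v, 0 ≤ v → v ≤ r → done v = 1 := by
    intro v hv
    induction v, hv using Int.leInduction with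
    | base =>
      intro _
      refine (h.done_eq 0 le_rfl hr).resolve_left fun h0 => ?_
      have := hno 0 le_rfl hr h0
      rw [h.dist_zero] at this
      omega
    | succ v hv ih =>
      intro hv'
      obtain ⟨e, c, he⟩ := hchain v hv (by omega)
      refine (h.done_eq (v + 1) (by omega) hv').resolve_left fun h0 => ?_
      have := hno (v + 1) (by omega) hv' h0
      have := (h.relaxed _ _ _ _ he (ih (by omega)) trivial).1
      omega
  have hc := h.card
  rw [Finset.filter_true_of_mem fun v hv =>
    hall v (Finset.mem_Icc.1 hv).1 (Finset.mem_Icc.1 hv).2, Int.card_Icc] at hc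
  omega

/-- The node `u` receives rank `i`, above all earlier ranks, so parents keep smaller ranks than
their children. None of its arcs has been relaxed yet; hence the restriction `x ≠ u`. -/
theorem finish (h : Search R r i (fun _ _ => True) dist done par rank) {u : ℤ} (hu0 : 0 ≤ u)
    (hur : u ≤ r) (hu : done u = 0) (hdu : 0 ≤ dist u)
    (hmin : ∀ v, 0 ≤ v → v ≤ r → done v = 0 → 0 ≤ dist v → dist u ≤ dist v) :
    Search R r (i + 1) (fun _ x => x ≠ u) dist (Function.update done u 1) par
      (Function.update rank u i) := by
  have hdone : ∀ v, Function.update done u 1 v = 1 ↔ v = u ∨ done v = 1 := by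
    intro v
    by_cases hv : v = u
    · simp [hv]
    · simp [hv]
  have hundone : ∀ v, Function.update done u 1 v = 0 ↔ v ≠ u ∧ done v = 0 := by
    intro v
    by_cases hv : v = u
    · simp [hv]
    · simp [hv]
  have hne : ∀ v, done v = 1 → v ≠ u := by rintro v h1 rfl; omega
  refine ⟨fun v h0 h1 => ?_, h.dist_zero, fun v h0 h1 => ?_, fun d v h0 h1 h2 h3 => ?_,
    fun e x y c hR => ?_, fun v h0 h1 h2 h3 => ?_, fun v h0 h1 => ?_, ?_⟩
  · rw [hdone, hundone]
    have := h.done_eq v h0 h1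
    tauto
  · rw [hdone]
    rintro (rfl | h4)
    exacts [hdu, h.dist_nonneg v h0 h1 h4]
  · rw [hdone, hundone]
    rintro (rfl | h4) h5 h6
    exacts [hmin v h2 h3 h5.2 h6, h.dist_le d v h0 h1 h2 h3 h4 h5.2 h6]
  · rw [hdone]
    rintro (h4 | h4) h5
    exacts [absurd h4 h5, h.relaxed e x y c hR h4 trivial]
  · obtain ⟨x, c, hx0, hxr, h4, h5, h6, h7⟩ := h.parent v h0 h1 h2 h3
    refine ⟨x, c, hx0, hxr, h4, (hdone x).2 (.inr h5), h6, fun h8 => ?_⟩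
    rw [Function.update_of_ne (hne x h5)]
    by_cases hv : v = u
    · subst hv
      rw [Function.update_self]
      exact (h.rank_bound x hx0 hxr h5).2
    · rw [Function.update_of_ne hv]
      exact h7 (((hdone v).1 h8).resolve_left hv)
  · rw [hdone]
    intro h4
    by_cases hv : v = u
    · subst hv
      have := h.card
      rw [Function.update_self]
      omega
    · rw [Function.update_of_ne hv]
      have := h.rank_bound v h0 h1 (h4.resolve_left hv)
      omega
  · have : (Finset.Icc 0 r).filter (fun v => Function.update done u 1 v = 1) =
        insert u ((Finset.Icc 0 r).filter fun v => done v = 1) := by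
      ext v
      simp only [Finset.mem_filter, hdone, Finset.mem_insert, Finset.mem_Icc]
      constructor
      · tauto
      · rintro (rfl | h4)
        · exact ⟨⟨hu0, hur⟩, .inl rfl⟩
        · exact ⟨h4.1, .inr h4.2⟩
    rw [this, Finset.card_insert_of_notMem (by simp [hu]), Nat.cast_succ, h.card]

variable {e u y c : ℤ}

theorem relax_keep (h : Search R r i P dist done par rank) (he : R e u y c)
    (huniq : ∀ y' c', R e u y' c' → y' = y ∧ c' = c)
    (hy : 0 ≤ dist y ∧ dist y ≤ dist u + c) :
    Search R r i (fun e' x => P e' x ∨ (e' = e ∧ x = u)) dist done par rank := by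
  refine { h with relaxed := fun e' x y' c' hR hx hP => ?_ }
  rcases hP with hP | ⟨rfl, rfl⟩
  · exact h.relaxed e' x y' c' hR hx hP
  · obtain ⟨rfl, rfl⟩ := huniq _ _ hR
    exact hy

/-- Only an unfinished node is changed, and its new distance `dist u + c` is at least `dist u`, the
maximum over finished nodes; so the order between finished and unfinished distances survives. A
distance that was already finite only decreases, which preserves the inequalities of earlier
relaxations. -/
theorem relax_update (h : Search R r i P dist done par rank) (he : R e u y c)
    (huniq : ∀ y' c', R e u y' c' → y' = y ∧ c' = c) (hc : 0 ≤ c) (hu0 : 0 ≤ u) (hur : u ≤ r)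
    (hu : done u = 1) (hy : done y = 0) (hlt : dist y < 0 ∨ dist u + c < dist y)
    (hmax : ∀ v, 0 ≤ v → v ≤ r → done v = 1 → dist v ≤ dist u) :
    Search R r i (fun e' x => P e' x ∨ (e' = e ∧ x = u)) (Function.update dist y (dist u + c)) done
      (Function.update par y e) rank := by
  have hdu := h.dist_nonneg u hu0 hur hu
  -- The source keeps distance `0`, on which neither a nonnegative candidate nor the test for
  -- infinity can succeed.
  have hy0 : y ≠ 0 := by
    rintro rfl
    rw [h.dist_zero] at hlt
    omega
  have hne : ∀ v, done v = 1 → v ≠ y := by rintro v h1 rfl; omega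
  refine ⟨h.done_eq, ?_, fun v h0 h1 h2 => ?_, fun d v h0 h1 h2 h3 h4 h5 h6 => ?_,
    fun e' x y' c' hR hx hP => ?_, fun v h0 h1 h2 h3 => ?_, h.rank_bound, h.card⟩
  · rw [Function.update_of_ne hy0.symm, h.dist_zero]
  · rw [Function.update_of_ne (hne v h2)]
    exact h.dist_nonneg v h0 h1 h2
  · rw [Function.update_of_ne (hne d h4)]
    by_cases hv : v = y
    · subst hv
      have := hmax d h0 h1 h4
      rw [Function.update_self]
      omega
    · rw [Function.update_of_ne hv] at h6 ⊢
      exact h.dist_le d v h0 h1 h2 h3 h4 h5 h6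
  · rw [Function.update_of_ne (hne x hx)]
    rcases hP with hP | ⟨rfl, rfl⟩
    · have := h.relaxed e' x y' c' hR hx hP
      by_cases hv : y' = y
      · subst hv
        rw [Function.update_self]
        omega
      · rw [Function.update_of_ne hv]
        exact this
    · obtain ⟨rfl, rfl⟩ := huniq _ _ hR
      rw [Function.update_self]
      omega
  · by_cases hv : v = y
    · subst hv
      refine ⟨u, c, hu0, hur, ?_, hu, ?_, fun h4 => by omega⟩
      · rwa [Function.update_self]
      · rw [Function.update_self, Function.update_of_ne (hne u hu)]
    · rw [Function.update_of_ne hv] at h3 ⊢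
      rw [Function.update_of_ne hv]
      obtain ⟨x, c', hx0, hxr, h4, h5, h6, h7⟩ := h.parent v h0 h1 h2 h3
      refine ⟨x, c', hx0, hxr, h4, h5, ?_, h7⟩
      rwa [Function.update_of_ne (hne x h5)]

end Search

/-! ### Dijkstra's algorithm on the machine -/

theorem relax_run (t : Store) : relax.run t =
    if t.arr .done (t.reg .y) = 0 ∧
      (t.arr .dist (t.reg .y) < 0 ∨ t.reg .c < t.arr .dist (t.reg .y)) then
      (t.setArr .dist (t.reg .y) (t.reg .c)).setArr .par (t.reg .y) (t.reg .e)
    else t := by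
  simp only [relax, run_when, run_ite, Cond.eval, AExp.eval, block_run_cons, block_run_nil,
    run_put]
  by_cases h1 : t.arr .done (t.reg .y) = 0
  · by_cases h2 : t.arr .dist (t.reg .y) < 0
    · simp [h1, h2, Store.setArr]
    · by_cases h3 : t.reg .c < t.arr .dist (t.reg .y)
      · simp [h1, h2, h3, Store.setArr]
      · simp [h1, h2, h3]
  · simp [h1]

/-- One relaxation, in a store that holds the state of the search. -/
theorem Search.run_relax {R : ℤ → ℤ → ℤ → ℤ → Prop} {r i : ℤ} {P : ℤ → ℤ → Prop}
    {rank : ℤ → ℤ} {e u y c : ℤ} {t : Store}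
    (h : Search R r i P (t.arr .dist) (t.arr .done) (t.arr .par) rank) (he : R e u y c)
    (huniq : ∀ y' c', R e u y' c' → y' = y ∧ c' = c) (hc : 0 ≤ c) (hu0 : 0 ≤ u) (hur : u ≤ r)
    (hy0 : 0 ≤ y) (hyr : y ≤ r) (hu : t.arr .done u = 1)
    (hmax : ∀ v, 0 ≤ v → v ≤ r → t.arr .done v = 1 → t.arr .dist v ≤ t.arr .dist u)
    (hty : t.reg .y = y) (htc : t.reg .c = t.arr .dist u + c) (hte : t.reg .e = e) :
    Search R r i (fun e' x => P e' x ∨ (e' = e ∧ x = u)) ((relax.run t).arr .dist)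
        ((relax.run t).arr .done) ((relax.run t).arr .par) rank ∧
      ∀ v, 0 ≤ v → v ≤ r → t.arr .done v = 1 →
        (relax.run t).arr .dist v ≤ (relax.run t).arr .dist u := by
  rw [relax_run, hty, htc, hte]
  split_ifs with h1
  · have hne : ∀ v, t.arr .done v = 1 → v ≠ y := by rintro v h1 rfl; omega
    constructor
    · simpa [Store.setArr] using h.relax_update he huniq hc hu0 hur hu h1.1 h1.2 hmax
    · intro v h2 h3 h4
      simpa [Store.setArr, hne v h4, hne u hu] using hmax v h2 h3 h4
  · refine ⟨h.relax_keep he huniq ?_, hmax⟩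
    rcases h.done_eq y hy0 hyr with h2 | h2
    · have : ¬ _ := fun h3 => h1 ⟨h2, h3⟩
      omega
    -- A finished `y` needs no update: `dist y ≤ dist u ≤ dist u + c`.
    · have := h.dist_nonneg y hy0 hyr h2
      have := hmax y hy0 hyr h2
      omega

open AExp in
/-- Relax the arc in register `e` from the node in register `u`. -/
def scanArc : Prog := block [
  when (.and (.eq (get .tail (reg .e)) (reg .u)) (.lt (get .flow (reg .e)) (get .cap (reg .e))))
    (block [
      .set .y (get .head (reg .e)),
      .set .c (get .dist (reg .u) + (get .wU (reg .e) + get .pot (reg .u) - get .pot (reg .y))),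
      relax]),
  when (.and (.eq (get .head (reg .e)) (reg .u)) (.lt (lit 0) (get .flow (reg .e))))
    (block [
      .set .y (get .tail (reg .e)),
      .set .c (get .dist (reg .u) + (get .pot (reg .u) - get .wU (reg .e) - get .pot (reg .y))),
      relax])]

open AExp in
/-- Find the unfinished node with the least tentative distance. -/
def selectNode : Prog :=
  .loop .v (lit 0) (reg .r + lit 1)
    (when (.and (.eq (get .done (reg .v)) (lit 0)) (.le (lit 0) (get .dist (reg .v))))
      (.ite (.eq (reg .u) (lit (-1)))
        (.set .u (reg .v))
        (when (.lt (get .dist (reg .v)) (get .dist (reg .u))) (.set .u (reg .v)))))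

open AExp in
/-- Finish the node in register `u`. -/
def finishNode : Prog :=
  when (.le (lit 0) (reg .u)) (block [
    .put .done (reg .u) (lit 1),
    .loop .e (lit 0) (reg .m) scanArc])

open AExp in
theorem shortestPaths_eq : shortestPaths = block [
    .loop .v (lit 0) (reg .r + lit 1) (block [
      .put .dist (reg .v) (lit (-1)),
      .put .done (reg .v) (lit 0)]),
    .put .dist (lit 0) (lit 0),
    .loop .i (lit 0) (reg .r + lit 1) (block [.set .u (lit (-1)), selectNode, finishNode])] := rfl

/-- The value `-1` in register `u` means that no candidate has been met; otherwise the register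
holds a nearest candidate among the nodes scanned so far. -/
theorem selectNode_run {t : Store} {r : ℤ} (hr : t.reg .r = r) (h0 : 0 ≤ r)
    (hu : t.reg .u = -1) :
    let u := (selectNode.run t).reg .u
    (u = -1 ∧ ∀ v, 0 ≤ v → v ≤ r → t.arr .done v = 0 → t.arr .dist v < 0) ∨
      (0 ≤ u ∧ u ≤ r ∧ t.arr .done u = 0 ∧ 0 ≤ t.arr .dist u ∧
        ∀ v, 0 ≤ v → v ≤ r → t.arr .done v = 0 → 0 ≤ t.arr .dist v →
          t.arr .dist u ≤ t.arr .dist v) := by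
  have key := Prog.run_loop (ρ := .v) (a := .lit 0) (b := .reg .r + .lit 1) (s := t)
    (p := when (.and (.eq (.get .done (.reg .v)) (.lit 0)) (.le (.lit 0) (.get .dist (.reg .v))))
      (.ite (.eq (.reg .u) (.lit (-1)))
        (.set .u (.reg .v))
        (when (.lt (.get .dist (.reg .v)) (.get .dist (.reg .u))) (.set .u (.reg .v)))))
    (fun z t' =>
      (t'.reg .u = -1 ∧ ∀ v, 0 ≤ v → v < z → t.arr .done v = 0 → t.arr .dist v < 0) ∨
      (0 ≤ t'.reg .u ∧ t'.reg .u < z ∧ t.arr .done (t'.reg .u) = 0 ∧ 0 ≤ t.arr .dist (t'.reg .u) ∧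
        ∀ v, 0 ≤ v → v < z → t.arr .done v = 0 → 0 ≤ t.arr .dist v →
          t.arr .dist (t'.reg .u) ≤ t.arr .dist v))
    (x := 0) (y := r + 1) rfl (by simp [AExp.eval, hr]) (by omega)
    (.inl ⟨hu, by intros; omega⟩) ?_
  · simp only [Int.lt_add_one_iff] at key
    exact key
  · intro z t' hz0 hz1 hF hI
    have ed : t'.arr .done = t.arr .done := hF.arr .done rfl
    have ei : t'.arr .dist = t.arr .dist := hF.arr .dist rfl
    have cases_lt : ∀ v, v < z + 1 → v < z ∨ v = z := by intro v; omega
    simp only [run_when, run_ite, Cond.eval, AExp.eval, Store.reg_setReg, Store.arr_setReg, ed, ei,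
      if_true, Bool.and_eq_true, decide_eq_true_eq, run_set, reduceCtorEq, if_false]
    by_cases h1 : t.arr .done z = 0 ∧ 0 ≤ t.arr .dist z
    · rw [if_pos h1]
      rcases hI with ⟨h2, h3⟩ | ⟨h2, h3, h4, h5, h6⟩
      · rw [if_pos h2]
        right
        simp only [Store.reg_setReg, if_true]
        refine ⟨hz0, by omega, h1.1, h1.2, fun v hv0 hv1 hv2 hv3 => ?_⟩
        rcases cases_lt v hv1 with hv | rfl
        · have := h3 v hv0 hv hv2; omega
        · exact le_rfl
      · rw [if_neg (by omega)]
        right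
        by_cases h7 : t.arr .dist z < t.arr .dist (t'.reg .u)
        · rw [if_pos h7]
          simp only [Store.reg_setReg, if_true]
          refine ⟨hz0, by omega, h1.1, h1.2, fun v hv0 hv1 hv2 hv3 => ?_⟩
          rcases cases_lt v hv1 with hv | rfl
          · have := h6 v hv0 hv hv2 hv3; omega
          · exact le_rfl
        · rw [if_neg h7]
          simp only [Store.reg_setReg, reduceCtorEq, if_false]
          refine ⟨h2, by omega, h4, h5, fun v hv0 hv1 hv2 hv3 => ?_⟩
          rcases cases_lt v hv1 with hv | rfl
          · exact h6 v hv0 hv hv2 hv3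
          · omega
    · rw [if_neg h1]
      simp only [Store.reg_setReg, reduceCtorEq, if_false]
      refine hI.imp (fun h => ⟨h.1, fun v hv0 hv1 hv2 => ?_⟩)
        (fun h => ⟨h.1, by omega, h.2.2.1, h.2.2.2.1, fun v hv0 hv1 hv2 hv3 => ?_⟩)
      · rcases cases_lt v hv1 with hv | rfl
        · exact h.2 v hv0 hv hv2
        · by_contra hn
          exact h1 ⟨hv2, by omega⟩
      · rcases cases_lt v hv1 with hv | rfl
        · exact h.2.2.2.2 v hv0 hv hv2 hv3
        · exact absurd ⟨hv2, hv3⟩ h1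

namespace Network

variable (N : Network)

/-- In the residual network of the flow `f`, the arc `e` leads from `u` to `y`, and `c` is its cost
for the weights `W` reduced by the potential `φ`. -/
def Residual (W f φ : ℤ → ℤ) (e u y c : ℤ) : Prop :=
  e ∈ N.arcs ∧
    ((N.tail e = u ∧ N.head e = y ∧ f e < N.cap e ∧ c = W e + φ u - φ y) ∨
      (N.head e = u ∧ N.tail e = y ∧ 0 < f e ∧ c = φ u - W e - φ y))

variable {N} {W f φ : ℤ → ℤ} {e u y c : ℤ}

theorem Residual.bounds (h : N.Residual W f φ e u y c) :
    0 ≤ u ∧ u ≤ N.r ∧ 0 ≤ y ∧ y ≤ N.r ∧ u ≠ y := by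
  obtain ⟨h1, h2⟩ := h
  obtain ⟨h3, h4⟩ := mem_arcs.1 h1
  have := N.tail_nonneg e h3 h4
  have := N.tail_lt_head e h3 h4
  have := N.head_le e h3 h4
  omega

/-- There are no loops, so the end from which an arc is used determines its direction. -/
theorem Residual.unique (h : N.Residual W f φ e u y c) {y' c' : ℤ}
    (h' : N.Residual W f φ e u y' c') : y' = y ∧ c' = c := by
  obtain ⟨h1, h2⟩ := h
  obtain ⟨h3, h4⟩ := mem_arcs.1 h1
  have := N.tail_lt_head e h3 h4
  obtain ⟨_, h5⟩ := h'
  rcases h2 with ⟨rfl, rfl, _, rfl⟩ | ⟨rfl, rfl, _, rfl⟩ <;>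
  rcases h5 with ⟨h6, rfl, _, rfl⟩ | ⟨h6, rfl, _, rfl⟩ <;> omega

/-- At most one of the two tests succeeds, as `N.tail z < N.head z`. If neither does, the arc is not
residual at `u` and there is nothing to relax. -/
theorem scanArc_run {t : Store} {i z : ℤ} {rank : ℤ → ℤ} (hN : N.Loaded t)
    (hW : t.arr .wU = W) (hf : t.arr .flow = f) (hφ : t.arr .pot = φ)
    (hR : ∀ e u y c, N.Residual W f φ e u y c → 0 ≤ c)
    (hz : z ∈ N.arcs) (hte : t.reg .e = z) (htu : t.reg .u = u)
    (hu0 : 0 ≤ u) (hur : u ≤ N.r) (hu : t.arr .done u = 1)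
    (h : Search (N.Residual W f φ) N.r i (fun e x => x ≠ u ∨ e < z) (t.arr .dist) (t.arr .done)
      (t.arr .par) rank)
    (hmax : ∀ v, 0 ≤ v → v ≤ N.r → t.arr .done v = 1 → t.arr .dist v ≤ t.arr .dist u) :
    Search (N.Residual W f φ) N.r i (fun e x => x ≠ u ∨ e < z + 1) ((scanArc.run t).arr .dist)
        ((scanArc.run t).arr .done) ((scanArc.run t).arr .par) rank ∧
      ∀ v, 0 ≤ v → v ≤ N.r → t.arr .done v = 1 →
        (scanArc.run t).arr .dist v ≤ (scanArc.run t).arr .dist u := by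
  obtain ⟨hz0, hz1⟩ := mem_arcs.1 hz
  have hlt := N.tail_lt_head z hz0 hz1
  have main : ∀ y c, N.Residual W f φ z u y c → ∀ t' : Store, t'.arr = t.arr → t'.reg .y = y →
      t'.reg .c = t.arr .dist u + c → t'.reg .e = z →
      Search (N.Residual W f φ) N.r i (fun e x => x ≠ u ∨ e < z + 1) ((relax.run t').arr .dist)
          ((relax.run t').arr .done) ((relax.run t').arr .par) rank ∧
        ∀ v, 0 ≤ v → v ≤ N.r → t.arr .done v = 1 →
          (relax.run t').arr .dist v ≤ (relax.run t').arr .dist u := by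
    intro y c hres t' ha hy hc he
    have hb := hres.bounds
    rw [← ha] at h hmax hc hu ⊢
    have := h.run_relax hres (fun y' c' => hres.unique) (hR _ _ _ _ hres) hu0 hur hb.2.2.1
      hb.2.2.2.1 hu hmax hy hc he
    refine ⟨this.1.mono fun e' x y' c' _ => ?_, this.2⟩
    omega
  simp only [scanArc, block_run_cons, block_run_nil]
  by_cases h1 : N.tail z = u ∧ f z < N.cap z
  · have c1 : Cond.eval t (.and (.eq (.get .tail (.reg .e)) (.reg .u))
        (.lt (.get .flow (.reg .e)) (.get .cap (.reg .e)))) = true := by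
      simp [Cond.eval, AExp.eval, hte, htu, hN.tail, hN.cap, hf, h1]
    rw [run_when _ _ t, if_pos c1]
    generalize hw : Prog.run _ t = t1
    have F : Frame (block [
      .set .y (.get .head (.reg .e)),
      .set .c (.get .dist (.reg .u) +
        (.get .wU (.reg .e) + .get .pot (.reg .u) - .get .pot (.reg .y))),
      relax]) t t1 := hw ▸ Frame.run _ t
    -- After a forward relaxation the second test fails: `N.head z` differs from `N.tail z = u`.
    rw [run_when, if_neg]
    · rw [← hw]
      simp only [block_run_cons, block_run_nil]
      refine main (N.head z) (W z + φ u - φ (N.head z))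
        ⟨hz, .inl ⟨h1.1, rfl, h1.2, rfl⟩⟩ _ rfl ?_ ?_ ?_
      · simp [run_set, Store.setReg, AExp.eval, hte, hN.head]
      · simp [run_set, Store.setReg, AExp.eval, AExp.eval_sub, hte, hN.head, htu,
          hW, hφ]
      · simp [run_set, Store.setReg, hte]
    · simp only [Cond.eval, AExp.eval, F.arr .head rfl, F.reg .e rfl, F.reg .u rfl, hte, htu,
        hN.head]
      simp
      omega
  · have c1 : Cond.eval t (.and (.eq (.get .tail (.reg .e)) (.reg .u))
        (.lt (.get .flow (.reg .e)) (.get .cap (.reg .e)))) ≠ true := by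
      simpa [Cond.eval, AExp.eval, hte, htu, hN.tail, hN.cap, hf] using h1
    rw [run_when _ _ t, if_neg c1, run_when]
    by_cases h2 : N.head z = u ∧ 0 < f z
    · rw [if_pos (by simp [Cond.eval, AExp.eval, hte, htu, hN.head, hf, h2])]
      simp only [block_run_cons, block_run_nil]
      refine main (N.tail z) (φ u - W z - φ (N.tail z))
        ⟨hz, .inr ⟨h2.1, rfl, h2.2, rfl⟩⟩ _ rfl ?_ ?_ ?_
      · simp [run_set, Store.setReg, AExp.eval, hte, hN.tail]
      · simp [run_set, Store.setReg, AExp.eval, AExp.eval_sub, hte, hN.tail, htu,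
          hW, hφ]
      · simp [run_set, Store.setReg, hte]
    · rw [if_neg (by simpa [Cond.eval, AExp.eval, hte, htu, hN.head, hf] using h2)]
      refine ⟨h.mono fun e x y c hres hx => ?_, hmax⟩
      by_cases he : e = z
      · subst he
        refine .inl fun hxu => ?_
        subst hxu
        obtain ⟨_, ⟨h3, _, h4, _⟩ | ⟨h3, _, h4, _⟩⟩ := hres
        exacts [h1 ⟨h3, h4⟩, h2 ⟨h3, h4⟩]
      · omega

/-- The unsaturated c-arcs put the whole chain `0, 1, …, r` into the residual network. Therefore
each of the `r + 1` rounds finds a node to finish, and in the end all distances are finite. -/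
theorem shortestPaths_run {s : Store} (hN : N.Loaded s)
    (hW : s.arr .wU = W) (hf : s.arr .flow = f) (hφ : s.arr .pot = φ)
    (hR : ∀ e u y c, N.Residual W f φ e u y c → 0 ≤ c)
    (hchain : ∀ i, 0 ≤ i → i < N.r → f (N.n + i) < N.k) :
    ∃ rank : ℤ → ℤ, (∀ v, 0 ≤ v → v ≤ N.r → (shortestPaths.run s).arr .done v = 1) ∧
      Search (N.Residual W f φ) N.r (N.r + 1) (fun _ _ => True) ((shortestPaths.run s).arr .dist)
        ((shortestPaths.run s).arr .done) ((shortestPaths.run s).arr .par) rank := by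
  have hr := N.r_nonneg
  rw [shortestPaths_eq]
  simp only [block_run_cons, block_run_nil]
  have P1 := Prog.run_loop (ρ := .v) (a := .lit 0) (b := .reg .r + .lit 1) (s := s)
    (p := block [.put .dist (.reg .v) (.lit (-1)), .put .done (.reg .v) (.lit 0)])
    (fun i s' => ∀ v, 0 ≤ v → v < i → s'.arr .dist v = -1 ∧ s'.arr .done v = 0)
    (x := 0) (y := N.r + 1) rfl (by simp [AExp.eval, hN.r]) (by omega)
    (by intros; omega) (by
      intro i s' _ _ hF hI v hv0 hv1
      by_cases hv : v = i
      · simp [block_run_cons, block_run_nil, run_put, Store.setArr, Store.setReg, AExp.eval, hv]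
      · simpa [block_run_cons, block_run_nil, run_put, Store.setArr, Store.setReg, AExp.eval, hv]
          using hI v hv0 (by omega))
  generalize hs1 : Prog.run _ s = s1 at P1 ⊢
  have F1 := hs1 ▸ Frame.run _ s
  have N1 : N.Loaded s1 := hN.of_frame F1 rfl
  generalize hs2 : Prog.run _ s1 = s2
  have F2 := hs2 ▸ Frame.run _ s1
  have N2 : N.Loaded s2 := N1.of_frame F2 rfl
  have hd2 : ∀ v, 0 ≤ v → v ≤ N.r → s2.arr .dist v = if v = 0 then 0 else -1 := by
    intro v h0 h1
    rw [← hs2, run_put, Store.arr_setArr, if_pos rfl, Function.update_apply]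
    simp only [AExp.eval]
    rw [(P1 v h0 (by omega)).1]
    rfl
  have hdone2 : ∀ v, 0 ≤ v → v ≤ N.r → s2.arr .done v = 0 := by
    intro v h0 h1
    rw [F2.arr .done rfl, (P1 v h0 (by omega)).2]
  have P3 := Prog.run_loop (ρ := .i) (a := .lit 0) (b := .reg .r + .lit 1) (s := s2)
    (p := block [.set .u (.lit (-1)), selectNode, finishNode])
    (fun i t => ∃ rank, Search (N.Residual W f φ) N.r i (fun _ _ => True) (t.arr .dist)
      (t.arr .done) (t.arr .par) rank)
    (x := 0) (y := N.r + 1) rfl (by simp [AExp.eval, N2.r]) (by omega) ?_ ?_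
  · obtain ⟨rank, h⟩ := P3
    exact ⟨rank, h.done_of_card hr, h⟩
  · have nd : ∀ v, 0 ≤ v → v ≤ N.r → s2.arr .done v ≠ 1 := fun v h0 h1 => by
      rw [hdone2 v h0 h1]; decide
    refine ⟨fun _ => 0, fun v h0 h1 => .inl (hdone2 v h0 h1), by rw [hd2 0 le_rfl hr]; rfl,
      fun v h0 h1 h2 => absurd h2 (nd v h0 h1), fun d v h0 h1 _ _ h2 => absurd h2 (nd d h0 h1),
      fun e u y c h h2 => absurd h2 (nd u h.bounds.1 h.bounds.2.1), fun v h0 h1 h2 h3 => ?_,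
      fun v h0 h1 h2 => absurd h2 (nd v h0 h1), ?_⟩
    · rw [hd2 v h0 h1, if_neg h2] at h3
      omega
    · rw [Finset.filter_false_of_mem fun v hv =>
        nd v (Finset.mem_Icc.1 hv).1 (Finset.mem_Icc.1 hv).2]
      rfl
  · rintro i t hi0 hi1 hF ⟨rank, hS⟩
    have Nt : N.Loaded t := N2.of_frame hF rfl
    have Wt : t.arr .wU = W := by
      rw [hF.arr .wU rfl, F2.arr .wU rfl, F1.arr .wU rfl, hW]
    have ft : t.arr .flow = f := by
      rw [hF.arr .flow rfl, F2.arr .flow rfl, F1.arr .flow rfl, hf]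
    have φt : t.arr .pot = φ := by
      rw [hF.arr .pot rfl, F2.arr .pot rfl, F1.arr .pot rfl, hφ]
    simp only [block_run_cons, block_run_nil]
    set t1 := (Prog.set .u (.lit (-1))).run (t.setReg .i i) with ht1
    have hr1 : t1.reg .r = N.r := by simp [ht1, run_set, Store.setReg, Nt.r]
    have hu1 : t1.reg .u = -1 := by simp [ht1, run_set, Store.setReg, AExp.eval]
    have ha1 : t1.arr = t.arr := rfl
    have N1' : N.Loaded t1 := ⟨by simp [ht1, run_set, Store.setReg, Nt.n], hr1,
      by simp [ht1, run_set, Store.setReg, Nt.k], by simp [ht1, run_set, Store.setReg, Nt.m],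
      Nt.tail, Nt.head, Nt.cap, Nt.wt⟩
    have hsel := selectNode_run hr1 hr hu1
    have F4 := Frame.run selectNode t1
    set t2 := selectNode.run t1 with ht2
    simp only at hsel
    rw [ha1] at hsel
    have A2 : t2.arr = t.arr := funext fun A => by rw [F4.arr A rfl, ha1]
    have N2' : N.Loaded t2 := N1'.of_frame F4 rfl
    set u := t2.reg .u with hu
    rcases hsel with ⟨_, hno⟩ | ⟨hu0, hur, hud, hdu, hmin⟩
    -- The search for a nearest node cannot come back empty before all nodes are finished.
    · obtain ⟨v, h0, h1, h2, h3⟩ := hS.exists_frontier hr (by omega) (fun v h0 h1 =>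
        ⟨N.n + v, _, chain_mem h0 h1, .inl ⟨N.tail_chain v h0 h1, N.head_chain v h0 h1, by
          rw [N.cap_chain v h0 h1]; exact hchain v h0 h1, rfl⟩⟩)
      have := hno v h0 h1 h2
      omega
    · refine ⟨Function.update rank u i, ?_⟩
      have cu : Cond.eval t2 (.le (.lit 0) (.reg .u)) = true := decide_eq_true hu0
      rw [finishNode, run_when, if_pos cu]
      simp only [block_run_cons, block_run_nil]
      have hS1 := hS.finish hu0 hur hud hdu hmin
      have hmax1 : ∀ v, 0 ≤ v → v ≤ N.r → Function.update (t.arr .done) u 1 v = 1 →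
          t.arr .dist v ≤ t.arr .dist u := by
        intro v h0 h1 h2
        by_cases hv : v = u
        · rw [hv]
        · rw [Function.update_of_ne hv] at h2
          exact hS.dist_le v u h0 h1 hu0 hur h2 hud hdu
      set t3 := (Prog.put .done (.reg .u) (.lit 1)).run t2 with ht3
      have R3 : t3.reg = t2.reg := rfl
      have D3 : t3.arr .done = Function.update (t.arr .done) u 1 := by
        simp [ht3, run_put, Store.setArr, AExp.eval, A2, hu]
      have O3 : ∀ A, A ≠ .done → t3.arr A = t.arr A := by
        intro A hA
        simp [ht3, run_put, Store.setArr, hA, A2]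
      have N3 : N.Loaded t3 := N2'.run (p := .put .done (.reg .u) (.lit 1)) rfl
      have inner := Prog.run_loop (ρ := .e) (a := .lit 0) (b := .reg .m) (s := t3) (p := scanArc)
        (fun z t' => t'.arr .done u = 1 ∧
          Search (N.Residual W f φ) N.r (i + 1) (fun e x => x ≠ u ∨ e < z)
            (t'.arr .dist) (t'.arr .done) (t'.arr .par) (Function.update rank u i) ∧
          ∀ v, 0 ≤ v → v ≤ N.r → t'.arr .done v = 1 → t'.arr .dist v ≤ t'.arr .dist u)
        (x := 0) (y := N.n + N.r) rfl N3.m (by have := N.n_nonneg; omega) ?_ ?_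
      · refine inner.2.1.mono fun e x y c hres _ => .inr (mem_arcs.1 hres.1).2
      · rw [D3, O3 .dist (by decide), O3 .par (by decide)]
        exact ⟨Function.update_self .., hS1.mono fun e x y c hres hx => by
          have := (mem_arcs.1 hres.1).1
          omega, hmax1⟩
      · rintro z t' hz0 hz1 hFz ⟨hI1, hI2, hI3⟩
        have Nz : N.Loaded (t'.setReg .e z) := N3.of_frame (hFz.setReg z) rfl
        have hdn : (scanArc.run (t'.setReg .e z)).arr .done = t'.arr .done :=
          (Frame.run scanArc (t'.setReg .e z)).arr .done rfl
        have := scanArc_run (t := t'.setReg .e z) (z := z) (u := u) Nz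
          (W := W) (f := f) (φ := φ)
          ((hFz.arr .wU rfl).trans ((O3 _ (by decide)).trans Wt))
          ((hFz.arr .flow rfl).trans ((O3 _ (by decide)).trans ft))
          ((hFz.arr .pot rfl).trans ((O3 _ (by decide)).trans φt)) hR
          (mem_arcs.2 ⟨hz0, hz1⟩) (by simp [Store.setReg])
          ((hFz.setReg z).reg .u rfl) hu0 hur hI1 hI2 hI3
        refine ⟨by rw [hdn]; exact hI1, this.1, ?_⟩
        rw [hdn]
        exact this.2

end Network

/-! ### Augmentation along a path of parents -/

namespace Network

variable {N : Network} {W f φ par rank : ℤ → ℤ}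

/-- Residual uses of one arc, even for different flows and potentials, either enter the same node or
are opposite. This separates the arcs of a path and describes what an augmentation can create. -/
theorem Residual.eq_or_swap {f' φ' : ℤ → ℤ} {u u' y y' c c' e : ℤ}
    (h : N.Residual W f φ e u y c) (h' : N.Residual W f' φ' e u' y' c') :
    y' = y ∨ (y' = u ∧ u' = y) := by
  obtain ⟨_, h1⟩ := h
  obtain ⟨_, h2⟩ := h'
  omega

theorem IsFlow.congr {f g : ℤ → ℤ} {j : ℤ} (hf : N.IsFlow f j) (h : ∀ e ∈ N.arcs, g e = f e) :
    N.IsFlow g j :=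
  ⟨fun e he => by rw [h e he]; exact hf.nonneg e he,
    fun e he => by rw [h e he]; exact hf.le_cap e he,
    fun i h0 h1 => by
      rw [← hf.cut_eq i h0 h1]
      exact Finset.sum_congr rfl fun e he => by rw [h e he]⟩

/-- Pushing one unit of flow along a path of residual arcs that is stored in `par`. -/
theorem augment_run {s : Store} {j : ℤ} (hN : N.Loaded s)
    (hf : N.IsFlow (s.arr .flow) j)
    (hrank : ∀ v, 0 ≤ v → v ≤ N.r → 0 ≤ rank v ∧ rank v ≤ N.r)
    (hpar : ∀ v, 0 ≤ v → v ≤ N.r → v ≠ 0 → ∃ u c,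
      N.Residual W (s.arr .flow) φ (s.arr .par v) u v c ∧ rank u < rank v) :
    N.IsFlow ((augment.run s).arr .flow) (j + 1) ∧ ∀ e ∈ N.arcs,
      (augment.run s).arr .flow e = s.arr .flow e ∨
        ∃ y, 0 ≤ y ∧ y ≤ N.r ∧ y ≠ 0 ∧ s.arr .par y = e := by
  have hr := N.r_nonneg
  set f := s.arr .flow with hfdef
  set par := s.arr .par with hpardef
  simp only [augment, block_run_cons, block_run_nil]
  set s1 := (Prog.set .x (.reg .r)).run s with hs1
  have N1 : N.Loaded s1 := hN.run (p := .set .x (.reg .r)) rfl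
  have hx1 : s1.reg .x = N.r := by simp [hs1, run_set, Store.setReg, AExp.eval, hN.r]
  have key := Prog.run_loop (ρ := .i) (a := .lit 0) (b := .reg .r) (s := s1)
    (p := when (.lt (.lit 0) (.reg .x)) (block [
      .set .e (.get .par (.reg .x)),
      .ite (.eq (.get .head (.reg .e)) (.reg .x))
        (block [incr .flow (.reg .e) (.lit 1), .set .x (.get .tail (.reg .e))])
        (block [incr .flow (.reg .e) (.lit (-1)), .set .x (.get .head (.reg .e))])]))
    -- The unit pushed so far runs from `x` to `r`, so it has raised exactly the cuts above `x`,
    -- although the path may also use arcs backwards. The rank of `x` drops in every iteration,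
    -- which forces `x = 0` after `r` of them. Changed arcs are recorded as parents of nodes of rank
    -- greater than that of `x`.
    (fun i t => 0 ≤ t.reg .x ∧ t.reg .x ≤ N.r ∧ (t.reg .x = 0 ∨ rank (t.reg .x) ≤ N.r - i) ∧
      (∀ l, 0 < l → l ≤ N.r → N.cut (t.arr .flow) l = j + if t.reg .x < l then 1 else 0) ∧
      ∀ e ∈ N.arcs, t.arr .flow e = f e ∨ (0 ≤ t.arr .flow e ∧ t.arr .flow e ≤ N.cap e ∧
        ∃ y, 0 ≤ y ∧ y ≤ N.r ∧ y ≠ 0 ∧ par y = e ∧ rank (t.reg .x) < rank y))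
    (x := 0) (y := N.r) rfl N1.r hr ?_ ?_
  · obtain ⟨h1, h2, h3, h4, h5⟩ := key
    set t := Prog.run _ s1 with ht
    have hx : t.reg .x = 0 := by
      refine h3.elim id fun h3 => ?_
      by_contra h0
      obtain ⟨u, c, hres, hlt⟩ := hpar _ h1 h2 h0
      have := hrank u hres.bounds.1 hres.bounds.2.1
      omega
    refine ⟨⟨fun e he => ?_, fun e he => ?_, fun i hi0 hi1 => ?_⟩, fun e he => ?_⟩
    · rcases h5 e he with h | h
      · rw [h]; exact hf.nonneg e he
      · exact h.1
    · rcases h5 e he with h | h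
      · rw [h]; exact hf.le_cap e he
      · exact h.2.1
    · rw [h4 i hi0 hi1, hx, if_pos hi0]
    · rcases h5 e he with h | ⟨_, _, y, h6, h7, h8, h9, _⟩
      · exact .inl h
      · exact .inr ⟨y, h6, h7, h8, h9⟩
  · rw [hx1]
    refine ⟨hr, le_rfl, .inr (by have := hrank N.r hr le_rfl; omega), fun l h0 h1 => ?_,
      fun e _ => .inl rfl⟩
    rw [if_neg (by omega)]
    exact (hf.cut_eq l h0 h1).trans (add_zero j).symm
  · rintro i t hi0 hi1 hF ⟨h1, h2, h3, h4, h5⟩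
    have Nt : N.Loaded (t.setReg .i i) := N1.of_frame (hF.setReg i) rfl
    have hp : t.arr .par = par := hF.arr .par rfl
    set x := t.reg .x with hx
    by_cases h0 : x = 0
    · have c1 : Cond.eval (t.setReg .i i) (.lt (.lit 0) (.reg .x)) ≠ true := by
        simp [Cond.eval, AExp.eval, Store.setReg, ← hx, h0]
      rw [run_when, if_neg c1]
      exact ⟨h1, h2, .inl h0, h4, h5⟩
    · have c1 : Cond.eval (t.setReg .i i) (.lt (.lit 0) (.reg .x)) = true := by
        simp [Cond.eval, AExp.eval, Store.setReg, ← hx]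
        omega
      rw [run_when, if_pos c1]
      simp only [block_run_cons, block_run_nil]
      obtain ⟨u, c, hres, hlt⟩ := hpar x h1 h2 h0
      have hb := hres.bounds
      set e := par x with he
      -- The parent arc of `x` has not been touched yet. Otherwise it would also be the parent arc
      -- of some `y` with larger rank; then `y` would be `x` itself or the parent node `u` of `x`,
      -- and both contradict the ranks.
      have hfe : t.arr .flow e = f e := by
        refine (h5 e hres.1).resolve_right ?_
        rintro ⟨_, _, y, h6, h7, h8, h9, h10⟩
        obtain ⟨u', c', hres', hlt'⟩ := hpar y h6 h7 h8
        rw [h9] at hres'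
        rcases hres.eq_or_swap hres' with rfl | ⟨rfl, rfl⟩
        · omega
        · omega
      have hrank' : u = 0 ∨ rank u ≤ N.r - (i + 1) := by omega
      have hrest : ∀ d : ℤ, 0 ≤ f e + d → f e + d ≤ N.cap e → ∀ e' ∈ N.arcs,
          Function.update (t.arr .flow) e (t.arr .flow e + d) e' = f e' ∨
          (0 ≤ Function.update (t.arr .flow) e (t.arr .flow e + d) e' ∧
            Function.update (t.arr .flow) e (t.arr .flow e + d) e' ≤ N.cap e' ∧
            ∃ y, 0 ≤ y ∧ y ≤ N.r ∧ y ≠ 0 ∧ par y = e' ∧ rank u < rank y) := by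
        intro d hd0 hd1 e' he'
        by_cases hee : e' = e
        · subst hee
          rw [Function.update_self, hfe]
          exact .inr ⟨hd0, hd1, x, h1, h2, h0, rfl, hlt⟩
        · rw [Function.update_of_ne hee]
          refine (h5 e' he').imp id ?_
          rintro ⟨h6, h7, y, h8, h9, h10, h11, h12⟩
          exact ⟨h6, h7, y, h8, h9, h10, h11, hlt.trans h12⟩
      set t1 := (Prog.set .e (.get .par (.reg .x))).run (t.setReg .i i) with ht1
      have N1' : N.Loaded t1 := Nt.run (p := .set .e (.get .par (.reg .x))) rfl
      have e1 : t1.reg .e = e := by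
        simp [ht1, run_set, Store.setReg, AExp.eval, hp, ← hx, he]
      have x1 : t1.reg .x = x := by
        simp [ht1, run_set, Store.setReg, ← hx]
      have f1 : t1.arr .flow = t.arr .flow := rfl
      have hnn := hf.nonneg e hres.1
      have hcap := hf.le_cap e hres.1
      rcases hres.2 with ⟨h6, h7, h8, _⟩ | ⟨h6, h7, h8, _⟩
      · have c2 : Cond.eval t1 (.eq (.get .head (.reg .e)) (.reg .x)) = true := by
          simp [Cond.eval, AExp.eval, e1, x1, N1'.head, h7]
        rw [run_ite, if_pos c2]
        simp only [block_run_cons, block_run_nil, run_incr, run_set, AExp.eval, e1, f1,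
          Store.reg_setArr, Store.reg_setReg, if_true, Store.arr_setReg, Store.arr_setArr,
          reduceCtorEq, if_false, N1'.tail, h6]
        refine ⟨hb.1, hb.2.1, hrank', fun l hl0 hl1 => ?_, hrest 1 (by omega) (by omega)⟩
        rw [cut_update hres.1, h4 l hl0 hl1, h6, h7]
        have := (mem_arcs.1 hres.1)
        have := N.tail_lt_head e this.1 this.2
        split_ifs <;> omega
      · have c2 : Cond.eval t1 (.eq (.get .head (.reg .e)) (.reg .x)) ≠ true := by
          simp [Cond.eval, AExp.eval, e1, x1, N1'.head, h6, hb.2.2.2.2]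
        rw [run_ite, if_neg c2]
        simp only [block_run_cons, block_run_nil, run_incr, run_set, AExp.eval, e1, f1,
          Store.reg_setArr, Store.reg_setReg, if_true, Store.arr_setReg, Store.arr_setArr,
          reduceCtorEq, if_false, N1'.head, h6]
        refine ⟨hb.1, hb.2.1, hrank', fun l hl0 hl1 => ?_, hrest (-1) (by omega) (by omega)⟩
        rw [cut_update hres.1, h4 l hl0 hl1, h6, h7]
        have := (mem_arcs.1 hres.1)
        have := N.tail_lt_head e this.1 this.2
        split_ifs <;> omega

/-! ### Initial potentials and the weights of `N^U` -/

/-- The loop that computes the weights of heaviest paths makes `π` a feasible potential. -/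
theorem step3_run {s : Store} (hN : N.Loaded s) :
    ∀ e ∈ N.arcs, N.wt e + (step3.run s).arr .pi (N.head e) ≤ (step3.run s).arr .pi (N.tail e) := by
  have hr := N.r_nonneg
  simp only [step3, block_run_cons, block_run_nil]
  generalize hs1 : Prog.run _ s = s1
  have N1 : N.Loaded s1 := hN.of_frame (hs1 ▸ Frame.run _ s) rfl
  have key := Prog.run_loop (ρ := .i) (a := .lit 0) (b := .reg .r) (s := s1) (p := block [
    .set .u (.reg .r - .lit 1 - .reg .i),
    .loop .e (.lit 0) (.reg .m)
      (when (.eq (.get .tail (.reg .e)) (.reg .u)) (block [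
        .set .c (.get .wN (.reg .e) + .get .pi (.get .head (.reg .e))),
        when (.lt (.get .pi (.reg .u)) (.reg .c)) (.put .pi (.reg .u) (.reg .c))]))])
    -- Nodes from `r - i` upwards are settled; later iterations change `π` only at smaller nodes.
    (fun i t => ∀ e ∈ N.arcs, N.r - i ≤ N.tail e →
      N.wt e + t.arr .pi (N.head e) ≤ t.arr .pi (N.tail e))
    (x := 0) (y := N.r) rfl N1.r hr ?_ ?_
  · intro e he
    have hm := mem_arcs.1 he
    have := N.tail_nonneg e hm.1 hm.2
    exact key e he (by omega)
  · intro e he h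
    have hm := mem_arcs.1 he
    have := N.tail_lt_head e hm.1 hm.2
    have := N.head_le e hm.1 hm.2
    omega
  · intro i t hi0 hi1 hF hI
    have Nt : N.Loaded (t.setReg .i i) := N1.of_frame (hF.setReg i) rfl
    simp only [block_run_cons, block_run_nil]
    set t1 := (Prog.set .u (.reg .r - .lit 1 - .reg .i)).run (t.setReg .i i) with ht1
    have N1' : N.Loaded t1 := Nt.run (p := .set .u (.reg .r - .lit 1 - .reg .i)) rfl
    have hrt : t.reg .r = N.r := by simpa [Store.setReg] using Nt.r
    set u := N.r - 1 - i with hu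
    have u1 : t1.reg .u = u := by
      simp [ht1, run_set, Store.setReg, AExp.eval, AExp.eval_sub, hrt, hu]
    have inner := Prog.run_loop (ρ := .e) (a := .lit 0) (b := .reg .m) (s := t1)
      (p := (when (.eq (.get .tail (.reg .e)) (.reg .u)) (block [
        .set .c (.get .wN (.reg .e) + .get .pi (.get .head (.reg .e))),
        when (.lt (.get .pi (.reg .u)) (.reg .c)) (.put .pi (.reg .u) (.reg .c))])))
      (fun z t' => ∀ e ∈ N.arcs, u < N.tail e ∨ (N.tail e = u ∧ e < z) →
        N.wt e + t'.arr .pi (N.head e) ≤ t'.arr .pi (N.tail e))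
      (x := 0) (y := N.n + N.r) rfl N1'.m (by have := N.n_nonneg; omega) ?_ ?_
    · intro e he h
      have := (mem_arcs.1 he).2
      exact inner e he (by omega)
    · intro e he h
      have := (mem_arcs.1 he).1
      exact hI e he (by omega)
    · intro z t' hz0 hz1 hFz hJ
      have Nz : N.Loaded (t'.setReg .e z) := N1'.of_frame (hFz.setReg z) rfl
      have uz : t'.reg .u = u := (hFz.reg .u rfl).trans u1
      set p := t'.arr .pi with hp
      have c1 : Cond.eval (t'.setReg .e z) (.eq (.get .tail (.reg .e)) (.reg .u)) =
          decide (N.tail z = u) := by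
        simp only [Cond.eval, AExp.eval, Nz.tail]
        simp [Store.setReg, uz]
      rw [run_when, c1]
      have hlt := N.tail_lt_head z hz0 hz1
      by_cases h1 : N.tail z = u
      · rw [if_pos (by simpa using h1)]
        simp only [block_run_cons, block_run_nil, run_set, run_when, run_put]
        have c2 : AExp.eval (t'.setReg .e z) (.get .wN (.reg .e) + .get .pi (.get .head (.reg .e)))
            = N.wt z + p (N.head z) := by
          simp only [AExp.eval, Nz.wt, Nz.head]
          simp [Store.setReg, hp]
        rw [c2]
        simp only [Cond.eval, AExp.eval, Store.reg_setReg, Store.arr_setReg, reduceCtorEq, if_true,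
          if_false, uz, decide_eq_true_eq, ← hp]
        split_ifs with h2
        · rw [Store.arr_setArr, if_pos rfl]
          simp only [Store.arr_setReg, ← hp]
          intro e he h
          have hm := mem_arcs.1 he
          have := N.tail_lt_head e hm.1 hm.2
          -- The head of `e` lies strictly above `u`, so raising `π` at `u` can only help the
          -- inequality.
          rw [Function.update_of_ne (by omega)]
          by_cases h3 : N.tail e = u
          · rw [h3, Function.update_self]
            by_cases h4 : e = z
            · rw [h4]
            · have := hJ e he (by omega)
              rw [h3] at this
              omega
          · rw [Function.update_of_ne h3]
            exact hJ e he (by omega)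
        · intro e he h
          simp only [Store.arr_setReg, ← hp]
          by_cases h4 : e = z
          · rw [h4, h1]
            omega
          · exact hJ e he (by omega)
      · rw [if_neg (by simpa using h1)]
        intro e he h
        by_cases h4 : e = z
        · subst h4
          exact hJ e he (by omega)
        · exact hJ e he (by omega)

theorem step4_run {s : Store} (hN : N.Loaded s) : ∀ e ∈ N.arcs,
    (step4.run s).arr .wU e = s.arr .pi (N.tail e) - s.arr .pi (N.head e) - N.wt e := by
  intro e he
  have := mem_arcs.1 he
  have key := run_loop_put (A := .wU) (ρ := .e) (a := .lit 0) (b := .reg .m) (j := .reg .e)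
    (e := .get .pi (.get .tail (.reg .e)) - .get .pi (.get .head (.reg .e)) - .get .wN (.reg .e))
    (s := s) 0 (N.n + N.r) 0
    (fun e => s.arr .pi (N.tail e) - s.arr .pi (N.head e) - N.wt e) rfl hN.m
    (by have := N.n_nonneg; have := N.r_nonneg; omega)
    (fun s' i _ => by simp [AExp.eval, Store.setReg]) (fun s' i _ _ hF => by
      have Ns : N.Loaded (s'.setReg .e i) := hN.of_frame (hF.setReg i) rfl
      simp only [AExp.eval_sub, AExp.eval, Ns.tail, Ns.head, Ns.wt, (hF.setReg i).arr .pi rfl]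
      simp [Store.setReg]) e
  rw [if_pos (by omega), sub_zero] at key
  exact key

/-! ### Successive shortest paths -/

open AExp in
/-- Add the distances to the potentials. -/
def raisePotentials : Prog :=
  .loop .v (lit 0) (reg .r + lit 1)
    (when (.le (lit 0) (get .dist (reg .v))) (incr .pot (reg .v) (get .dist (reg .v))))

theorem raisePotentials_run {s : Store} (hN : N.Loaded s)
    (hd : ∀ v, 0 ≤ v → v ≤ N.r → 0 ≤ s.arr .dist v) :
    ∀ v, 0 ≤ v → v ≤ N.r → (raisePotentials.run s).arr .pot v = s.arr .pot v + s.arr .dist v := by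
  have key := Prog.run_loop (ρ := .v) (a := .lit 0) (b := .reg .r + .lit 1) (s := s)
    (p := when (.le (.lit 0) (.get .dist (.reg .v))) (incr .pot (.reg .v) (.get .dist (.reg .v))))
    (fun i t => ∀ v, t.arr .pot v =
      if 0 ≤ v ∧ v < i then s.arr .pot v + s.arr .dist v else s.arr .pot v)
    (x := 0) (y := N.r + 1) rfl (by simp [AExp.eval, hN.r]) (by have := N.r_nonneg; omega) ?_ ?_
  · intro v h0 h1
    rw [raisePotentials, key, if_pos (by omega)]
  · intro v
    rw [if_neg (by omega)]
  · intro i t h0 h1 hF hI v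
    have hdi := hd i h0 (by omega)
    rw [← hF.arr .dist rfl] at hdi
    rw [run_when, if_pos (by simpa [Cond.eval, AExp.eval, Store.setReg] using hdi), run_incr,
      Store.arr_setArr, if_pos rfl]
    simp only [AExp.eval, Store.reg_setReg, if_true, Store.arr_setReg, hF.arr .dist rfl]
    rw [Function.update_apply, hI, hI]
    by_cases hv : v = i
    · subst hv
      rw [if_pos rfl, if_neg (by omega), if_pos (by omega)]
    · rw [if_neg hv]
      split_ifs <;> first | rfl | omega

open AExp in
/-- Successive shortest paths compute a flow of value `k` that satisfies complementary slackness. -/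
theorem step5_run {s : Store} (hN : N.Loaded s) (hW : ∀ e ∈ N.arcs, 0 ≤ s.arr .wU e) :
    N.IsFlow ((step5.run s).arr .flow) N.k ∧ ∃ φ : ℤ → ℤ, ∀ e u y c,
      N.Residual (s.arr .wU) ((step5.run s).arr .flow) φ e u y c → 0 ≤ c := by
  have hr := N.r_nonneg
  have hn := N.n_nonneg
  set W := s.arr .wU with hWdef
  simp only [step5, block_run_cons, block_run_nil]
  have hflow := run_loop_put (A := .flow) (ρ := .e) (a := lit 0) (b := reg .m) (j := reg .e)
    (e := lit 0) (s := s) 0 (N.n + N.r) 0 (fun _ => 0) rfl hN.m (by omega)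
    (fun s' i _ => by simp [AExp.eval, Store.setReg]) (fun s' i _ _ _ => rfl)
  generalize hs1 : Prog.run _ s = s1 at hflow ⊢
  have F1 := hs1 ▸ Frame.run _ s
  have N1 : N.Loaded s1 := hN.of_frame F1 rfl
  have hpot := run_loop_put (A := .pot) (ρ := .v) (a := lit 0) (b := reg .r + lit 1) (j := reg .v)
    (e := lit 0) (s := s1) 0 (N.r + 1) 0 (fun _ => 0) rfl (by simp [AExp.eval, N1.r]) (by omega)
    (fun s' i _ => by simp [AExp.eval, Store.setReg]) (fun s' i _ _ _ => rfl)
  generalize hs2 : Prog.run _ s1 = s2 at hpot ⊢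
  have F2 := hs2 ▸ Frame.run _ s1
  have N2 : N.Loaded s2 := N1.of_frame F2 rfl
  have hf2 : ∀ e ∈ N.arcs, s2.arr .flow e = 0 := by
    intro e he
    have := mem_arcs.1 he
    rw [F2.arr .flow rfl, hflow, if_pos (by omega)]
  have hφ2 : ∀ v, 0 ≤ v → v ≤ N.r → s2.arr .pot v = 0 := by
    intro v h0 h1
    rw [hpot, if_pos (by omega)]
  have key := Prog.run_loop (ρ := .j) (a := lit 0) (b := reg .k) (s := s2)
    (p := block [shortestPaths, raisePotentials, augment])
    (fun j t => N.IsFlow (t.arr .flow) j ∧ ∀ e u y c,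
      N.Residual W (t.arr .flow) (t.arr .pot) e u y c → 0 ≤ c)
    (x := 0) (y := N.k) rfl N2.k N.k_nonneg ?_ ?_
  · exact ⟨key.1, _, key.2⟩
  · refine ⟨⟨fun e he => (hf2 e he).ge, fun e he => ?_, fun i _ _ => ?_⟩, fun e u y c hres => ?_⟩
    · rw [hf2 e he]
      have hm := mem_arcs.1 he
      by_cases h : e < N.n
      · rw [N.cap_vertex e hm.1 h]; exact zero_le_one
      · have := N.cap_chain (e - N.n) (by omega) (by omega)
        rw [add_sub_cancel] at this
        rw [this]
        exact N.k_nonneg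
    · exact Finset.sum_eq_zero fun e he => by rw [hf2 e he, ite_self]
    -- The zero flow has no backward residual arcs, and with zero potentials a forward arc costs its
    -- weight in `N^U`.
    · have hb := hres.bounds
      have := hW e hres.1
      obtain ⟨he, ⟨_, _, _, rfl⟩ | ⟨_, _, h, _⟩⟩ := hres
      · rw [hφ2 u hb.1 hb.2.1, hφ2 y hb.2.2.1 hb.2.2.2.1]
        omega
      · rw [hf2 e he] at h
        omega
  · rintro j t hj0 hj1 hF ⟨hfl, hres⟩
    set t0 := t.setReg .j j with ht0
    have N0 : N.Loaded t0 := N2.of_frame (hF.setReg j) rfl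
    have W0 : t0.arr .wU = W := by
      rw [(hF.setReg j).arr .wU rfl, F2.arr .wU rfl, F1.arr .wU rfl]
    simp only [block_run_cons, block_run_nil]
    obtain ⟨rank, hdone, hS⟩ := shortestPaths_run (W := W) (f := t.arr .flow) (φ := t.arr .pot) N0
      W0 rfl rfl hres (fun i h0 h1 => by
        -- A c-arc carries no more than the cut it crosses, that is, at most `j < k`.
        have := le_cut hfl.nonneg (chain_mem h0 h1) (i := i + 1)
          (by rw [N.tail_chain i h0 h1]; omega) (by rw [N.head_chain i h0 h1])
        rw [hfl.cut_eq _ (by omega) (by omega)] at this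
        omega)
    have F3 := Frame.run shortestPaths t0
    set t1 := shortestPaths.run t0 with ht1
    have N1' : N.Loaded t1 := N0.of_frame F3 rfl
    have hd : ∀ v, 0 ≤ v → v ≤ N.r → 0 ≤ t1.arr .dist v := fun v h0 h1 =>
      hS.dist_nonneg v h0 h1 (hdone v h0 h1)
    have hpot' := raisePotentials_run N1' hd
    have F4 := Frame.run raisePotentials t1
    set t2 := raisePotentials.run t1 with ht2
    have N2' : N.Loaded t2 := N1'.of_frame F4 rfl
    have f2 : t2.arr .flow = t.arr .flow := by
      rw [F4.arr .flow rfl, F3.arr .flow rfl]; rfl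
    have p2 : t2.arr .par = t1.arr .par := F4.arr .par rfl
    have φ1 : t1.arr .pot = t.arr .pot := by rw [F3.arr .pot rfl]; rfl
    have hpar : ∀ v, 0 ≤ v → v ≤ N.r → v ≠ 0 → ∃ u c,
        N.Residual W (t.arr .flow) (t.arr .pot) (t1.arr .par v) u v c ∧ rank u < rank v ∧
          t1.arr .dist v = t1.arr .dist u + c := by
      intro v h0 h1 h2
      obtain ⟨u, c, _, _, h3, _, h4, h5⟩ := hS.parent v h0 h1 h2 (hd v h0 h1)
      exact ⟨u, c, h3, h5 (hdone v h0 h1), h4⟩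
    have haug := augment_run (W := W) (φ := t.arr .pot) (rank := rank) N2' (j := j)
      (by rw [f2]; exact hfl)
      (fun v h0 h1 => by have := hS.rank_bound v h0 h1 (hdone v h0 h1); omega)
      (fun v h0 h1 h2 => by
        obtain ⟨u, c, h3, h4, _⟩ := hpar v h0 h1 h2
        exact ⟨u, c, by rwa [f2, p2], h4⟩)
    have F5 := Frame.run augment t2
    set t3 := augment.run t2 with ht3
    refine ⟨haug.1, fun e u y c hres3 => ?_⟩
    rw [F5.arr .pot rfl] at hres3
    have hb := hres3.bounds
    have hu := hpot' u hb.1 hb.2.1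
    have hy := hpot' y hb.2.2.1 hb.2.2.2.1
    rw [φ1] at hu hy
    -- An arc with unchanged flow was residual before, in the same direction; its new reduced cost
    -- is the old one plus `dist u - dist y`, nonnegative by relaxation. Any changed arc is a parent
    -- arc.
    rcases haug.2 e hres3.1 with hsame | ⟨v, hv0, hv1, hv2, hv⟩
    · rw [f2] at hsame
      obtain ⟨he, h⟩ := hres3
      rw [hsame] at h
      have old : N.Residual W (t.arr .flow) (t.arr .pot) e u y
          (c - t1.arr .dist u + t1.arr .dist y) := by
        refine ⟨he, h.imp (fun h => ⟨h.1, h.2.1, h.2.2.1, ?_⟩)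
          (fun h => ⟨h.1, h.2.1, h.2.2.1, ?_⟩)⟩
        · have := h.2.2.2; omega
        · have := h.2.2.2; omega
      have := (hS.relaxed e u y _ old (hdone u hb.1 hb.2.1) trivial).2
      omega
    -- A parent arc is tight, `dist v = dist x + c'`, so after the update its reduced cost is `0` in
    -- either direction.
    · obtain ⟨x, c', hx, _, hx'⟩ := hpar v hv0 hv1 hv2
      rw [← p2, hv] at hx
      have hbx := hx.bounds
      have hux := hpot' x hbx.1 hbx.2.1
      have huv := hpot' v hv0 hv1
      rw [φ1] at hux huv
      have h1 := hx.2
      have h2 := hres3.2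
      rcases hx.eq_or_swap hres3 with h3 | h3
      · subst h3
        have : u = x := by omega
        subst this
        omega
      · obtain ⟨rfl, rfl⟩ := h3
        omega

end Network

/-! ## Decomposing the flow -/

namespace Network

variable {N : Network} {f use colour : ℤ → ℤ} {j x : ℤ}

variable (N) in
/-- The state of the decomposition of the flow `f` when the `j`-th path has reached the node `x`. -/
structure Decomposition (f : ℤ → ℤ) (j x : ℤ) (use colour : ℤ → ℤ) : Prop where
  nonneg : ∀ e ∈ N.arcs, 0 ≤ use e
  cut_eq : ∀ i, 0 < i → i ≤ N.r → N.cut use i = N.k - j + if x < i then 1 else 0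
  colour_eq : ∀ v, 0 ≤ v → v < N.n → (colour v = 0 ∧ use v = f v) ∨
    (0 < colour v ∧ colour v ≤ j ∧ use v = 0 ∧ 0 < f v)
  disjoint : ∀ u v, 0 ≤ u → u < N.n → 0 ≤ v → v < N.n → u ≠ v → colour u = colour v →
    0 < colour u → N.head u ≤ N.tail v ∨ N.head v ≤ N.tail u
  head_le : ∀ v, 0 ≤ v → v < N.n → colour v = j → N.head v ≤ x

/-- The start is treated as a completed path number `0`: it stands at the sink, and nothing has been
removed from the flow. -/
theorem IsFlow.decomposition (hf : N.IsFlow f N.k) (huse : ∀ e ∈ N.arcs, use e = f e)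
    (hcol : ∀ v, 0 ≤ v → v < N.n → colour v = 0) : N.Decomposition f 0 N.r use colour := by
  have hr := N.r_nonneg
  have hu := hf.congr huse
  refine ⟨hu.nonneg, fun i h0 h1 => ?_, fun v h0 h1 => .inl ⟨hcol v h0 h1, ?_⟩,
    fun u v h0 h1 _ _ _ _ h2 => ?_, fun v h0 h1 _ => N.head_le v h0 (by omega)⟩
  · rw [hu.cut_eq i h0 h1, if_neg (by omega)]
    ring
  · exact huse v (mem_arcs.2 (by omega))
  · rw [hcol u h0 h1] at h2
    omega

/-- At the source the path still owes one unit to every cut, which accounts for the shift from `k -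
j` to `k - (j + 1) + 1`. Colour `j + 1` is still unused. -/
theorem Decomposition.next (h : N.Decomposition f j N.r use colour) (hj : 0 ≤ j) :
    N.Decomposition f (j + 1) 0 use colour := by
  refine ⟨h.nonneg, fun i h0 h1 => ?_, fun v h0 h1 => ?_, h.disjoint, fun v h0 h1 h2 => ?_⟩
  · rw [h.cut_eq i h0 h1, if_neg (by omega), if_pos h0]
    ring
  · have := h.colour_eq v h0 h1
    omega
  · have := h.colour_eq v h0 h1
    omega

/-- All arcs of colour `j` so far end at or before `x`, where the new arc begins, so the arcs of one
colour do not overlap. As `f ≤ 1` on vertex arcs, a single use empties such an arc. -/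
theorem Decomposition.step (h : N.Decomposition f j x use colour)
    (hf : ∀ v, 0 ≤ v → v < N.n → f v ≤ 1) (hj : 0 < j) {e : ℤ} (he : e ∈ N.arcs)
    (hx : N.tail e = x) (hu : 0 < use e) :
    N.Decomposition f j (N.head e) (Function.update use e (use e + -1))
      (if e < N.n then Function.update colour e j else colour) := by
  have hr := N.r_nonneg
  have hm := mem_arcs.1 he
  have hlt := N.tail_lt_head e hm.1 hm.2
  have hcol : ∀ v, v < N.n → (if e < N.n then Function.update colour e j else colour) v =
      if v = e then j else colour v := by
    intro v hv
    by_cases hve : v = e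
    · subst hve; simp [hv]
    · split_ifs <;> simp [hve]
  have hnew : e < N.n → colour e = 0 ∧ use e = f e := fun h1 => by
    have := h.colour_eq e hm.1 h1
    omega
  refine ⟨fun e' he' => ?_, fun i h0 h1 => ?_, fun v h0 h1 => ?_,
    fun u v hu0 hu1 hv0 hv1 huv => ?_, fun v h0 h1 => ?_⟩
  · by_cases hee : e' = e
    · subst hee; rw [Function.update_self]; omega
    · rw [Function.update_of_ne hee]; exact h.nonneg e' he'
  · rw [cut_update he, h.cut_eq i h0 h1]
    split_ifs <;> omega
  · rw [hcol v h1]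
    by_cases hve : v = e
    · subst hve
      have := hnew h1
      have := hf v h0 h1
      rw [if_pos rfl, Function.update_self]
      omega
    · rw [if_neg hve, Function.update_of_ne hve]
      exact h.colour_eq v h0 h1
  · rw [hcol u hu1, hcol v hv1]
    by_cases hue : u = e
    · subst hue
      rw [if_pos rfl, if_neg (Ne.symm huv)]
      intro h1 _
      have := h.head_le v hv0 hv1 h1.symm
      omega
    · rw [if_neg hue]
      by_cases hve : v = e
      · subst hve
        rw [if_pos rfl]
        intro h1 _
        have := h.head_le u hu0 hu1 h1
        omega
      · rw [if_neg hve]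
        exact h.disjoint u v hu0 hu1 hv0 hv1 huv
  · rw [hcol v h1]
    by_cases hve : v = e
    · subst hve
      intro _
      exact le_rfl
    · rw [if_neg hve]
      intro h2
      have := h.head_le v h0 h1 h2
      omega

/-- The remaining amount grows by one from cut `x` to cut `x + 1`. At the source it grows from `0`
to `k - j + 1`. -/
theorem Decomposition.exists_arc (h : N.Decomposition f j x use colour) (hx0 : 0 ≤ x)
    (hxr : x < N.r) (hj : j ≤ N.k) : ∃ e ∈ N.arcs, N.tail e = x ∧ 0 < use e := by
  refine exists_outgoing h.nonneg ?_
  rw [h.cut_eq (x + 1) (by omega) (by omega), if_pos (by omega)]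
  by_cases h0 : x = 0
  · subst h0
    rw [cut_zero]
    omega
  · rw [h.cut_eq x (by omega) (by omega), if_neg (by omega)]
    omega

/-- After `k` paths every cut is empty, hence so is every vertex arc; one that carried flow can only
have been emptied by being coloured. -/
theorem Decomposition.colour_pos (h : N.Decomposition f N.k N.r use colour) {v : ℤ} (h0 : 0 ≤ v)
    (h1 : v < N.n) (hf : 0 < f v) : 0 < colour v ∧ colour v ≤ N.k := by
  have hr := N.r_nonneg
  have hv : v ∈ N.arcs := mem_arcs.2 (by omega)
  have ht := N.tail_nonneg v h0 (by omega)
  have hlt := N.tail_lt_head v h0 (by omega)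
  have hle := N.head_le v h0 (by omega)
  have := le_cut h.nonneg hv (i := N.tail v + 1) (by omega) (by omega)
  rw [h.cut_eq _ (by omega) (by omega), if_neg (by omega)] at this
  have := h.colour_eq v h0 h1
  omega

/-! ### Tracing the paths on the machine -/

open AExp in
/-- Let the current path leave the node in register `u`. -/
def takeArc : Prog :=
  .loop .e (lit 0) (reg .m)
    (when (.and (.eq (reg .took) (lit 0)) (.and (.eq (get .tail (reg .e)) (reg .u))
        (.lt (lit 0) (get .use (reg .e))))) (block [
      incr .use (reg .e) (lit (-1)),
      .set .cur (get .head (reg .e)),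
      .set .took (lit 1),
      when (.lt (reg .e) (reg .n)) (.put .colour (reg .e) (reg .j))]))

open AExp in
/-- Follow one path from the source to the sink. -/
def tracePath : Prog := block [
  .set .cur (lit 0),
  .loop .u (lit 0) (reg .r)
    (when (.eq (reg .cur) (reg .u)) (block [.set .took (lit 0), takeArc]))]

open AExp in
theorem step7_eq : step7 = block [
    .loop .v (lit 0) (reg .n) (block [
      .put .colour (reg .v) (lit 0),
      .put .use (reg .v) (get .Q (reg .v))]),
    .loop .e (reg .n) (reg .m) (.put .use (reg .e) (get .flow (reg .e))),
    .loop .j (lit 1) (reg .k + lit 1) tracePath] := rfl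

theorem takeArc_run {s : Store} (hN : N.Loaded s) (ht : s.reg .took = 0) (hu : s.reg .u = x)
    (hj : s.reg .j = j) (hex : ∃ e ∈ N.arcs, N.tail e = x ∧ 0 < s.arr .use e) :
    ∃ e ∈ N.arcs, N.tail e = x ∧ 0 < s.arr .use e ∧
      (takeArc.run s).reg .cur = N.head e ∧
      (takeArc.run s).arr .use = Function.update (s.arr .use) e (s.arr .use e + -1) ∧
      (takeArc.run s).arr .colour =
        if e < N.n then Function.update (s.arr .colour) e j else s.arr .colour := by
  have key := Prog.run_loop (ρ := .e) (a := .lit 0) (b := .reg .m) (s := s) (p :=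
    (when (.and (.eq (.reg .took) (.lit 0)) (.and (.eq (.get .tail (.reg .e)) (.reg .u))
        (.lt (.lit 0) (.get .use (.reg .e))))) (block [
      incr .use (.reg .e) (.lit (-1)),
      .set .cur (.get .head (.reg .e)),
      .set .took (.lit 1),
      when (.lt (.reg .e) (.reg .n)) (.put .colour (.reg .e) (.reg .j))])))
    -- Either no usable arc lies below `z`, or the first one has been taken; from then on `took`
    -- blocks all others.
    (fun z t =>
      (t.reg .took = 0 ∧ t.arr .use = s.arr .use ∧ t.arr .colour = s.arr .colour ∧
        ∀ e, 0 ≤ e → e < z → N.tail e = x → s.arr .use e ≤ 0) ∨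
      (t.reg .took = 1 ∧ ∃ e ∈ N.arcs, N.tail e = x ∧ 0 < s.arr .use e ∧
        t.reg .cur = N.head e ∧
        t.arr .use = Function.update (s.arr .use) e (s.arr .use e + -1) ∧
        t.arr .colour =
          if e < N.n then Function.update (s.arr .colour) e j else s.arr .colour))
    (x := 0) (y := N.n + N.r) rfl hN.m (by have := N.n_nonneg; have := N.r_nonneg; omega)
    (.inl ⟨ht, rfl, rfl, by intros; omega⟩) ?_
  · rcases key with ⟨_, _, _, h⟩ | ⟨_, h⟩
    · obtain ⟨e, he, h1, h2⟩ := hex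
      have := h e (mem_arcs.1 he).1 (mem_arcs.1 he).2 h1
      omega
    · exact h
  · intro z t hz0 hz1 hF hI
    have Nt : N.Loaded (t.setReg .e z) := hN.of_frame (hF.setReg z) rfl
    have ut : t.reg .u = x := (hF.reg .u rfl).trans hu
    have jt : t.reg .j = j := (hF.reg .j rfl).trans hj
    have nt : t.reg .n = N.n := by simpa [Store.setReg] using Nt.n
    rcases hI with ⟨h1, h2, h3, h4⟩ | ⟨h1, h2⟩
    · have c1 : Cond.eval (t.setReg .e z) (.and (.eq (.reg .took) (.lit 0))
          (.and (.eq (.get .tail (.reg .e)) (.reg .u)) (.lt (.lit 0) (.get .use (.reg .e))))) =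
          decide (N.tail z = x ∧ 0 < s.arr .use z) := by
        simp only [Cond.eval, AExp.eval, Nt.tail]
        simp [Store.setReg, h1, h2, ut]
      rw [run_when, c1]
      by_cases hc : N.tail z = x ∧ 0 < s.arr .use z
      · rw [if_pos (decide_eq_true hc)]
        refine .inr ⟨?_, z, mem_arcs.2 ⟨hz0, hz1⟩, hc.1, hc.2, ?_, ?_, ?_⟩
        · simp only [block_run_cons, block_run_nil, run_incr, run_set, run_when, run_put]
          split_ifs <;> simp [Store.setReg, Store.setArr, AExp.eval]
        · simp only [block_run_cons, block_run_nil, run_incr, run_set, run_when, run_put, AExp.eval]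
          have := Nt.head
          simp only [Store.arr_setReg] at this
          split_ifs <;> simp [Store.setReg, Store.setArr, this]
        · simp only [block_run_cons, block_run_nil, run_incr, run_set, run_when, run_put]
          split_ifs <;> simp [Store.setReg, Store.setArr, AExp.eval, h2]
        · simp only [block_run_cons, block_run_nil, run_incr, run_set, run_when, run_put, Cond.eval,
            AExp.eval]
          by_cases hzn : z < N.n
          · simp [Store.setReg, Store.setArr, nt, hzn, h3, jt]
          · simp [Store.setReg, Store.setArr, nt, hzn, h3]
      · rw [if_neg (by simpa using hc)]
        refine .inl ⟨by simpa [Store.setReg] using h1, h2, h3, fun e he0 he1 he2 => ?_⟩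
        by_cases hez : e = z
        · subst hez
          by_contra h5
          exact hc ⟨he2, by omega⟩
        · exact h4 e he0 (by omega) he2
    · rw [run_when, if_neg (by simp [Cond.eval, AExp.eval, Store.setReg, h1])]
      refine .inr ⟨by simpa [Store.setReg] using h1, ?_⟩
      simpa [Store.setReg] using h2

/-- Nodes increase along a path, so one upward pass over `u` meets all nodes of the path in order.
The invariant is that `cur` is never behind `u`, which yields `cur = r` at the end. -/
theorem tracePath_run {s : Store} (hN : N.Loaded s) (hf : ∀ v, 0 ≤ v → v < N.n → f v ≤ 1)
    (hj0 : 0 < j) (hjk : j ≤ N.k) (hj : s.reg .j = j)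
    (h : N.Decomposition f j 0 (s.arr .use) (s.arr .colour)) :
    N.Decomposition f j N.r ((tracePath.run s).arr .use) ((tracePath.run s).arr .colour) := by
  simp only [tracePath, block_run_cons, block_run_nil]
  set s1 := (Prog.set .cur (.lit 0)).run s with hs1
  have N1 : N.Loaded s1 := hN.run (p := .set .cur (.lit 0)) rfl
  have key := Prog.run_loop (ρ := .u) (a := .lit 0) (b := .reg .r) (s := s1) (p :=
      when (.eq (.reg .cur) (.reg .u)) (block [.set .took (.lit 0), takeArc]))
    (fun z t => z ≤ t.reg .cur ∧ t.reg .cur ≤ N.r ∧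
      N.Decomposition f j (t.reg .cur) (t.arr .use) (t.arr .colour))
    (x := 0) (y := N.r) rfl N1.r N.r_nonneg ?_ ?_
  · have h1 := key.2.2
    rwa [le_antisymm key.2.1 key.1] at h1
  · have : s1.reg .cur = 0 := by simp [hs1, run_set, Store.setReg, AExp.eval]
    rw [this]
    exact ⟨le_rfl, N.r_nonneg, h⟩
  · rintro z t hz0 hz1 hF ⟨h1, h2, h3⟩
    have c1 : Cond.eval (t.setReg .u z) (.eq (.reg .cur) (.reg .u)) = decide (t.reg .cur = z) := by
      simp [Cond.eval, AExp.eval, Store.setReg]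
    rw [run_when, c1]
    by_cases hz : t.reg .cur = z
    · rw [if_pos (decide_eq_true hz)]
      simp only [block_run_cons, block_run_nil]
      have Nt : N.Loaded (t.setReg .u z) := N1.of_frame (hF.setReg z) rfl
      rw [hz] at h3
      obtain ⟨e, he, h4, h5, h6, h7, h8⟩ := takeArc_run (j := j) (x := z)
        (Nt.run (p := .set .took (.lit 0)) rfl)
        (by simp [run_set, Store.setReg, AExp.eval]) (by simp [run_set, Store.setReg])
        (by
          have : t.reg .j = j := (hF.reg .j rfl).trans
            (by simpa [hs1, run_set, Store.setReg] using hj)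
          simpa [run_set, Store.setReg] using this)
        (h3.exists_arc hz0 hz1 hjk)
      have hm := mem_arcs.1 he
      have := N.tail_lt_head e hm.1 hm.2
      have := N.head_le e hm.1 hm.2
      rw [h6, h7, h8]
      exact ⟨by omega, by omega, h3.step hf hj0 he h4 h5⟩
    · rw [if_neg (by simpa using hz)]
      have : (t.setReg .u z).reg .cur = t.reg .cur := by simp [Store.setReg]
      rw [this]
      exact ⟨by omega, h2, h3⟩

theorem step6_run {s : Store} (hN : N.Loaded s) : ∀ v, 0 ≤ v → v < N.n →
    (step6.run s).arr .Q v = if 0 < s.arr .flow v then 1 else 0 := by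
  refine Prog.run_loop (fun i t => ∀ v, 0 ≤ v → v < i → t.arr .Q v =
    if 0 < s.arr .flow v then 1 else 0) (x := 0) (y := N.n) rfl hN.n N.n_nonneg
    (by intros; omega) ?_
  intro i t h0 h1 hF hI v hv0 hv1
  rw [run_ite]
  simp only [Cond.eval, AExp.eval, Store.reg_setReg, Store.arr_setReg, if_true, hF.arr .flow rfl,
    decide_eq_true_eq, run_put]
  by_cases hv : v = i
  · subst hv
    split_ifs <;> simp [Store.setArr]
  · have := hI v hv0 (by omega)
    split_ifs at this ⊢ <;> simp [Store.setArr, Store.setReg, hv, this]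

theorem step7_run {s : Store} (hN : N.Loaded s) (hf : N.IsFlow (s.arr .flow) N.k)
    (hQ : ∀ v, 0 ≤ v → v < N.n → s.arr .Q v = s.arr .flow v) :
    ∃ use, N.Decomposition (s.arr .flow) N.k N.r use ((step7.run s).arr .colour) := by
  have hn := N.n_nonneg
  have hr := N.r_nonneg
  rw [step7_eq]
  simp only [block_run_cons, block_run_nil]
  have P1 := Prog.run_loop (ρ := .v) (a := .lit 0) (b := .reg .n) (s := s)
    (p := block [.put .colour (.reg .v) (.lit 0), .put .use (.reg .v) (.get .Q (.reg .v))])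
    (fun i t => ∀ v, 0 ≤ v → v < i → t.arr .colour v = 0 ∧ t.arr .use v = s.arr .flow v)
    (x := 0) (y := N.n) rfl hN.n hn (by intros; omega) (by
      intro i t h0 h1 hF hI v hv0 hv1
      by_cases hv : v = i
      · subst hv
        simp [block_run_cons, block_run_nil, run_put, Store.setArr, Store.setReg, AExp.eval,
          hF.arr .Q rfl, hQ v h0 h1]
      · simpa [block_run_cons, block_run_nil, run_put, Store.setArr, Store.setReg, AExp.eval, hv]
          using hI v hv0 (by omega))
  generalize hs1 : Prog.run _ s = s1 at P1 ⊢
  have F1 := hs1 ▸ Frame.run _ s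
  have N1 : N.Loaded s1 := hN.of_frame F1 rfl
  have P2 := run_loop_put (A := .use) (ρ := .e) (a := .reg .n) (b := .reg .m) (j := .reg .e)
    (e := .get .flow (.reg .e)) (s := s1) N.n (N.n + N.r) 0 (s.arr .flow) N1.n N1.m (by omega)
    (fun t i _ => by simp [AExp.eval, Store.setReg]) (fun t i _ _ hF => by
      simp [AExp.eval, Store.setReg, hF.arr .flow rfl, F1.arr .flow rfl])
  generalize hs2 : Prog.run _ s1 = s2 at P2 ⊢
  have F2 := hs2 ▸ Frame.run _ s1
  have N2 : N.Loaded s2 := N1.of_frame F2 rfl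
  have key := Prog.run_loop (ρ := .j) (a := .lit 1) (b := .reg .k + .lit 1) (s := s2)
    (p := tracePath)
    -- On entry to iteration `j`, the paths `1, …, j - 1` are complete.
    (fun j t => N.Decomposition (s.arr .flow) (j - 1) N.r (t.arr .use) (t.arr .colour))
    (x := 1) (y := N.k + 1) rfl (by simp [AExp.eval, N2.k]) (by have := N.k_nonneg; omega) ?_ ?_
  · rw [add_sub_cancel_right] at key
    exact ⟨_, key⟩
  · refine hf.decomposition (fun e he => ?_) (fun v h0 h1 => ?_)
    · have hm := mem_arcs.1 he
      rw [P2]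
      split_ifs with h
      · rw [sub_zero]
      · exact (P1 e hm.1 (by omega)).2
    · rw [F2.arr .colour rfl, (P1 v h0 h1).1]
  · intro j t h0 h1 hF hI
    have hI' := hI.next (by omega)
    rw [sub_add_cancel] at hI'
    rw [add_sub_cancel_right]
    refine tracePath_run (N2.of_frame (hF.setReg j) rfl) (fun v hv0 hv1 => ?_) (by omega) (by omega)
      (by simp [Store.setReg]) hI'
    rw [← N.cap_vertex v hv0 hv1]
    exact hf.le_cap v (mem_arcs.2 (by omega))

end Network

/-! ### Flows carried by vertex sets -/

namespace Network

variable {N : Network}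

theorem sum_arcs {n : ℕ} (hn : N.n = n) (F : ℤ → ℤ) (hF : ∀ e ∈ N.arcs, N.n ≤ e → F e = 0) :
    ∑ e ∈ N.arcs, F e = ∑ v : Fin n, F (v : ℕ) := by
  have hr := N.r_nonneg
  refine (Finset.sum_of_injOn (fun v : Fin n => ((v : ℕ) : ℤ)) (fun u _ v _ h => ?_) (fun v _ => ?_)
    (fun e he hne => ?_) fun _ _ => rfl).symm
  · exact Fin.ext (by simpa using h)
  · exact mem_arcs.2 ⟨by simp, by have := v.isLt; simp only [hn]; omega⟩
  · refine hF e he ?_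
    by_contra! hlt
    obtain ⟨v, hv⟩ := exists_fin_eq (n := n) (mem_arcs.1 he).1 (by omega)
    exact hne ⟨v, by simp, hv⟩

/-- The indicator function of a vertex set on the arcs. -/
def indicator {n : ℕ} (S : Finset (Fin n)) (e : ℤ) : ℤ :=
  if h : e.toNat < n then if ⟨e.toNat, h⟩ ∈ S then 1 else 0 else 0

theorem indicator_coe {n : ℕ} (S : Finset (Fin n)) (v : Fin n) :
    indicator S (v : ℕ) = if v ∈ S then 1 else 0 := by
  simp [indicator]

theorem indicator_of_le {n : ℕ} (S : Finset (Fin n)) {e : ℤ} (h : n ≤ e) : indicator S e = 0 :=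
  dif_neg (by omega)

theorem indicator_bounds {n : ℕ} (S : Finset (Fin n)) (e : ℤ) :
    0 ≤ indicator S e ∧ indicator S e ≤ 1 := by
  unfold indicator
  split_ifs <;> omega

theorem cut_indicator {n : ℕ} (hn : N.n = n) (S : Finset (Fin n)) (i : ℤ) :
    N.cut (indicator S) i =
      ((S.filter fun v : Fin n => N.tail (v : ℕ) < i ∧ i ≤ N.head (v : ℕ)).card : ℤ) := by
  rw [cut, sum_arcs hn _ fun e _ h => by rw [indicator_of_le S (hn ▸ h), ite_self],
    Finset.card_filter, Nat.cast_sum, ← Finset.sum_subset (Finset.subset_univ S)]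
  · refine Finset.sum_congr rfl fun v hv => ?_
    rw [indicator_coe, if_pos hv]
    simp
  · intro v _ hv
    rw [indicator_coe, if_neg hv, ite_self]

/-- A vertex set that meets every cut at most `k` times is carried by a flow of value `k`. -/
theorem exists_isFlow {n : ℕ} (hn : N.n = n) (S : Finset (Fin n))
    (hS : ∀ i, 0 < i → i ≤ N.r → N.cut (indicator S) i ≤ N.k) :
    ∃ g, N.IsFlow g N.k ∧ ∀ v : Fin n, g (v : ℕ) = if v ∈ S then 1 else 0 := by
  have hn0 := N.n_nonneg
  -- The c-arc `n + i` is the only one across cut `i + 1`; it receives what `S` leaves free there.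
  set c : ℤ → ℤ := fun e => if e < N.n then 0 else N.k - N.cut (indicator S) (e - N.n + 1) with hc
  have hcut0 : ∀ i, 0 ≤ N.cut (indicator S) i := fun i => by
    rw [cut_indicator hn]; positivity
  have split : ∀ e ∈ N.arcs, e < N.n ∨ ∃ i, 0 ≤ i ∧ i < N.r ∧ e = N.n + i := by
    intro e he
    have := mem_arcs.1 he
    by_cases h : e < N.n
    · exact .inl h
    · exact .inr ⟨e - N.n, by omega, by omega, by omega⟩
  have hc1 : ∀ i, 0 ≤ i → c (N.n + i) = N.k - N.cut (indicator S) (i + 1) := fun i h0 => by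
    rw [hc]
    simp only
    rw [if_neg (by omega), add_sub_cancel_left]
  have hc0 : ∀ e, e < N.n → c e = 0 := fun e h => if_pos h
  refine ⟨fun e => indicator S e + c e, ⟨fun e he => ?_, fun e he => ?_, fun i h0 h1 => ?_⟩,
    fun v => ?_⟩
  · have := indicator_bounds S e
    rcases split e he with h | ⟨i, h0, h1, rfl⟩
    · rw [hc0 e h]; omega
    · rw [hc1 i h0]
      have := hS (i + 1) (by omega) (by omega)
      omega
  · have := indicator_bounds S e
    rcases split e he with h | ⟨i, h0, h1, rfl⟩
    · rw [hc0 e h, N.cap_vertex e (mem_arcs.1 he).1 h]; omega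
    · rw [hc1 i h0, N.cap_chain i h0 h1, indicator_of_le S (by omega)]
      have := hcut0 (i + 1)
      omega
  · have h2 : N.cut (fun e => indicator S e + c e) i = N.cut (indicator S) i + N.cut c i := by
      simp only [cut]
      rw [← Finset.sum_add_distrib]
      refine Finset.sum_congr rfl fun e _ => ?_
      split_ifs <;> simp
    have h3 : N.cut c i = c (N.n + (i - 1)) := by
      rw [cut, Finset.sum_eq_single (N.n + (i - 1))]
      · rw [N.tail_chain _ (by omega) (by omega), N.head_chain _ (by omega) (by omega),
          if_pos (by omega)]
      · intro e he hne
        rcases split e he with h | ⟨l, h4, h5, rfl⟩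
        · rw [hc0 e h, ite_self]
        · rw [N.tail_chain l h4 h5, N.head_chain l h4 h5, if_neg (by omega)]
      · intro h
        exact absurd (chain_mem (by omega) (by omega)) h
    rw [h2, h3, hc1 _ (by omega), sub_add_cancel]
    ring
  · have := v.isLt
    simp only
    rw [indicator_coe, hc0 _ (by omega), add_zero]

end Network

/-- A vertex set inducing a `k`-colourable subgraph meets every clique at most `k` times. -/
theorem card_filter_le_of_colorable {n k : ℕ} {G : SimpleGraph (Fin n)} {S : Finset (Fin n)}
    (hS : (G.induce (S : Set (Fin n))).Colorable k) (p : Fin n → Prop) [DecidablePred p]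
    (hp : ∀ u v, p u → p v → u ≠ v → G.Adj u v) : (S.filter p).card ≤ k := by
  classical
  have h : (G.induce (S : Set (Fin n))).IsClique
      ((S.filter p).subtype fun v => v ∈ (S : Set (Fin n)) : Finset _) := by
    intro u hu v hv huv
    rw [Finset.mem_coe, Finset.mem_subtype, Finset.mem_filter] at hu hv
    exact hp u v hu.2 hv.2 fun h => huv (Subtype.ext h)
  have := h.card_le_of_colorable hS
  rwa [Finset.card_subtype, Finset.filter_true_of_mem fun v hv =>
    Finset.mem_coe.2 (Finset.mem_filter.1 hv).1] at this

/-! ### Correctness of the algorithm -/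

section Main

variable {n k : ℕ} {G : SimpleGraph (Fin n)} {a b : Fin n → ℝ} {σ : Fin (2 * n) ≃ Fin n × Bool}
  (w : Fin n → ℕ)

/-- The network that the algorithm builds. -/
theorem exists_network (hG : IsIntervalModel G a b) (hσ : IsSortedEndpoints a b σ) (k : ℕ) :
    ∃ N : Network, N.Loaded (step2.run (step1.run (input σ w k))) ∧ N.n = n ∧
      N.r = turns σ (2 * n) ∧ N.k = k ∧ ∀ v : Fin n, N.tail (v : ℕ) = arcTail σ (v : ℕ) ∧
        N.head (v : ℕ) = arcHead σ (v : ℕ) ∧ N.wt (v : ℕ) = w v := by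
  have h1 := step1_run σ (fun v => (leftPos_lt_rightPos_iff hσ v v).2 (hG.1 v)) w k
  have F := Frame.run step1 (input σ w k)
  obtain ⟨N, h2, h3, h4, h5, h6⟩ := step2_run (n := n) (r := turns σ (2 * n)) (k := k)
    (lo := arcTail σ) (hi := arcHead σ) (s := step1.run (input σ w k))
    (F.reg .n rfl) h1.r (F.reg .k rfl) (by omega) (by omega) (by omega)
    (fun v _ _ => arcTail_nonneg σ v)
    (fun v h0 h1 => by
      obtain ⟨u, rfl⟩ := exists_fin_eq h0 h1
      exact (arcTail_lt_arcHead_iff hσ u u).2 (hG.1 u))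
    (fun v _ _ => arcHead_le σ v)
    (fun v c h2 h3 h4 h5 => by
      obtain ⟨u, rfl⟩ := exists_fin_eq h2 h3
      lift c to ℕ using h4
      exact h1.clique u c (by omega))
  refine ⟨N, h2, h3, h4, h5, fun v => ?_⟩
  have hv := v.isLt
  obtain ⟨h7, h8, h9⟩ := h6 (v : ℕ) (by omega) (by omega)
  refine ⟨h7, h8, ?_⟩
  rw [h9, F.arr .weight rfl]
  simp [input]

/-- Any competitor `S` becomes a `k`-flow `g` of the same weight; the computed flow is at least as
heavy by duality, and all vertices that carry it are coloured. -/
theorem isMaxWeightColouring (hG : IsIntervalModel G a b) (hσ : IsSortedEndpoints a b σ) :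
    IsMaxWeightColouring G w k (colourClasses n k (algorithm.run (input σ w k))) := by
  obtain ⟨N, N2, hn, -, hk, hv⟩ := exists_network w hG hσ k
  have hrun : algorithm.run (input σ w k) = step7.run (step6.run (step5.run (step4.run
      (step3.run (step2.run (step1.run (input σ w k))))))) := rfl
  rw [hrun]
  set s2 := step2.run (step1.run (input σ w k))
  have hpi := Network.step3_run N2
  have N3 : N.Loaded (step3.run s2) := N2.run rfl
  set s3 := step3.run s2
  have hW := Network.step4_run N3
  have N4 : N.Loaded (step4.run s3) := N3.run rfl
  set s4 := step4.run s3
  obtain ⟨hf, φ, hres⟩ := Network.step5_run N4 fun e he => by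
    have := hpi e he
    rw [hW e he]
    omega
  have N5 : N.Loaded (step5.run s4) := N4.run rfl
  set s5 := step5.run s4
  have hQ := Network.step6_run N5
  have N6 : N.Loaded (step6.run s5) := N5.run rfl
  have f6 : (step6.run s5).arr .flow = s5.arr .flow := (Frame.run step6 s5).arr .flow rfl
  set s6 := step6.run s5
  have hf01 : ∀ v, 0 ≤ v → v < N.n → 0 ≤ s5.arr .flow v ∧ s5.arr .flow v ≤ 1 := by
    intro v h0 h1
    have hr := N.r_nonneg
    have hm : v ∈ N.arcs := Network.mem_arcs.2 (by omega)
    rw [← N.cap_vertex v h0 h1]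
    exact ⟨hf.nonneg v hm, hf.le_cap v hm⟩
  obtain ⟨use, hD⟩ := Network.step7_run N6 (by rw [f6]; exact hf) (fun v h0 h1 => by
    have := hf01 v h0 h1
    rw [hQ v h0 h1, f6]
    split_ifs <;> omega)
  rw [f6] at hD
  set s7 := step7.run s6
  set f := s5.arr .flow
  have hvn : ∀ v : Fin n, (0 : ℤ) ≤ (v : ℕ) ∧ ((v : ℕ) : ℤ) < N.n := fun v => by
    have := v.isLt
    omega
  have hmem : ∀ i v, v ∈ colourClasses n k s7 i ↔ s7.arr .colour (v : ℕ) = (i : ℕ) + 1 := by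
    intro i v
    simp [colourClasses]
  have hdisj : ∀ i j, i ≠ j → Disjoint (colourClasses n k s7 i) (colourClasses n k s7 j) := by
    intro i j hij
    rw [Finset.disjoint_left]
    intro v hi hj
    rw [hmem] at hi hj
    exact hij (Fin.ext (by omega))
  refine ⟨hdisj, fun i u hu v hv' huv hadj => ?_, fun S hS => ?_⟩
  · have hu := (hmem i u).1 hu
    have hv' := (hmem i v).1 hv'
    have h1 := hD.disjoint (u : ℕ) (v : ℕ) (hvn u).1 (hvn u).2 (hvn v).1 (hvn v).2
      (fun h => huv (Fin.ext (by omega))) (by omega) (by omega)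
    have h2 := ((adj_iff_arcs_overlap hG hσ u v).1 hadj).2
    rw [(hv u).1, (hv u).2.1, (hv v).1, (hv v).2.1] at h1
    omega
  · obtain ⟨g, hg, hgv⟩ := Network.exists_isFlow hn S fun i h0 h1 => by
      rw [Network.cut_indicator hn, hk, Nat.cast_le]
      -- Arcs across the same cut overlap, so their vertices are pairwise adjacent.
      refine card_filter_le_of_colorable hS
        (fun v => N.tail (v : ℕ) < i ∧ i ≤ N.head (v : ℕ)) fun u v hu hv' huv => ?_
      rw [adj_iff_arcs_overlap hG hσ, ← (hv u).1, ← (hv u).2.1, ← (hv v).1, ← (hv v).2.1]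
      exact ⟨huv, by omega, by omega⟩
    -- Substituting the weights of `N^U`, the reduced cost with respect to `φ` equals the drop of `π
    -- + φ` minus `w_N`. Forward residual arcs give the first slackness condition, backward ones the
    -- second.
    have hopt := hf.optimal hg (Φ := fun v => s3.arr .pi v + φ v)
      (fun e he h => by
        have h1 := hres e _ _ _ ⟨he, .inl ⟨rfl, rfl, h, rfl⟩⟩
        rw [hW e he] at h1
        omega)
      (fun e he h => by
        have h1 := hres e _ _ _ ⟨he, .inr ⟨rfl, rfl, h, rfl⟩⟩
        rw [hW e he] at h1
        omega)
    have hchain : ∀ e ∈ N.arcs, N.n ≤ e → N.wt e = 0 := by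
      intro e he h
      have h1 := Network.mem_arcs.1 he
      have := N.wt_chain (e - N.n) (by omega) (by omega)
      rwa [add_sub_cancel] at this
    rw [Network.sum_arcs hn _ fun e he h => by rw [hchain e he h, zero_mul],
      Network.sum_arcs hn _ fun e he h => by rw [hchain e he h, zero_mul]] at hopt
    have hleft : ∑ v : Fin n, N.wt (v : ℕ) * g (v : ℕ) = ((∑ v ∈ S, w v : ℕ) : ℤ) := by
      rw [Nat.cast_sum, ← Finset.sum_subset (Finset.subset_univ S)]
      · exact Finset.sum_congr rfl fun v h => by rw [hgv, if_pos h, (hv v).2.2, mul_one]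
      · intro v _ h
        rw [hgv, if_neg h, mul_zero]
    -- Uncoloured vertices carry no flow and coloured ones at most one unit, so this inequality
    -- suffices.
    have hright : ∑ v : Fin n, N.wt (v : ℕ) * f (v : ℕ) ≤
        ((∑ i, ∑ v ∈ colourClasses n k s7 i, w v : ℕ) : ℤ) := by
      rw [← Finset.sum_biUnion fun i _ j _ hij => hdisj i j hij, Nat.cast_sum,
        ← Finset.sum_subset (Finset.subset_univ (Finset.univ.biUnion (colourClasses n k s7)))]
      · refine Finset.sum_le_sum fun v _ => ?_
        rw [(hv v).2.2]
        have := hf01 (v : ℕ) (hvn v).1 (hvn v).2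
        nlinarith
      · intro v _ h
        have h1 : ¬ 0 < f (v : ℕ) := fun h1 => h (by
          have h2 := hD.colour_pos (hvn v).1 (hvn v).2 h1
          rw [hk] at h2
          refine Finset.mem_biUnion.2 ⟨⟨(s7.arr .colour (v : ℕ)).toNat - 1, by omega⟩,
            Finset.mem_univ _, (hmem _ _).2 ?_⟩
          simp only
          omega)
        have := hf01 (v : ℕ) (hvn v).1 (hvn v).2
        rw [show f (v : ℕ) = 0 by omega, mul_zero]
    rw [hleft] at hopt
    exact_mod_cast hopt.trans hright

end Main

/-! ## The running time -/

section Time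

variable {s : Store} {n r k : ℕ}

theorem toNat_cast_add (a b : ℕ) : ((a : ℤ) + b).toNat = a + b := by omega

theorem step1_time (hn : s.reg .n = n) (h1 : 1 ≤ n) : step1.time s ≤ 200 * n ^ 2 := by
  -- The list `X` names the registers that determine the loop ranges; `decide` checks on the program
  -- text that none of them is assigned.
  refine (Prog.time_le_bound (X := [.n]) (s := s) (by decide) s fun _ _ => rfl).trans ?_
  simp [step1, block, when, Prog.bound, AExp.cost, Cond.cost, AExp.eval, hn,
    toNat_cast_add]
  nlinarith

theorem step2_time (hn : s.reg .n = n) (hr : s.reg .r = r) (h1 : 1 ≤ n) (h2 : r ≤ n) :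
    step2.time s ≤ 200 * n ^ 2 := by
  refine (Prog.time_le_bound (X := [.n, .r]) (s := s) (by decide) s fun _ _ => rfl).trans ?_
  simp [step2, block, when, Prog.bound, AExp.cost, Cond.cost, AExp.cost_sub,
    AExp.eval, hn, hr]
  nlinarith [Nat.mul_le_mul_right n h2]

theorem step3_time (hr : s.reg .r = r) (hm : s.reg .m = n + r) (h1 : 1 ≤ n)
    (h2 : r ≤ n) : step3.time s ≤ 200 * n ^ 2 := by
  refine (Prog.time_le_bound (X := [.r, .m]) (s := s) (by decide) s fun _ _ => rfl).trans ?_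
  simp [step3, block, when, Prog.bound, AExp.cost, Cond.cost, AExp.cost_sub,
    AExp.eval, hr, hm, toNat_cast_add]
  nlinarith [Nat.mul_le_mul_right n h2, Nat.mul_le_mul h2 h2]

theorem step4_time (hm : s.reg .m = n + r) (h1 : 1 ≤ n)
    (h2 : r ≤ n) : step4.time s ≤ 200 * n ^ 2 := by
  refine (Prog.time_le_bound (X := [.m]) (s := s) (by decide) s fun _ _ => rfl).trans ?_
  simp [step4, Prog.bound, AExp.cost, AExp.cost_sub, AExp.eval, hm, toNat_cast_add]
  nlinarith

theorem step5_time (hr : s.reg .r = r) (hm : s.reg .m = n + r) (hk : s.reg .k = k) (h1 : 1 ≤ n)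
    (h2 : r ≤ n) (h3 : 1 ≤ k) : step5.time s ≤ 2000 * (k * n ^ 2) := by
  refine (Prog.time_le_bound (X := [.r, .m, .k]) (s := s) (by decide) s fun _ _ => rfl).trans ?_
  simp [step5, shortestPaths, relax, augment, incr, block, when, Prog.bound, AExp.cost, Cond.cost,
    AExp.cost_sub, AExp.eval, hr, hm, hk, toNat_cast_add]
  -- The bound for one of the `k` rounds, as `Prog.bound` computes it. The nested products come from
  -- Dijkstra's algorithm: `r + 1` rounds, each scanning all nodes and all `n + r` arcs.
  have h4 : 2 + (5 + (r + 1) * 8 +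
      (3 + (5 + (r + 1) * (2 + (2 + (5 + (r + 1) * 28 + (4 + (3 + (3 + (n + r) * 113) + 1))))))) +
        (5 + (r + 1) * 15 + (2 + (3 + r * 33)))) ≤ 1800 * n ^ 2 := by
    nlinarith [Nat.mul_le_mul_right n h2, Nat.mul_le_mul h2 h2]
  have h5 := Nat.mul_le_mul_left k h4
  have h6 : n ^ 2 ≤ k * n ^ 2 := Nat.le_mul_of_pos_left _ h3
  nlinarith

theorem step6_time (hn : s.reg .n = n) (h1 : 1 ≤ n) : step6.time s ≤ 200 * n ^ 2 := by
  refine (Prog.time_le_bound (X := [.n]) (s := s) (by decide) s fun _ _ => rfl).trans ?_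
  simp [step6, Prog.bound, AExp.cost, Cond.cost, AExp.eval, hn]
  nlinarith

theorem step7_time (hn : s.reg .n = n) (hr : s.reg .r = r) (hm : s.reg .m = n + r)
    (hk : s.reg .k = k) (h1 : 1 ≤ n) (h2 : r ≤ n) (h3 : 1 ≤ k) :
    step7.time s ≤ 2000 * (k * n ^ 2) := by
  refine (Prog.time_le_bound (X := [.n, .r, .m, .k]) (s := s) (by decide) s fun _ _ => rfl).trans ?_
  simp [step7, incr, block, when, Prog.bound, AExp.cost, Cond.cost, AExp.eval, hn,
    hr, hm, hk, toNat_cast_add]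
  have h4 : 2 + (2 + (3 + r * (2 + (4 + (2 + (3 + (n + r) * 36) + 1))))) ≤ 1800 * n ^ 2 := by
    nlinarith [Nat.mul_le_mul_right n h2, Nat.mul_le_mul h2 h2]
  have h5 := Nat.mul_le_mul_left k h4
  have h6 : n ^ 2 ≤ k * n ^ 2 := Nat.le_mul_of_pos_left _ h3
  nlinarith

/-- Five steps cost at most `200 n²` each, and steps 5 and 7 at most `2000 k n²` each, which adds up
to `5000 k n²`. -/
theorem algorithm_time {G : SimpleGraph (Fin n)} {a b : Fin n → ℝ}
    {σ : Fin (2 * n) ≃ Fin n × Bool} (w : Fin n → ℕ) (hG : IsIntervalModel G a b)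
    (hσ : IsSortedEndpoints a b σ) (hn : 1 ≤ n) (hk : 1 ≤ k) :
    algorithm.time (input σ w k) ≤ 5000 * (k * n ^ 2) := by
  obtain ⟨N, N2, hNn, hNr, hNk, -⟩ := exists_network w hG hσ k
  have hr : turns σ (2 * n) ≤ n := turns_le σ
  have F1 := Frame.run step1 (input σ w k)
  have hn1 : (step1.run (input σ w k)).reg .n = n := F1.reg .n rfl
  have hr1 : (step1.run (input σ w k)).reg .r = turns σ (2 * n) :=
    (step1_run σ (fun v => (leftPos_lt_rightPos_iff hσ v v).2 (hG.1 v)) w k).r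
  have ht1 := step1_time (s := input σ w k) rfl hn
  have ht2 := step2_time hn1 hr1 hn hr
  change step1.time (input σ w k) + (step2.time (step1.run (input σ w k)) + _) ≤ _
  set s2 := step2.run (step1.run (input σ w k))
  have regs : ∀ s, N.Loaded s → s.reg .n = n ∧ s.reg .r = turns σ (2 * n) ∧
      s.reg .m = n + turns σ (2 * n) ∧ s.reg .k = k := fun s h =>
    ⟨h.n.trans hNn, h.r.trans hNr, by rw [h.m, hNn, hNr], h.k.trans hNk⟩
  have N3 : N.Loaded (step3.run s2) := N2.run rfl
  have N4 : N.Loaded (step4.run (step3.run s2)) := N3.run rfl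
  have N5 : N.Loaded (step5.run (step4.run (step3.run s2))) := N4.run rfl
  have N6 : N.Loaded (step6.run (step5.run (step4.run (step3.run s2)))) := N5.run rfl
  obtain ⟨-, a3, b3, -⟩ := regs _ N2
  obtain ⟨-, -, b4, -⟩ := regs _ N3
  obtain ⟨-, a5, b5, c5⟩ := regs _ N4
  obtain ⟨a6, -, -, -⟩ := regs _ N5
  obtain ⟨a7, b7, c7, d7⟩ := regs _ N6
  have ht3 := step3_time a3 b3 hn hr
  have ht4 := step4_time b4 hn hr
  have ht5 := step5_time a5 b5 c5 hn hr hk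
  have ht6 := step6_time a6 hn
  have ht7 := step7_time a7 b7 c7 d7 hn hr hk
  have h6 : n ^ 2 ≤ k * n ^ 2 := Nat.le_mul_of_pos_left _ hk
  change _ + (_ + (step3.time s2 + (step4.time (step3.run s2) + (step5.time _ + (step6.time _ +
    step7.time _))))) ≤ _
  omega

end Time
end MWKF

theorem theorem4 :
    ∃ C : ℕ, ∀ (n k M : ℕ), 1 ≤ n → 1 ≤ k → 1 ≤ M →
      ∀ (G : SimpleGraph (Fin n)) (a b : Fin n → ℝ) (σ : Fin (2 * n) ≃ Fin n × Bool)
        (w : Fin n → ℕ),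
        MWKF.IsIntervalModel G a b → MWKF.IsSortedEndpoints a b σ → (∀ v, w v ≤ M) →
          MWKF.IsMaxWeightColouring G w k
            (MWKF.colourClasses n k (MWKF.algorithm.run (MWKF.input σ w k))) ∧
          MWKF.algorithm.time (MWKF.input σ w k) ≤ C * (k * M * n ^ 2) := by
  refine ⟨5000, fun n k M hn hk hM G a b σ w hG hσ _ => ⟨MWKF.isMaxWeightColouring w hG hσ,
    (MWKF.algorithm_time w hG hσ hn hk).trans (Nat.mul_le_mul_left _ ?_)⟩⟩
  -- The bound `k n²` passes to `k M n²` because `M ≥ 1`.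
  exact Nat.mul_le_mul_right _ (Nat.le_mul_of_pos_right k hM)
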